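/- Let $p\in[1,\infty)$. Let $\mu$ and $\mu_\varepsilon$ be probability measures on $\mathbb R$ ($\mu$ unknown, $\mu_\varepsilon$ known). One observes $Y_i=X_i+\varepsilon_i$, $i=1,\dots,n$, where $X_1,\dots,X_n$ are i.i.d. with law $\mu$, $\varepsilon_1,\dots,\varepsilon_n$ are i.i.d. with law $\mu_\varepsilon$, and $(X_1,\dots,X_n)$ is independent of $(\varepsilon_1,\dots,\varepsilon_n)$; $Y$ denotes a variable with the common law $\mu\star\mu_\varepsilon$ of the $Y_i$. Write $\mu_\varepsilon^*(t)=\int e^{itu}\mu_\varepsilon(du)$ and $f^*(t)=\int e^{itu}f(u)\,du$. For probability measures $\nu,\nu'$ on $\mathbb R$ let $W_p(\nu,\nu')=\inf_\pi\big(\int|x-y|^p\,\pi(dx,dy)\big)^{1/p}$, the infimum being over all couplings $\pi$ of $\nu$ and $\nu'$. Let $m_0$ be the least integer strictly greater than $p+\frac12$ and $m_1$ the least integer strictly greater than $p-\frac12$. *The estimator.* Let $k\ge 0$ be a symmetric function with $\int k=1$ whose Fourier transform $k^*$ is supported on $[-1,1]$ and is $\lceil p\rceil$ times differentiable with Lipschitz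 $\lceil p\rceil$-th derivative. Assume that $\mu_\varepsilon^*$ does not vanish. For a bandwidth $h>0$ put $$\tilde k_h(x)=\frac1{2\pi}\int\frac{e^{iux}k^*(u)}{\mu_\varepsilon^*(-u/h)}\,du,\qquad \hat F_n(t)=\frac1{nh}\int_{-\infty}^t\sum_{i=1}^n\tilde k_h\Big(\frac{u-Y_i}h\Big)du .$$ Given $\rho\ge 0$, let $\tilde\mu_n$ be a (random) probability measure whose distribution function $\tilde F_n$ satisfies, for every distribution function $G$, $$\int|x|^{p-1}|\hat F_n-\tilde F_n|(x)\,dx\le\int|x|^{p-1}|\hat F_n-G|(x)\,dx+\rho .$$ *Assumptions.* Let $r_\varepsilon=1/\mu_\varepsilon^*$ be twice continuously differentiable and $m_1$ times differentiable on $\mathbb R$, and $m_0$ times differentiable at every point of $[-2,2]$, and assume that $$\int_0^\infty x^{p-1}\sqrt{P(|Y|\ge x)}\,dx<\infty\quad\text{and}\quad\sup_{t\in[-2,2]}|r_\varepsilon^{(m_0)}(t)|<\infty .$$ (1) (Supersmooth case.) Assume that there are $\beta>0$, $\tilde\beta\ge0$, $\gamma>0$, $c>0$ with $|r_\varepsilon^{(\ell)}(t)|\le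 c(1+|t|)^{\tilde\beta}\exp(|t|^\beta/\gamma)$ for all $\ell\in\{0,\dots,m_1\}$ and $t\in\mathbb R$. Then there is a constant $C>0$ such that for every $n\ge2$ and every $0\le\rho\le n^{-1/2}$, the estimator with bandwidth $h=(4/(\gamma\log n))^{1/\beta}$ satisfies $$\mathbb E\,W_p^p(\tilde\mu_n,\mu)\le C(\log n)^{-p/\beta}.$$ (2) (Ordinary smooth case.) Assume that there are $\beta>0$, $c>0$ with $|r_\varepsilon^{(\ell)}(t)|\le c(1+|t|)^{\beta}$ for all $\ell\in\{0,\dots,m_1\}$ and $t\in\mathbb R$. Then there is a constant $C>0$ such that for every $n\ge2$ and every $0\le\rho\le n^{-1/2}$, the estimator with bandwidth $h=n^{-1/(2p+(2\beta-1)_+)}$ satisfies $\mathbb E\,W_p^p(\tilde\mu_n,\mu)\le C\psi_n$, where $$\psi_n=\begin{cases}n^{-p/(2p+2\beta-1)}&\text{if }\beta>\frac12,\\ \sqrt{\log n/n}&\text{if }\beta=\frac12,\\ n^{-1/2}&\text{if }\beta<\frac12.\end{cases}$$ In both cases $C$ does not depend on $n$, on $\rho$, on the probability space, or on the choice of the approximate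 minimizer $\tilde\mu_n$. -/

import Mathlib

open MeasureTheory ProbabilityTheory Set
open scoped ENNReal NNReal

noncomputable section

namespace WassersteinDeconvolution

/-- The Wasserstein distance of order `p` between two probability measures on the line: the infimum
of `(∫ |x - y| ^ p dπ(x, y)) ^ (1 / p)` over all couplings `π`, with values in `[0, ∞]`. -/
def wasserstein (p : ℝ) (μ ν : Measure ℝ) : ℝ≥0∞ :=
  ⨅ π : {π : Measure (ℝ × ℝ) // π.fst = μ ∧ π.snd = ν},
    (∫⁻ z, ENNReal.ofReal (|z.1 - z.2| ^ p) ∂π.1) ^ (1 / p)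

/-- The Fourier transform `x ↦ ∫ e^{iux} f(u) du` of a function. -/
def fourierStar (f : ℝ → ℝ) (x : ℝ) : ℂ :=
  ∫ u : ℝ, Complex.exp (Complex.I * u * x) * (f u : ℂ)

/-- The function `r = 1 / μ_ε^*`, where `μ_ε^*` is the characteristic function of the noise. -/
def invCharFun (με : Measure ℝ) (t : ℝ) : ℂ := 1 / charFun με t

/-- The least integer strictly greater than `p + 1/2`. -/
def mZero (p : ℝ) : ℕ := ⌊p + 1 / 2⌋₊ + 1

/-- The least integer strictly greater than `p - 1/2`. -/
def mOne (p : ℝ) : ℕ := ⌊p - 1 / 2⌋₊ + 1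

/-- Admissible kernels: symmetric probability densities whose Fourier transform is supported on
`[-1, 1]` and is `⌈p⌉` times differentiable with a Lipschitz `⌈p⌉`-th derivative. (As the last
derivative is Lipschitz, hence continuous, this is `ContDiff` of order `⌈p⌉`.) -/
structure IsKernel (p : ℝ) (k : ℝ → ℝ) : Prop where
  symm : ∀ x, k (-x) = k x
  nonneg : ∀ x, 0 ≤ k x
  integrable : Integrable k
  integral_eq_one : ∫ x, k x = 1
  contDiff : ContDiff ℝ (⌈p⌉₊ : ℕ) (fourierStar k)
  lipschitz : ∃ L : ℝ≥0, LipschitzWith L (iteratedDeriv ⌈p⌉₊ (fourierStar k))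
  support : ∀ u, u ∉ Icc (-1 : ℝ) 1 → fourierStar k u = 0

/-- The deconvolution kernel `x ↦ (2π)⁻¹ ∫ e^{iux} k^*(u) / μ_ε^*(-u/h) du`; the integral is a real
number by symmetry, and we take its real part to obtain an element of `ℝ`. -/
def deconvKernel (k : ℝ → ℝ) (με : Measure ℝ) (h x : ℝ) : ℝ :=
  ((1 / (2 * Real.pi) : ℂ) *
    ∫ u : ℝ, Complex.exp (Complex.I * u * x) * fourierStar k u / charFun με (-u / h)).re

/-- The preliminary estimator `F̂ₙ` of the distribution function of `μ`, from the observations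
`y 0, …, y (n - 1)` and with bandwidth `h`. -/
def prelimCDF (k : ℝ → ℝ) (με : Measure ℝ) (h : ℝ) {n : ℕ} (y : Fin n → ℝ) (t : ℝ) : ℝ :=
  1 / (n * h) * ∫ u in Iic t, ∑ i, deconvKernel k με h ((u - y i) / h)

/-- The loss `∫ |x| ^ (p - 1) |F(x) - G(x)| dx`, with values in `[0, ∞]`. -/
def cdfLoss (p : ℝ) (F G : ℝ → ℝ) : ℝ≥0∞ :=
  ∫⁻ x, ENNReal.ofReal (|x| ^ (p - 1) * |F x - G x|)

/-- `ν` is a probability measure whose distribution function minimizes, up to `ρ`, the loss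
`∫ |x| ^ (p - 1) |F(x) - G(x)| dx` over all distribution functions `G`. -/
def IsIsotoneApprox (p ρ : ℝ) (F : ℝ → ℝ) (ν : Measure ℝ) : Prop :=
  IsProbabilityMeasure ν ∧
    ∀ G : Measure ℝ, IsProbabilityMeasure G →
      cdfLoss p F (cdf ν) ≤ cdfLoss p F (cdf G) + ENNReal.ofReal ρ

/-- The convolution model: `X 0, …, X (n - 1)` are i.i.d. of law `μ`, `ε 0, …, ε (n - 1)` are i.i.d.
of law `με`, and the two families are independent of each other. -/
structure IsConvolutionSample {Ω : Type*} [MeasurableSpace Ω] (P : Measure Ω) (μ με : Measure ℝ)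
    {n : ℕ} (X ε : Fin n → Ω → ℝ) : Prop where
  measurable_signal : ∀ i, Measurable (X i)
  measurable_noise : ∀ i, Measurable (ε i)
  law_signal : ∀ i, P.map (X i) = μ
  law_noise : ∀ i, P.map (ε i) = με
  indep_signal : iIndepFun X P
  indep_noise : iIndepFun ε P
  indep : IndepFun (fun ω i => X i ω) (fun ω i => ε i ω) P

/-- `μt` is (a version of) the isotone deconvolution estimator of order `p`, kernel `k`,
bandwidth `h` and tolerance `ρ`, computed from the observations `Y i = X i + ε i`. -/
def IsIsotoneEstimator {Ω : Type*} (p ρ : ℝ) (k : ℝ → ℝ) (με : Measure ℝ) (h : ℝ) {n : ℕ}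
    (X ε : Fin n → Ω → ℝ) (μt : Ω → Measure ℝ) : Prop :=
  ∀ ω, IsIsotoneApprox p ρ (prelimCDF k με h (fun i => X i ω + ε i ω)) (μt ω)

/-- The rate in the ordinary smooth case. -/
def ordinaryRate (p β : ℝ) (n : ℕ) : ℝ :=
  if 1 / 2 < β then (n : ℝ) ^ (-(p / (2 * p + 2 * β - 1)))
  else if β = 1 / 2 then √(Real.log n / n)
  else 1 / √n

end WassersteinDeconvolution

end

/-!
On the line `W_p ^ p ≤ C ∫ |x| ^ (p - 1) |F - G| dx` for two laws with distribution functions `F`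
and `G`, so the weighted `L¹` distance controls the risk. Let `k_h` be the law with density
`k (· / h) / h`. Smoothing moves `μ` by at most a multiple of `h ^ p` in `W_p ^ p`, and the
preliminary estimator is an unbiased estimator of the distribution function of `μ ∗ k_h`, since
dividing by `με^*` undoes the noise. By the triangle inequality and the minimality of the isotone
approximation only the fluctuations of the preliminary estimator remain. It is an average of
pairwise independent terms `G_h (x - Y i)`, so its `L¹(Ω)` error at `x` is at most `n ^ (-1/2)`
times the `L²` norm of `G_h (x - Y)`, centred at `0` for `x < 0` and at `1` for `x ≥ 0`.

The Fourier transform of `G_h` has a pole at the origin, coming from the integration. A smooth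
cutoff splits it. The low frequencies are the primitive of a density with `m_0` bounded Fourier
derivatives, hence with enough weighted moments to be integrated against `|x| ^ (p - 1)`, and
contribute `O(1)`. The high frequencies have an honest Fourier transform, of size
`|r(w)| / (1 + |w|)` up to the order `m_1` and supported in `[-1 / h, 1 / h]`; Plancherel's identity
bounds the moments of their square by `∫ (b(w) / (1 + |w|)) ^ 2 dw` over that interval, `b` being
the bound on the derivatives of `r`. The two cases of the theorem evaluate this integral and balance
it against `h ^ p`.
-/

noncomputable section

namespace WassersteinDeconvolution

open Filter Topology FourierTransform SchwartzMap ComplexConjugate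

/-! ### The inverse Fourier transform -/

section plancherel

variable {V E : Type*} [NormedAddCommGroup V] [InnerProductSpace ℝ V] [FiniteDimensional ℝ V]
  [MeasurableSpace V] [BorelSpace V] [NormedAddCommGroup E] [InnerProductSpace ℂ E]
  [CompleteSpace E] {f : V → E}

theorem fourier_toLp_ae_eq (h₁ : Integrable f) (h₂ : MemLp f 2) :
    (𝓕 (h₂.toLp f) : Lp (α := V) E 2) =ᵐ[volume] 𝓕 f := by
  refine ae_eq_of_integral_contDiff_smul_eq ((Lp.memLp _).locallyIntegrable (by norm_num))
    (VectorFourier.fourierIntegral_continuous Real.continuous_fourierChar continuous_inner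
      h₁).locallyIntegrable fun g hg hgc => ?_
  let η : 𝓢(V, ℂ) := HasCompactSupport.toSchwartzMap (f := fun x => (g x : ℂ))
    (hgc.comp_left (g := ((↑) : ℝ → ℂ)) rfl) (Complex.ofRealCLM.contDiff.comp hg)
  have hη : ∀ F : V → E, ∫ x, g x • F x = ∫ x, η x • F x := fun F =>
    integral_congr_ae (.of_forall fun x => (Complex.coe_smul (g x) (F x)).symm)
  have htempered := congrArg (fun T => T η) (Lp.fourier_toTemperedDistribution_eq (h₂.toLp f))
  simp only [TemperedDistribution.fourier_apply, Lp.toTemperedDistribution_apply] at htempered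
  have hflip := VectorFourier.integral_fourierIntegral_smul_eq_flip (L := innerₗ V)
    Real.continuous_fourierChar continuous_inner (η.integrable (μ := volume)) h₁
  rw [flip_innerₗ] at hflip
  calc ∫ x, g x • (𝓕 (h₂.toLp f) : Lp E 2 (volume : Measure V)) x
      = ∫ x, 𝓕 η x • h₂.toLp f x := by rw [hη, htempered]
    _ = ∫ x, 𝓕 (η : V → ℂ) x • f x := by
        refine integral_congr_ae ?_
        filter_upwards [h₂.coeFn_toLp] with x hx
        rw [hx, SchwartzMap.fourier_coe]
    _ = ∫ x, g x • 𝓕 f x := hflip.trans (hη _).symm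

theorem eLpNorm_fourier_eq (h₁ : Integrable f) (h₂ : MemLp f 2) :
    eLpNorm (𝓕 f) 2 volume = eLpNorm f 2 volume := by
  have hnorm := Lp.norm_fourier_eq (h₂.toLp f)
  rw [Lp.norm_def, Lp.norm_def] at hnorm
  rw [← eLpNorm_congr_ae (fourier_toLp_ae_eq h₁ h₂), ← eLpNorm_congr_ae h₂.coeFn_toLp]
  exact (ENNReal.toReal_eq_toReal_iff' (Lp.eLpNorm_ne_top _) (Lp.eLpNorm_ne_top _)).1 hnorm

theorem lintegral_enorm_sq_fourier (h₁ : Integrable f) (h₂ : MemLp f 2) :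
    ∫⁻ v, ‖𝓕 f v‖ₑ ^ 2 = ∫⁻ w, ‖f w‖ₑ ^ 2 := by
  have hpow : ∀ g : V → E, eLpNorm g 2 volume ^ 2 = ∫⁻ v, ‖g v‖ₑ ^ 2 := fun g => by
    simpa using eLpNorm_nnreal_pow_eq_lintegral (f := g) (μ := volume) (p := 2) two_ne_zero
  rw [← hpow, ← hpow, eLpNorm_fourier_eq h₁ h₂]

end plancherel

/-- The inverse Fourier transform `v ↦ (2π)⁻¹ ∫ e^{-iwv} f(w) dw` for the convention
`f^*(t) = ∫ e^{itu} f(u) du`, expressed through Mathlib's `𝓕`, whose character is `e^{-2πiwv}`. -/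
def invFourier (f : ℝ → ℂ) (v : ℝ) : ℂ := (1 / (2 * Real.pi) : ℂ) * 𝓕 f (v / (2 * Real.pi))

theorem ofReal_pi_ne_zero : (Real.pi : ℂ) ≠ 0 := Complex.ofReal_ne_zero.2 Real.pi_ne_zero

section invFourier

variable {f g : ℝ → ℂ}

theorem invFourier_eq_integral (f : ℝ → ℂ) (v : ℝ) :
    invFourier f v =
      (1 / (2 * Real.pi) : ℂ) * ∫ w : ℝ, Complex.exp (-(Complex.I * w * v)) * f w := by
  have hpi := ofReal_pi_ne_zero
  rw [invFourier, Real.fourier_real_eq_integral_exp_smul]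
  congr 1
  refine integral_congr_ae (.of_forall fun w => ?_)
  simp only [smul_eq_mul]
  congr 2
  push_cast
  field_simp

theorem continuous_invFourier (hf : Integrable f) : Continuous (invFourier f) := by
  have : Continuous (𝓕 f) := VectorFourier.fourierIntegral_continuous
    Real.continuous_fourierChar (by fun_prop) hf
  unfold invFourier
  fun_prop

theorem tendsto_invFourier_atBot (f : ℝ → ℂ) : Tendsto (invFourier f) atBot (𝓝 0) := by
  have hfourier : Tendsto (𝓕 f) atBot (𝓝 0) :=
    (Real.zero_at_infty_fourier f).mono_left (by rw [cocompact_eq_atBot_atTop]; exact le_sup_left)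
  have hscale : Tendsto (fun v : ℝ => v / (2 * Real.pi)) atBot atBot :=
    tendsto_id.atBot_div_const (by positivity)
  unfold invFourier
  simpa using (hfourier.comp hscale).const_mul (1 / (2 * Real.pi) : ℂ)

theorem invFourier_add (hf : Integrable f) (hg : Integrable g) (v : ℝ) :
    invFourier (fun w => f w + g w) v = invFourier f v + invFourier g v := by
  have hadd : 𝓕 (f + g) = 𝓕 f + 𝓕 g :=
    VectorFourier.fourierIntegral_add Real.continuous_fourierChar (by fun_prop) hf hg
  change (1 / (2 * Real.pi) : ℂ) * 𝓕 (f + g) (v / (2 * Real.pi)) = _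
  rw [hadd, Pi.add_apply, mul_add, invFourier, invFourier]

theorem conj_invFourier (hf : ∀ w, conj (f (-w)) = f w) (v : ℝ) :
    conj (invFourier f v) = invFourier f v := by
  rw [invFourier_eq_integral, map_mul, ← integral_conj, ← integral_neg_eq_self]
  congr 1
  · simp [Complex.conj_ofNat]
  · refine integral_congr_ae (.of_forall fun w => ?_)
    simp only [map_mul, ← Complex.exp_conj, map_neg, Complex.conj_I, Complex.conj_ofReal, hf]
    push_cast
    congr 2
    ring

theorem invFourier_deriv (hf : Integrable f) (hd : Differentiable ℝ f)
    (hf' : Integrable (deriv f)) (v : ℝ) :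
    invFourier (deriv f) v = Complex.I * v * invFourier f v := by
  have hpi := ofReal_pi_ne_zero
  rw [invFourier, Real.fourier_deriv hf hd hf', invFourier]
  simp only [smul_eq_mul]
  push_cast
  field_simp

theorem hasDerivAt_invFourier (hf : Integrable f)
    (hf' : Integrable fun w : ℝ => (w : ℂ) * f w) (v : ℝ) :
    HasDerivAt (invFourier f) (invFourier (fun w => -Complex.I * w * f w) v) v := by
  have hpi := ofReal_pi_ne_zero
  have hfourier := Real.hasDerivAt_fourier hf (by simpa using hf') (v / (2 * Real.pi))
  have hscaled : HasDerivAt (invFourier f) _ v :=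
    (hfourier.scomp v ((hasDerivAt_id v).div_const (2 * Real.pi))).const_mul
      (1 / (2 * Real.pi) : ℂ)
  convert hscaled using 1
  rw [invFourier, Real.fourier_real_eq_integral_exp_smul, Real.fourier_real_eq_integral_exp_smul,
    Complex.real_smul]
  congr 1
  rw [← integral_const_mul]
  refine integral_congr_ae (.of_forall fun w => ?_)
  simp only [smul_eq_mul]
  push_cast
  field_simp

theorem integral_exp_mul_invFourier (hc : Continuous f) (hf : Integrable f)
    (hi : Integrable (invFourier f)) (t : ℝ) :
    ∫ v : ℝ, Complex.exp (Complex.I * t * v) * invFourier f v = f t := by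
  have hpi := ofReal_pi_ne_zero
  have h2pi : (2 * Real.pi : ℝ) ≠ 0 := by positivity
  have hfourier : Integrable (𝓕 f) := by
    refine ((hi.comp_mul_left' h2pi).const_mul (2 * Real.pi : ℂ)).congr (.of_forall fun x => ?_)
    simp only [invFourier]
    rw [mul_div_cancel_left₀ _ h2pi]
    field_simp
  have hscale := Measure.integral_comp_div
    (fun s : ℝ => Complex.exp (((-2 * Real.pi * s * -t : ℝ) : ℂ) * Complex.I) • 𝓕 f s) (2 * Real.pi)
  rw [abs_of_pos (by positivity)] at hscale
  calc ∫ v : ℝ, Complex.exp (Complex.I * t * v) * invFourier f v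
      = ∫ v : ℝ, (1 / (2 * Real.pi) : ℂ) * (Complex.exp
          (((-2 * Real.pi * (v / (2 * Real.pi)) * -t : ℝ) : ℂ) * Complex.I) •
            𝓕 f (v / (2 * Real.pi))) := by
        refine integral_congr_ae (.of_forall fun v => ?_)
        simp only [invFourier, smul_eq_mul]
        rw [mul_left_comm]
        congr 3
        push_cast
        field_simp
    _ = 𝓕 (𝓕 f) (-t) := by
        rw [integral_const_mul, hscale, Complex.real_smul, ← mul_assoc,
          Real.fourier_real_eq_integral_exp_smul]
        push_cast
        rw [one_div, inv_mul_cancel₀ (by simp), one_mul]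
    _ = f t := by
        rw [← Real.fourierInv_eq_fourier_neg]
        exact congrFun (hc.fourierInv_fourier_eq hf hfourier) t

theorem lintegral_comp_div (g : ℝ → ℝ≥0∞) {c : ℝ} (hc : c ≠ 0) :
    ∫⁻ v, g (v / c) = ENNReal.ofReal |c| * ∫⁻ v, g v := by
  have hmap := (Homeomorph.mulLeft₀ c⁻¹ (inv_ne_zero hc)).measurableEmbedding.lintegral_map
    (μ := volume) g
  simp only [Homeomorph.coe_mulLeft₀] at hmap
  rw [Real.map_volume_mul_left (inv_ne_zero hc), lintegral_smul_measure, inv_inv,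
    smul_eq_mul] at hmap
  simpa only [div_eq_inv_mul] using hmap.symm

theorem lintegral_enorm_sq_invFourier (h₁ : Integrable f) (h₂ : MemLp f 2) :
    ∫⁻ v, ‖invFourier f v‖ₑ ^ 2 = ENNReal.ofReal (1 / (2 * Real.pi)) * ∫⁻ w, ‖f w‖ₑ ^ 2 := by
  have hconst : ‖(1 / (2 * Real.pi) : ℂ)‖ₑ = ENNReal.ofReal (1 / (2 * Real.pi)) := by
    rw [← ofReal_norm]
    congr 1
    simp [abs_of_pos Real.pi_pos]
  simp only [invFourier, enorm_mul, mul_pow, hconst]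
  rw [lintegral_const_mul' _ _ (by finiteness),
    lintegral_comp_div (fun v => ‖𝓕 f v‖ₑ ^ 2) (by positivity), abs_of_pos (by positivity),
    lintegral_enorm_sq_fourier h₁ h₂, ← mul_assoc]
  congr 1
  rw [← ENNReal.ofReal_pow (by positivity), ← ENNReal.ofReal_mul (by positivity)]
  congr 1
  field_simp

theorem lintegral_enorm_sq_invFourier_le (h₁ : Integrable f) (h₂ : MemLp f 2) :
    ∫⁻ v, ‖invFourier f v‖ₑ ^ 2 ≤ ∫⁻ w, ‖f w‖ₑ ^ 2 := by
  rw [lintegral_enorm_sq_invFourier h₁ h₂]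
  refine mul_le_of_le_one_left zero_le (ENNReal.ofReal_le_one.2 ?_)
  exact (div_le_one (by positivity)).2 (by linarith [Real.pi_gt_three])

end invFourier

/-! ### Functions with dominated derivatives -/

/-- The function `f` is `m` times differentiable at the points of `S`, and there the norms of its
derivatives of order at most `m` are dominated by `b`. This is the form in which the smoothness
of `1 / μ_ε^*` enters. -/
structure HasDerivBound {E : Type*} [NormedAddCommGroup E] [NormedSpace ℝ E] (S : Set ℝ) (m : ℕ)
    (b : ℝ → ℝ) (f : ℝ → E) : Prop where
  differentiableAt : ∀ ℓ < m, ∀ t ∈ S, DifferentiableAt ℝ (iteratedDeriv ℓ f) t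
  norm_iteratedDeriv_le : ∀ ℓ ≤ m, ∀ t ∈ S, ‖iteratedDeriv ℓ f t‖ ≤ b t

namespace HasDerivBound

section general

variable {E : Type*} [NormedAddCommGroup E] [NormedSpace ℝ E] {S T : Set ℝ} {m n : ℕ}
  {b b' : ℝ → ℝ} {f g : ℝ → E}

theorem norm_le (h : HasDerivBound S m b f) {t : ℝ} (ht : t ∈ S) : ‖f t‖ ≤ b t := by
  simpa using h.norm_iteratedDeriv_le 0 (Nat.zero_le m) t ht

theorem mono (h : HasDerivBound S m b f) (hb : ∀ t ∈ S, b t ≤ b' t) : HasDerivBound S m b' f :=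
  ⟨h.differentiableAt, fun ℓ hℓ t ht => (h.norm_iteratedDeriv_le ℓ hℓ t ht).trans (hb t ht)⟩

theorem of_le (h : HasDerivBound S n b f) (hmn : m ≤ n) : HasDerivBound S m b f :=
  ⟨fun ℓ hℓ => h.differentiableAt ℓ (hℓ.trans_le hmn),
    fun ℓ hℓ => h.norm_iteratedDeriv_le ℓ (hℓ.trans hmn)⟩

theorem subset (h : HasDerivBound T m b f) (hST : S ⊆ T) : HasDerivBound S m b f :=
  ⟨fun ℓ hℓ t ht => h.differentiableAt ℓ hℓ t (hST ht),
    fun ℓ hℓ t ht => h.norm_iteratedDeriv_le ℓ hℓ t (hST ht)⟩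

theorem union (h : HasDerivBound S m b f) (h' : HasDerivBound T m b f) :
    HasDerivBound (S ∪ T) m b f :=
  ⟨fun ℓ hℓ t ht => ht.elim (h.differentiableAt ℓ hℓ t) (h'.differentiableAt ℓ hℓ t),
    fun ℓ hℓ t ht => ht.elim (h.norm_iteratedDeriv_le ℓ hℓ t) (h'.norm_iteratedDeriv_le ℓ hℓ t)⟩

theorem congr (hS : IsOpen S) (h : HasDerivBound S m b f) (hfg : EqOn f g S) :
    HasDerivBound S m b g := by
  have heq : ∀ ℓ, EqOn (iteratedDeriv ℓ f) (iteratedDeriv ℓ g) S := hfg.iteratedDeriv_of_isOpen hS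
  exact ⟨fun ℓ hℓ t ht => (h.differentiableAt ℓ hℓ t ht).congr_of_eventuallyEq
    ((heq ℓ).symm.eventuallyEq_of_mem (hS.mem_nhds ht)),
    fun ℓ hℓ t ht => heq ℓ ht ▸ h.norm_iteratedDeriv_le ℓ hℓ t ht⟩

theorem zero_iff : HasDerivBound S 0 b f ↔ ∀ t ∈ S, ‖f t‖ ≤ b t :=
  ⟨fun h _ ht => h.norm_le ht, fun h => ⟨fun ℓ hℓ => absurd hℓ (Nat.not_lt_zero ℓ), fun ℓ hℓ t ht =>
    by simpa [Nat.le_zero.1 hℓ] using h t ht⟩⟩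

theorem succ_iff : HasDerivBound S (m + 1) b f ↔
    (∀ t ∈ S, DifferentiableAt ℝ f t ∧ ‖f t‖ ≤ b t) ∧ HasDerivBound S m b (deriv f) := by
  constructor
  · exact fun h => ⟨fun t ht => ⟨by simpa using h.differentiableAt 0 m.succ_pos t ht, h.norm_le ht⟩,
      fun ℓ hℓ => iteratedDeriv_succ' (f := f) ▸ h.differentiableAt (ℓ + 1) (by omega),
      fun ℓ hℓ => iteratedDeriv_succ' (f := f) ▸ h.norm_iteratedDeriv_le (ℓ + 1) (by omega)⟩
  · rintro ⟨h, h'⟩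
    refine ⟨fun ℓ hℓ t ht => ?_, fun ℓ hℓ t ht => ?_⟩
    all_goals obtain _ | ℓ := ℓ
    · simpa using (h t ht).1
    · exact iteratedDeriv_succ' (f := f) ▸ h'.differentiableAt ℓ (by omega) t ht
    · simpa using (h t ht).2
    · exact iteratedDeriv_succ' (f := f) ▸ h'.norm_iteratedDeriv_le ℓ (by omega) t ht

theorem continuous (h : HasDerivBound univ (m + 1) b f) : Continuous f :=
  continuous_iff_continuousAt.2 fun t => ((succ_iff.1 h).1 t trivial).1.continuousAt

theorem const (c : E) : HasDerivBound S m (fun _ => ‖c‖) fun _ => c := by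
  refine ⟨fun ℓ _ t _ => ?_, fun ℓ _ t _ => ?_⟩
  · rw [show iteratedDeriv ℓ (fun _ : ℝ => c) = fun _ => if ℓ = 0 then c else 0 from
      funext fun _ => iteratedDeriv_const]
    exact differentiableAt_const _
  · rw [iteratedDeriv_const]
    split_ifs <;> simp

theorem add (hS : IsOpen S) (h : HasDerivBound S m b f) (h' : HasDerivBound S m b' g) :
    HasDerivBound S m (fun t => b t + b' t) fun t => f t + g t := by
  induction m generalizing f g with
  | zero => exact zero_iff.2 fun t ht => norm_add_le_of_le (h.norm_le ht) (h'.norm_le ht)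
  | succ m ih =>
    obtain ⟨hf, hf'⟩ := succ_iff.1 h
    obtain ⟨hg, hg'⟩ := succ_iff.1 h'
    exact succ_iff.2 ⟨fun t ht => ⟨(hf t ht).1.add (hg t ht).1,
      norm_add_le_of_le (hf t ht).2 (hg t ht).2⟩,
      (ih hf' hg').congr hS fun t ht => (deriv_fun_add (hf t ht).1 (hg t ht).1).symm⟩

theorem const_smul {𝕜 : Type*} [NormedField 𝕜] [NormedSpace 𝕜 E] [SMulCommClass ℝ 𝕜 E] (a : 𝕜)
    (h : HasDerivBound S m b f) : HasDerivBound S m (fun t => ‖a‖ * b t) fun t => a • f t := by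
  have heq : ∀ ℓ, iteratedDeriv ℓ (fun t => a • f t) = fun t => a • iteratedDeriv ℓ f t :=
    fun ℓ => funext fun t => iteratedDeriv_fun_const_smul_field a f
  refine ⟨fun ℓ hℓ t ht => ?_, fun ℓ hℓ t ht => ?_⟩
  · exact heq ℓ ▸ (h.differentiableAt ℓ hℓ t ht).fun_const_smul a
  · simp only [heq, norm_smul]
    gcongr
    exact h.norm_iteratedDeriv_le ℓ hℓ t ht

theorem comp_mul_left {c a : ℝ} (ha : 0 ≤ a) (h : HasDerivBound univ m (fun _ => c) f) :
    HasDerivBound univ m (fun _ => (1 + a) ^ m * c) fun t => f (a * t) := by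
  induction m generalizing f c with
  | zero => exact zero_iff.2 fun t _ => by simpa using h.norm_le (mem_univ (a * t))
  | succ m ih =>
    obtain ⟨hf, hf'⟩ := succ_iff.1 h
    have hc : 0 ≤ c := (norm_nonneg _).trans (hf 0 trivial).2
    refine succ_iff.2 ⟨fun t _ => ⟨?_, ?_⟩, ?_⟩
    · exact (hf (a * t) trivial).1.comp t (differentiableAt_id.const_mul a)
    · exact (hf (a * t) trivial).2.trans
        (le_mul_of_one_le_left hc (one_le_pow₀ (le_add_of_nonneg_right ha)))
    · refine (((ih hf').const_smul a).mono fun t _ => ?_).congr isOpen_univ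
        fun t _ => (deriv_comp_mul_left a f t).symm
      rw [Real.norm_of_nonneg ha]
      calc a * ((1 + a) ^ m * c) ≤ (1 + a) * ((1 + a) ^ m * c) := by gcongr; linarith
        _ = (1 + a) ^ (m + 1) * c := by ring

theorem exists_of_isCompact {K : Set ℝ} (hK : IsCompact K)
    (hd : ∀ ℓ < m, ∀ t ∈ K, DifferentiableAt ℝ (iteratedDeriv ℓ f) t)
    (hM : ∃ M, ∀ t ∈ K, ‖iteratedDeriv m f t‖ ≤ M) :
    ∃ c, 0 ≤ c ∧ HasDerivBound K m (fun _ => c) f := by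
  have hbound : ∀ ℓ ≤ m, ∃ M, ∀ t ∈ K, ‖iteratedDeriv ℓ f t‖ ≤ M := fun ℓ hℓ => by
    rcases hℓ.eq_or_lt with rfl | hlt
    · exact hM
    · exact hK.exists_bound_of_continuousOn fun t ht =>
        (hd ℓ hlt t ht).continuousAt.continuousWithinAt
  choose! M hM' using hbound
  refine ⟨∑ ℓ ∈ Finset.range (m + 1), |M ℓ|, Finset.sum_nonneg fun _ _ => abs_nonneg _, hd,
    fun ℓ hℓ t ht => (hM' ℓ hℓ t ht).trans ((le_abs_self _).trans ?_)⟩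
  exact Finset.single_le_sum (f := fun ℓ => |M ℓ|) (fun _ _ => abs_nonneg _)
    (Finset.mem_range.2 (by omega))

theorem of_eq_zero {R c : ℝ} (hc : 0 ≤ c) (hf : ∀ t, R < |t| → f t = 0) :
    HasDerivBound {t | R < |t|} m (fun _ => c) f :=
  ((const (0 : E)).mono fun _ _ => by simpa using hc).congr
    (isOpen_lt continuous_const continuous_abs) fun t ht => (hf t ht).symm

theorem exists_of_contDiff {R : ℝ} (hf : ContDiff ℝ m f) (hR : ∀ t, R < |t| → f t = 0) :
    ∃ c, 0 ≤ c ∧ HasDerivBound univ m (fun _ => c) f := by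
  obtain ⟨c, hc, h⟩ := exists_of_isCompact (isCompact_Icc (a := -R) (b := R))
    (fun ℓ hℓ t _ => (hf.differentiable_iteratedDeriv ℓ (by exact_mod_cast hℓ)) t)
    (isCompact_Icc.exists_bound_of_continuousOn (hf.continuous_iteratedDeriv m le_rfl).continuousOn)
  refine ⟨c, hc, (h.union (of_eq_zero hc hR)).subset fun t _ => ?_⟩
  exact (le_or_gt |t| R).imp abs_le.1 id

end general

theorem mul {A : Type*} [NormedRing A] [NormedAlgebra ℝ A] {S : Set ℝ} {m : ℕ} {b b' : ℝ → ℝ}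
    {f g : ℝ → A} (hS : IsOpen S) (h : HasDerivBound S m b f) (h' : HasDerivBound S m b' g) :
    HasDerivBound S m (fun t => 2 ^ m * (b t * b' t)) fun t => f t * g t := by
  induction m generalizing f g with
  | zero =>
    refine zero_iff.2 fun t ht => ?_
    rw [pow_zero, one_mul]
    exact norm_mul_le_of_le (h.norm_le ht) (h'.norm_le ht)
  | succ m ih =>
    obtain ⟨hf, hf'⟩ := succ_iff.1 h
    obtain ⟨hg, hg'⟩ := succ_iff.1 h'
    refine succ_iff.2 ⟨fun t ht => ⟨(hf t ht).1.mul (hg t ht).1, ?_⟩, ?_⟩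
    · have hmul := norm_mul_le_of_le (hf t ht).2 (hg t ht).2
      exact hmul.trans (le_mul_of_one_le_left ((norm_nonneg _).trans hmul)
        (one_le_pow₀ one_le_two))
    · refine (((ih hf' (h'.of_le m.le_succ)).add hS (ih (h.of_le m.le_succ) hg')).mono
        fun t _ => ?_).congr hS fun t ht => (deriv_fun_mul (hf t ht).1 (hg t ht).1).symm
      rw [pow_succ]
      linarith

end HasDerivBound

theorem deriv_eq_zero_of_eq_zero_of_lt_abs {E : Type*} [NormedAddCommGroup E] [NormedSpace ℝ E]
    {R : ℝ} {f : ℝ → E} (hf : ∀ t, R < |t| → f t = 0) : ∀ t, R < |t| → deriv f t = 0 := by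
  intro t ht
  have hzero : f =ᶠ[𝓝 t] fun _ => 0 := by
    filter_upwards [(isOpen_lt continuous_const continuous_abs).mem_nhds ht] with s hs using hf s hs
  rw [hzero.deriv_eq, deriv_const]

section compactSupport

variable {E : Type*} [NormedAddCommGroup E] {R : ℝ} {b : ℝ → ℝ}

theorem eq_indicator_Icc {f : ℝ → E} (hR : ∀ t, R < |t| → f t = 0) :
    (Icc (-R) R).indicator f = f :=
  indicator_eq_self.2 fun t ht => abs_le.1 (not_lt.1 (mt (hR t) ht))

theorem memLp_of_norm_le_of_eq_zero (q : ℝ≥0∞) {f : ℝ → E} (hm : AEStronglyMeasurable f)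
    (hb : Continuous b) (hf : ∀ t, ‖f t‖ ≤ b t) (hR : ∀ t, R < |t| → f t = 0) : MemLp f q := by
  obtain ⟨M, hM⟩ := (isCompact_Icc (a := -R) (b := R)).exists_bound_of_continuousOn hb.continuousOn
  rw [← eq_indicator_Icc hR, memLp_indicator_iff_restrict measurableSet_Icc]
  refine MemLp.of_bound hm.restrict M ?_
  filter_upwards [ae_restrict_mem measurableSet_Icc] with t ht
  exact (hf t).trans ((le_abs_self _).trans (hM t ht))

theorem integrable_of_norm_le_of_eq_zero {f : ℝ → E} (hm : AEStronglyMeasurable f)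
    (hb : Continuous b) (hf : ∀ t, ‖f t‖ ≤ b t) (hR : ∀ t, R < |t| → f t = 0) : Integrable f :=
  memLp_one_iff_integrable.1 (memLp_of_norm_le_of_eq_zero 1 hm hb hf hR)

end compactSupport

/-! ### Moments of inverse Fourier transforms -/

section moments

variable {R : ℝ} {b : ℝ → ℝ} {f : ℝ → ℂ} {m : ℕ}

theorem lintegral_pow_mul_sq_invFourier_le (hm : AEStronglyMeasurable f) (hb : Continuous b)
    (h : HasDerivBound univ m b f) (hR : ∀ t, R < |t| → f t = 0) :
    ∫⁻ v, ENNReal.ofReal (|v| ^ (2 * m) * ‖invFourier f v‖ ^ 2) ≤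
      ∫⁻ w in Icc (-R) R, ENNReal.ofReal (b w ^ 2) := by
  induction m generalizing f with
  | zero =>
    have hle : ∀ t, ‖f t‖ ≤ b t := fun t => h.norm_le trivial
    calc ∫⁻ v, ENNReal.ofReal (|v| ^ (2 * 0) * ‖invFourier f v‖ ^ 2)
        = ∫⁻ v, ‖invFourier f v‖ₑ ^ 2 := by
          simp [ENNReal.ofReal_pow, ofReal_norm]
      _ ≤ ∫⁻ w, ‖f w‖ₑ ^ 2 := lintegral_enorm_sq_invFourier_le
          (integrable_of_norm_le_of_eq_zero hm hb hle hR)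
          (memLp_of_norm_le_of_eq_zero 2 hm hb hle hR)
      _ ≤ ∫⁻ w, (Icc (-R) R).indicator (fun t => ENNReal.ofReal (b t ^ 2)) w := by
          conv_lhs => rw [← eq_indicator_Icc hR]
          refine lintegral_mono fun t => ?_
          by_cases ht : t ∈ Icc (-R) R
          · rw [indicator_of_mem ht, indicator_of_mem ht, ← ofReal_norm,
              ← ENNReal.ofReal_pow (norm_nonneg _)]
            exact ENNReal.ofReal_le_ofReal (by gcongr; exact hle t)
          · simp [indicator_of_notMem ht]
      _ = ∫⁻ w in Icc (-R) R, ENNReal.ofReal (b w ^ 2) := lintegral_indicator measurableSet_Icc _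
  | succ m ih =>
    obtain ⟨hf, hf'⟩ := HasDerivBound.succ_iff.1 h
    have hR' := deriv_eq_zero_of_eq_zero_of_lt_abs hR
    have hm' := (stronglyMeasurable_deriv f).aestronglyMeasurable (μ := volume)
    refine le_trans (le_of_eq (lintegral_congr fun v => ?_)) (ih hm' hf' hR')
    rw [invFourier_deriv (integrable_of_norm_le_of_eq_zero hm hb (fun t => (hf t trivial).2) hR)
      (fun t => (hf t trivial).1)
      (integrable_of_norm_le_of_eq_zero hm' hb (fun t => hf'.norm_le trivial) hR')]
    simp only [norm_mul, Complex.norm_I, Complex.norm_real, Real.norm_eq_abs]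
    congr 1
    ring

theorem one_add_pow_two_mul_le {x : ℝ} (hx : 0 ≤ x) (m : ℕ) :
    (1 + x) ^ (2 * m) ≤ 4 ^ m * (1 + x ^ (2 * m)) :=
  calc (1 + x) ^ (2 * m) ≤ 2 ^ (2 * m - 1) * (1 ^ (2 * m) + x ^ (2 * m)) :=
        add_pow_le zero_le_one hx _
    _ ≤ 2 ^ (2 * m) * (1 ^ (2 * m) + x ^ (2 * m)) := by gcongr <;> simp
    _ = 4 ^ m * (1 + x ^ (2 * m)) := by rw [pow_mul, one_pow]; norm_num

theorem lintegral_one_add_pow_mul_sq_invFourier_le (hm : AEStronglyMeasurable f)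
    (hb : Continuous b) (h : HasDerivBound univ m b f) (hR : ∀ t, R < |t| → f t = 0) :
    ∫⁻ v, ENNReal.ofReal ((1 + |v|) ^ (2 * m) * ‖invFourier f v‖ ^ 2) ≤
      ENNReal.ofReal (2 * 4 ^ m) * ∫⁻ w in Icc (-R) R, ENNReal.ofReal (b w ^ 2) := by
  have hzero := lintegral_pow_mul_sq_invFourier_le hm hb (h.of_le m.zero_le) hR
  have hpow := lintegral_pow_mul_sq_invFourier_le hm hb h hR
  have hcont := continuous_invFourier
    (integrable_of_norm_le_of_eq_zero hm hb (fun t => h.norm_le trivial) hR)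
  calc ∫⁻ v, ENNReal.ofReal ((1 + |v|) ^ (2 * m) * ‖invFourier f v‖ ^ 2)
      ≤ ∫⁻ v, ENNReal.ofReal (4 ^ m) * (ENNReal.ofReal (|v| ^ (2 * 0) * ‖invFourier f v‖ ^ 2) +
          ENNReal.ofReal (|v| ^ (2 * m) * ‖invFourier f v‖ ^ 2)) := by
        refine lintegral_mono fun v => ?_
        rw [← ENNReal.ofReal_add (by positivity) (by positivity),
          ← ENNReal.ofReal_mul (by positivity), mul_zero, pow_zero, ← add_mul, ← mul_assoc]
        exact ENNReal.ofReal_le_ofReal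
          (mul_le_mul_of_nonneg_right (one_add_pow_two_mul_le (abs_nonneg v) m) (sq_nonneg _))
    _ ≤ ENNReal.ofReal (4 ^ m) * (2 * ∫⁻ w in Icc (-R) R, ENNReal.ofReal (b w ^ 2)) := by
        rw [lintegral_const_mul' _ _ ENNReal.ofReal_ne_top, lintegral_add_left (by fun_prop),
          two_mul (∫⁻ w in Icc (-R) R, ENNReal.ofReal (b w ^ 2))]
        gcongr
    _ = _ := by
        rw [ENNReal.ofReal_mul (by positivity), ENNReal.ofReal_ofNat, mul_assoc, mul_left_comm]

end moments

/-! ### The frequency cutoff -/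

/-- A smooth bump function, equal to `1` on `[-1, 1]` and to `0` outside `[-3/2, 3/2]`. -/
def bump : ContDiffBump (0 : ℝ) := ⟨1, 3 / 2, by norm_num, by norm_num⟩

/-- The smooth cutoff to low frequencies, as a complex-valued function. -/
def cutoff (w : ℝ) : ℂ := (bump w : ℝ)

/-- The quotient `w ↦ (1 - φ(w)) / w`, where `φ` is the cutoff: the high frequency part of
`w ↦ 1 / w`. It is smooth since `1 - φ` vanishes near `0`. -/
def cutoffQuot (w : ℝ) : ℂ := (1 - cutoff w) / w

theorem contDiff_cutoff {n : ℕ∞} : ContDiff ℝ n cutoff :=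
  Complex.ofRealCLM.contDiff.comp bump.contDiff

theorem cutoff_eq_one {w : ℝ} (hw : |w| ≤ 1) : cutoff w = 1 := by
  have hbump : bump w = 1 := bump.one_of_mem_closedBall (by simpa [bump] using hw)
  simp [cutoff, hbump]

theorem cutoff_eq_zero {w : ℝ} (hw : 3 / 2 ≤ |w|) : cutoff w = 0 := by
  have hbump : bump w = 0 := bump.zero_of_le_dist (by simpa [bump] using hw)
  simp [cutoff, hbump]

theorem integrable_cutoff_mul {f : ℝ → ℂ} (hf : Continuous f) :
    Integrable fun w => cutoff w * f w := by
  have hsupp : HasCompactSupport cutoff :=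
    HasCompactSupport.intro (isCompact_Icc (a := -2) (b := 2)) fun w hw =>
      cutoff_eq_zero (by rw [mem_Icc, ← abs_le] at hw; linarith)
  exact ((contDiff_cutoff (n := 0)).continuous.mul hf).integrable_of_hasCompactSupport
    hsupp.mul_right

theorem cutoffQuot_eq_zero {w : ℝ} (hw : |w| ≤ 1) : cutoffQuot w = 0 := by
  simp [cutoffQuot, cutoff_eq_one hw]

theorem mul_cutoffQuot (w : ℝ) : (w : ℂ) * cutoffQuot w = 1 - cutoff w := by
  rcases eq_or_ne w 0 with rfl | hw
  · simp [cutoff_eq_one]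
  · exact mul_div_cancel₀ _ (Complex.ofReal_ne_zero.2 hw)

theorem contDiff_cutoffQuot {n : ℕ∞} : ContDiff ℝ n cutoffQuot := by
  refine contDiff_iff_contDiffAt.2 fun w => ?_
  by_cases hw : |w| < 1
  · refine (contDiffAt_const (c := (0 : ℂ))).congr_of_eventuallyEq ?_
    filter_upwards [(isOpen_lt continuous_abs continuous_const).mem_nhds hw] with s hs
    exact cutoffQuot_eq_zero (le_of_lt hs)
  · have hw0 : (w : ℂ) ≠ 0 := Complex.ofReal_ne_zero.2 fun h => hw (by simp [h])
    have hquot : ContDiffAt ℝ n (fun w : ℝ => (1 - cutoff w) * (w : ℂ)⁻¹) w :=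
      (contDiffAt_const.sub contDiff_cutoff.contDiffAt).mul
        (Complex.ofRealCLM.contDiff.contDiffAt.inv hw0)
    exact hquot

theorem norm_le_div_one_add_abs {w c : ℝ} {z : ℂ} (hz : |w| < 1 → z = 0) (h : ‖w * z‖ ≤ c) :
    ‖z‖ ≤ 2 * c / (1 + |w|) := by
  have hc : 0 ≤ c := (norm_nonneg _).trans h
  rw [norm_mul, Complex.norm_real, Real.norm_eq_abs] at h
  rcases lt_or_ge |w| 1 with hw | hw
  · rw [hz hw, norm_zero]
    positivity
  · rw [le_div_iff₀ (by positivity)]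
    nlinarith [norm_nonneg z]

namespace HasDerivBound

theorem id_mul_deriv {m : ℕ} {g : ℝ → ℂ} {c c₁ : ℝ} (hc₁ : 0 ≤ c₁) (hg : Differentiable ℝ g)
    (h : HasDerivBound univ (m + 1) (fun _ => c) fun w => w * g w)
    (h₁ : HasDerivBound univ m (fun w => c₁ / (1 + |w|)) g) :
    HasDerivBound univ m (fun _ => c + c₁) fun w => w * deriv g w := by
  refine (((succ_iff.1 h).2.add isOpen_univ (h₁.const_smul (-1 : ℝ))).mono fun w _ => ?_).congr
    isOpen_univ fun w _ => ?_
  · have : c₁ / (1 + |w|) ≤ c₁ := div_le_self hc₁ (le_add_of_nonneg_right (abs_nonneg w))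
    simpa using this
  · have hderiv : HasDerivAt (fun w : ℝ => (w : ℂ) * g w) (1 * g w + w * deriv g w) w :=
      Complex.ofRealCLM.hasDerivAt.mul (hg w).hasDerivAt
    simp [hderiv.deriv]

theorem exists_div_one_add_abs {m : ℕ} {g : ℝ → ℂ} {c : ℝ} (hg : ContDiff ℝ m g)
    (hg0 : ∀ w, |w| < 1 → g w = 0) (h : HasDerivBound univ m (fun _ => c) fun w => w * g w) :
    ∃ c', 0 ≤ c' ∧ HasDerivBound univ m (fun w => c' / (1 + |w|)) g := by
  have hc : 0 ≤ c := (norm_nonneg _).trans (h.norm_le (mem_univ 0))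
  have hle : ∀ w, ‖g w‖ ≤ 2 * c / (1 + |w|) := fun w =>
    norm_le_div_one_add_abs (hg0 w) (h.norm_le (mem_univ w))
  induction m generalizing g c with
  | zero => exact ⟨2 * c, by positivity, zero_iff.2 fun w _ => hle w⟩
  | succ m ih =>
    obtain ⟨hdiff, -, hg'⟩ := contDiff_succ_iff_deriv.1 (show ContDiff ℝ (m + 1) g from mod_cast hg)
    obtain ⟨c₁, hc₁, h₁⟩ := ih (hg.of_le (mod_cast m.le_succ)) hg0 (h.of_le m.le_succ) hc hle
    have hg0' : ∀ w, |w| < 1 → deriv g w = 0 := fun w hw => by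
      have hzero : g =ᶠ[𝓝 w] fun _ => 0 := by
        filter_upwards [(isOpen_lt continuous_abs continuous_const).mem_nhds hw] with s hs
          using hg0 s hs
      rw [hzero.deriv_eq, deriv_const]
    have hmul := id_mul_deriv hc₁ hdiff h h₁
    obtain ⟨c₂, hc₂, h₂⟩ := ih hg' hg0' hmul (add_nonneg hc hc₁) fun w =>
      norm_le_div_one_add_abs (hg0' w) (hmul.norm_le (mem_univ w))
    refine ⟨2 * c + c₂, by positivity, succ_iff.2 ⟨fun w _ => ⟨hdiff w, (hle w).trans ?_⟩,
      h₂.mono fun w _ => ?_⟩⟩ <;> gcongr <;> linarith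

end HasDerivBound

theorem exists_hasDerivBound_cutoffQuot (m : ℕ) :
    ∃ c, 0 ≤ c ∧ HasDerivBound univ m (fun w => c / (1 + |w|)) cutoffQuot := by
  obtain ⟨c, -, h⟩ := HasDerivBound.exists_of_contDiff (m := m) (R := 2)
    (contDiff_cutoff (n := m)) fun t ht => cutoff_eq_zero (by linarith)
  refine HasDerivBound.exists_div_one_add_abs (c := 1 + c) (contDiff_cutoffQuot (n := m))
    (fun w hw => cutoffQuot_eq_zero hw.le) ?_
  refine (((HasDerivBound.const (1 : ℂ)).add isOpen_univ (h.const_smul (-1 : ℝ))).mono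
    fun w _ => by simp).congr isOpen_univ fun w _ => ?_
  simp [mul_cutoffQuot, sub_eq_add_neg]

/-! ### Moments of the kernel -/

section fwdDiff

variable {E : Type*} [NormedAddCommGroup E] [NormedSpace ℝ E] {f : ℝ → E}

theorem differentiable_fwdDiff (hf : Differentiable ℝ f) (δ : ℝ) :
    Differentiable ℝ (fwdDiff δ f) :=
  (hf.comp (by fun_prop : Differentiable ℝ (· + δ))).sub hf

theorem deriv_fwdDiff (hf : Differentiable ℝ f) (δ : ℝ) :
    deriv (fwdDiff δ f) = fwdDiff δ (deriv f) := by
  ext t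
  have hshift : Differentiable ℝ fun t => f (t + δ) := hf.comp (by fun_prop)
  exact (deriv_fun_sub (hshift t) (hf t)).trans (by rw [deriv_comp_add_const]; rfl)

theorem differentiable_fwdDiff_iter (hf : Differentiable ℝ f) (δ : ℝ) (n : ℕ) :
    Differentiable ℝ ((fwdDiff δ)^[n] f) := by
  induction n generalizing f with
  | zero => exact hf
  | succ _ ih => exact ih (differentiable_fwdDiff hf δ)

theorem deriv_fwdDiff_iter (hf : Differentiable ℝ f) (δ : ℝ) (n : ℕ) :
    deriv ((fwdDiff δ)^[n] f) = (fwdDiff δ)^[n] (deriv f) := by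
  induction n generalizing f with
  | zero => rfl
  | succ _ ih =>
    rw [Function.iterate_succ_apply, ih (differentiable_fwdDiff hf δ), deriv_fwdDiff hf,
      Function.iterate_succ_apply]

theorem norm_fwdDiff_iter_le {n : ℕ} {L : ℝ≥0} (hf : ContDiff ℝ n f)
    (hL : LipschitzWith L (iteratedDeriv n f)) (δ t : ℝ) :
    ‖(fwdDiff δ)^[n + 1] f t‖ ≤ L * |δ| ^ (n + 1) := by
  have hstep : ∀ {g : ℝ → E} {K : ℝ≥0}, LipschitzWith K g → ∀ t, ‖fwdDiff δ g t‖ ≤ K * |δ| :=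
    fun {g K} hg t => by simpa [fwdDiff, dist_eq_norm] using hg.dist_le_mul (t + δ) t
  induction n generalizing f t with
  | zero => simpa using hstep (by simpa using hL) t
  | succ n ih =>
    have hf' : ContDiff ℝ (n + 1) f := mod_cast hf
    have hdiff : Differentiable ℝ f := hf'.differentiable (by simp)
    have hlip : LipschitzWith (L * δ.nnabs ^ (n + 1)) ((fwdDiff δ)^[n + 1] f) := by
      refine lipschitzWith_of_nnnorm_deriv_le (differentiable_fwdDiff_iter hdiff δ _) fun t => ?_
      rw [deriv_fwdDiff_iter hdiff, ← NNReal.coe_le_coe]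
      simpa using ih (contDiff_succ_iff_deriv.1 hf').2.2 (by rwa [← iteratedDeriv_succ']) t
    rw [Function.iterate_succ_apply']
    simpa [pow_succ, mul_assoc] using hstep hlip t

end fwdDiff

section sinPow

theorem norm_exp_I_mul_mul (u s : ℝ) : ‖Complex.exp (Complex.I * u * s)‖ = 1 := by
  rw [mul_assoc, ← Complex.ofReal_mul, Complex.norm_exp_I_mul_ofReal]

theorem fwdDiff_iter_fourierStar {k : ℝ → ℝ} (hk : Integrable k) (δ : ℝ) (n : ℕ) (t : ℝ) :
    (fwdDiff δ)^[n] (fourierStar k) t = ∫ u : ℝ, Complex.exp (Complex.I * u * t) *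
      (Complex.exp (Complex.I * u * δ) - 1) ^ n * (k u : ℂ) := by
  have hint : ∀ (n : ℕ) (t : ℝ), Integrable fun u : ℝ => Complex.exp (Complex.I * u * t) *
      (Complex.exp (Complex.I * u * δ) - 1) ^ n * (k u : ℂ) := fun n t => by
    refine hk.ofReal.bdd_mul (c := 2 ^ n) (Continuous.aestronglyMeasurable (by fun_prop))
      (.of_forall fun u => ?_)
    rw [norm_mul, norm_exp_I_mul_mul, one_mul, norm_pow]
    gcongr
    refine (norm_sub_le _ _).trans ?_
    rw [norm_exp_I_mul_mul, norm_one]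
    norm_num
  induction n generalizing t with
  | zero => simp [fourierStar]
  | succ n ih =>
    rw [Function.iterate_succ_apply', fwdDiff, ih, ih, ← integral_sub (hint n _) (hint n _)]
    refine integral_congr_ae (.of_forall fun u => ?_)
    simp only
    rw [Complex.ofReal_add, mul_add, Complex.exp_add]
    ring

theorem exp_mul_exp_sub_one (z : ℂ) :
    Complex.exp (-(z * Complex.I)) * (Complex.exp (2 * z * Complex.I) - 1) =
      Complex.I * (2 * Complex.sin z) := by
  rw [mul_sub, ← Complex.exp_add, mul_one, Complex.sin, ← neg_mul,
    show -z * Complex.I + 2 * z * Complex.I = z * Complex.I by ring]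
  linear_combination (Complex.exp (z * Complex.I) - Complex.exp (-z * Complex.I)) * Complex.I_mul_I

theorem exp_mul_exp_sub_one_pow (u δ : ℝ) (j : ℕ) :
    Complex.exp (Complex.I * u * (-(j * δ) : ℝ)) *
      (Complex.exp (Complex.I * u * δ) - 1) ^ (2 * j) =
      (-1) ^ j * (((2 * Real.sin (δ * u / 2)) ^ (2 * j) : ℝ) : ℂ) := by
  have hexp : Complex.exp (Complex.I * u * (-(j * δ) : ℝ)) =
      Complex.exp (-((δ * u / 2) * Complex.I)) ^ (2 * j) := by
    rw [← Complex.exp_nat_mul]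
    congr 1
    push_cast
    ring
  rw [hexp, ← mul_pow, show Complex.I * u * δ = 2 * (δ * u / 2) * Complex.I by ring,
    exp_mul_exp_sub_one, mul_pow, pow_mul Complex.I, Complex.I_sq]
  push_cast
  rfl

theorem integrable_sin_pow_mul {k : ℝ → ℝ} (hk : Integrable k) (δ : ℝ) (n : ℕ) :
    Integrable fun u => (2 * Real.sin (δ * u / 2)) ^ n * k u := by
  refine hk.bdd_mul (c := 2 ^ n) (Continuous.aestronglyMeasurable (by fun_prop))
    (.of_forall fun u => ?_)
  rw [norm_pow, norm_mul, Real.norm_eq_abs, Real.norm_eq_abs, abs_two]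
  gcongr
  linarith [Real.abs_sin_le_one (δ * u / 2)]

theorem integral_sin_pow_mul_le {k : ℝ → ℝ} (hk : Integrable k) {j : ℕ} (hj : 0 < j) {L : ℝ≥0}
    (hf : ContDiff ℝ (2 * j - 1 : ℕ) (fourierStar k))
    (hL : LipschitzWith L (iteratedDeriv (2 * j - 1) (fourierStar k))) (δ : ℝ) :
    ∫ u, (2 * Real.sin (δ * u / 2)) ^ (2 * j) * k u ≤ L * |δ| ^ (2 * j) := by
  have hdiff := norm_fwdDiff_iter_le hf hL δ (-(j * δ))
  rw [show 2 * j - 1 + 1 = 2 * j by omega, fwdDiff_iter_fourierStar hk] at hdiff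
  simp only [exp_mul_exp_sub_one_pow] at hdiff
  simp only [mul_assoc, ← Complex.ofReal_mul] at hdiff
  rw [integral_const_mul, norm_mul, norm_pow, norm_neg, norm_one, one_pow, one_mul,
    integral_complex_ofReal, Complex.norm_real] at hdiff
  exact (le_abs_self _).trans hdiff

theorem lintegral_sin_div_pow_mul_le {k : ℝ → ℝ} (hk : Integrable k) (hk0 : ∀ x, 0 ≤ k x) {j : ℕ}
    (hj : 0 < j) {L : ℝ≥0} (hf : ContDiff ℝ (2 * j - 1 : ℕ) (fourierStar k))
    (hL : LipschitzWith L (iteratedDeriv (2 * j - 1) (fourierStar k))) {δ : ℝ} (hδ : δ ≠ 0) :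
    ∫⁻ x, ENNReal.ofReal ((2 * Real.sin (δ * x / 2) / δ) ^ (2 * j) * k x) ≤ L := by
  have hscale : ∀ x, (2 * Real.sin (δ * x / 2) / δ) ^ (2 * j) * k x =
      (δ ^ (2 * j))⁻¹ * ((2 * Real.sin (δ * x / 2)) ^ (2 * j) * k x) := fun x => by
    rw [div_pow]
    field_simp
  have hpos : 0 < δ ^ (2 * j) := (even_two_mul j).pow_pos hδ
  simp only [hscale]
  rw [← ofReal_integral_eq_lintegral_ofReal ((integrable_sin_pow_mul hk δ _).const_mul _)
    (.of_forall fun u => mul_nonneg (inv_nonneg.2 hpos.le)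
      (mul_nonneg ((even_two_mul j).pow_nonneg _) (hk0 u))), integral_const_mul]
  refine ENNReal.ofReal_le_of_le_toReal ?_
  rw [inv_mul_le_iff₀ hpos, mul_comm (δ ^ (2 * j)), ENNReal.coe_toReal,
    ← (even_two_mul j).pow_abs δ]
  exact integral_sin_pow_mul_le hk hj hf hL δ

theorem tendsto_sin_mul_div (x : ℝ) :
    Tendsto (fun δ : ℝ => 2 * Real.sin (δ * x / 2) / δ) (𝓝[≠] 0) (𝓝 x) := by
  have hderiv : HasDerivAt (fun δ : ℝ => 2 * Real.sin (δ * x / 2)) x 0 := by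
    refine ((((hasDerivAt_id (0 : ℝ)).mul_const x).div_const 2).sin.const_mul 2).congr_deriv ?_
    simp only [id, zero_mul, zero_div, Real.cos_zero]
    ring
  refine hderiv.tendsto_slope_zero.congr fun δ => ?_
  simp [div_eq_inv_mul]

/- The symmetric differences of order `2j` of `k^*` at `0` are the integrals of
`(2 sin (δx/2)) ^ (2j) k(x)`; the moment is recovered by Fatou's lemma as `δ → 0`. -/
theorem lintegral_even_pow_mul_le {k : ℝ → ℝ} (hk : Integrable k) (hk0 : ∀ x, 0 ≤ k x) {j : ℕ}
    (hj : 0 < j) {L : ℝ≥0} (hf : ContDiff ℝ (2 * j - 1 : ℕ) (fourierStar k))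
    (hL : LipschitzWith L (iteratedDeriv (2 * j - 1) (fourierStar k))) :
    ∫⁻ x, ENNReal.ofReal (x ^ (2 * j) * k x) ≤ L := by
  let δ : ℕ → ℝ := fun N => 1 / ((N : ℝ) + 1)
  let F : ℕ → ℝ → ℝ≥0∞ := fun N x =>
    ENNReal.ofReal ((2 * Real.sin (δ N * x / 2) / δ N) ^ (2 * j) * k x)
  have hδ0 : ∀ N, δ N ≠ 0 := fun N => Nat.one_div_pos_of_nat.ne'
  have hδ : Tendsto δ atTop (𝓝[≠] 0) :=
    tendsto_nhdsWithin_iff.2 ⟨tendsto_one_div_add_atTop_nhds_zero_nat, .of_forall hδ0⟩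
  have hlim : ∀ x, Tendsto (fun N => F N x) atTop (𝓝 (ENNReal.ofReal (x ^ (2 * j) * k x))) :=
    fun x => ENNReal.tendsto_ofReal ((((tendsto_sin_mul_div x).comp hδ).pow _).mul_const _)
  calc ∫⁻ x, ENNReal.ofReal (x ^ (2 * j) * k x)
      = ∫⁻ x, liminf (fun N => F N x) atTop := lintegral_congr fun x => (hlim x).liminf_eq.symm
    _ ≤ liminf (fun N => ∫⁻ x, F N x) atTop := lintegral_liminf_le' fun N =>
        ((Continuous.aemeasurable (by fun_prop)).mul hk.aemeasurable).ennreal_ofReal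
    _ ≤ liminf (fun _ : ℕ => (L : ℝ≥0∞)) atTop := liminf_le_liminf
        (.of_forall fun N => lintegral_sin_div_pow_mul_le hk hk0 hj hf hL (hδ0 N))
    _ = L := liminf_const _

end sinPow

theorem rpow_le_one_add_pow {x p : ℝ} (hx : 0 ≤ x) (hp : 0 ≤ p) {n : ℕ} (hpn : p ≤ n) :
    x ^ p ≤ 1 + x ^ n := by
  rcases le_total x 1 with h | h
  · exact (Real.rpow_le_one hx h hp).trans (le_add_of_nonneg_right (pow_nonneg hx n))
  · rw [← Real.rpow_natCast]
    exact (Real.rpow_le_rpow_of_exponent_le h hpn).trans (le_add_of_nonneg_left zero_le_one)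

namespace IsKernel

variable {p : ℝ} {k : ℝ → ℝ}

theorem fourierStar_eq_zero (hk : IsKernel p k) {u : ℝ} (hu : 1 < |u|) : fourierStar k u = 0 :=
  hk.support u fun h => absurd (abs_le.2 h) hu.not_ge

theorem exists_lipschitzWith_iteratedDeriv (hk : IsKernel p k) {n : ℕ} (hn : n ≤ ⌈p⌉₊) :
    ∃ L : ℝ≥0, LipschitzWith L (iteratedDeriv n (fourierStar k)) := by
  rcases hn.eq_or_lt with rfl | hlt
  · exact hk.lipschitz
  obtain ⟨c, hc, h⟩ := HasDerivBound.exists_of_contDiff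
    (hk.contDiff.of_le (mod_cast hlt : ((n + 1 : ℕ) : WithTop ℕ∞) ≤ ⌈p⌉₊))
    fun t ht => hk.fourierStar_eq_zero ht
  refine ⟨⟨c, hc⟩, lipschitzWith_of_nnnorm_deriv_le
    (fun t => h.differentiableAt n n.lt_succ_self t trivial) fun t => ?_⟩
  rw [← iteratedDeriv_succ]
  exact h.norm_iteratedDeriv_le (n + 1) le_rfl t trivial

theorem lintegral_rpow_mul_lt_top (hp : 0 < p) (hk : IsKernel p k) :
    ∫⁻ x, ENNReal.ofReal (|x| ^ p * k x) < ∞ := by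
  obtain ⟨j, hj, hpj, hjp⟩ : ∃ j : ℕ, 0 < j ∧ ⌈p⌉₊ ≤ 2 * j ∧ 2 * j - 1 ≤ ⌈p⌉₊ :=
    ⟨(⌈p⌉₊ + 1) / 2, by have := Nat.ceil_pos.2 hp; omega, by omega, by omega⟩
  obtain ⟨L, hL⟩ := hk.exists_lipschitzWith_iteratedDeriv hjp
  have hmoment := lintegral_even_pow_mul_le hk.integrable hk.nonneg hj
    (hk.contDiff.of_le (mod_cast hjp)) hL
  calc ∫⁻ x, ENNReal.ofReal (|x| ^ p * k x)
      ≤ ∫⁻ x, (ENNReal.ofReal (k x) + ENNReal.ofReal (x ^ (2 * j) * k x)) := by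
        refine lintegral_mono fun x => ?_
        rw [← ENNReal.ofReal_add (hk.nonneg x)
          (mul_nonneg ((even_two_mul j).pow_nonneg _) (hk.nonneg x)), ← one_add_mul,
          ← (even_two_mul j).pow_abs x]
        exact ENNReal.ofReal_le_ofReal (mul_le_mul_of_nonneg_right
          (rpow_le_one_add_pow (abs_nonneg x) hp.le ((Nat.le_ceil p).trans (mod_cast hpj)))
          (hk.nonneg x))
    _ = (∫⁻ x, ENNReal.ofReal (k x)) + ∫⁻ x, ENNReal.ofReal (x ^ (2 * j) * k x) :=
        lintegral_add_left' hk.integrable.aemeasurable.ennreal_ofReal _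
    _ < ∞ := ENNReal.add_lt_top.2 ⟨hk.integrable.lintegral_lt_top,
        hmoment.trans_lt ENNReal.coe_lt_top⟩

end IsKernel

/-! ### Wasserstein distance and distribution functions -/

section Wasserstein

variable {p : ℝ} {μ ν μ₁ μ₂ μ₃ : Measure ℝ} {π π₁ π₂ : Measure (ℝ × ℝ)}

theorem measurable_ofReal_abs_sub_rpow (p : ℝ) :
    Measurable fun z : ℝ × ℝ => ENNReal.ofReal (|z.1 - z.2| ^ p) :=
  ((measurable_fst.sub measurable_snd).abs.pow_const p).ennreal_ofReal

theorem wasserstein_rpow_le_lintegral (hp : 0 < p) (h₁ : π.fst = μ) (h₂ : π.snd = ν) :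
    wasserstein p μ ν ^ p ≤ ∫⁻ z, ENNReal.ofReal (|z.1 - z.2| ^ p) ∂π := by
  rw [← ENNReal.le_rpow_inv_iff hp, ← one_div]
  exact iInf_le (fun π : {π : Measure (ℝ × ℝ) // π.fst = μ ∧ π.snd = ν} =>
    (∫⁻ z, ENNReal.ofReal (|z.1 - z.2| ^ p) ∂π.1) ^ (1 / p)) ⟨π, h₁, h₂⟩

theorem ofReal_abs_sub_rpow_le (hp : 1 ≤ p) (x y z : ℝ) :
    ENNReal.ofReal (|x - z| ^ p) ≤
      2 ^ (p - 1) * (ENNReal.ofReal (|x - y| ^ p) + ENNReal.ofReal (|y - z| ^ p)) := by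
  simp only [← ENNReal.ofReal_rpow_of_nonneg (abs_nonneg _) (zero_le_one.trans hp)]
  refine le_trans ?_ (ENNReal.rpow_add_le_mul_rpow_add_rpow _ _ hp)
  rw [← ENNReal.ofReal_add (abs_nonneg _) (abs_nonneg _)]
  gcongr
  exact abs_sub_le x y z

/-- The gluing of two couplings `π₁` and `π₂` along their common marginal: given `(x, y)` of law
`π₁`, the third coordinate is drawn from the conditional law under `π₂` given `y`. -/
def glue (π₁ π₂ : Measure (ℝ × ℝ)) [IsFiniteMeasure π₂] : Measure ((ℝ × ℝ) × ℝ) :=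
  π₁ ⊗ₘ π₂.condKernel.comap Prod.snd measurable_snd

theorem map_fst_glue [IsFiniteMeasure π₁] [IsFiniteMeasure π₂] :
    (glue π₁ π₂).map Prod.fst = π₁ :=
  Measure.fst_compProd _ _

theorem map_snd_glue [IsFiniteMeasure π₁] [IsFiniteMeasure π₂] (h : π₁.snd = π₂.fst) :
    (glue π₁ π₂).map (fun z => (z.1.2, z.2)) = π₂ := by
  refine Measure.ext_of_lintegral _ fun g hg => ?_
  conv_rhs => rw [← π₂.disintegrate π₂.condKernel, Measure.lintegral_compProd hg, ← h,
    Measure.snd, lintegral_map hg.lintegral_kernel_prod_right' measurable_snd]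
  rw [lintegral_map hg (by fun_prop), glue, Measure.lintegral_compProd (by fun_prop)]
  rfl

theorem wasserstein_rpow_le_add [IsFiniteMeasure π₁] [IsFiniteMeasure π₂] (hp : 1 ≤ p)
    (h₁ : π₁.fst = μ₁) (h₁' : π₁.snd = μ₂) (h₂ : π₂.fst = μ₂) (h₂' : π₂.snd = μ₃) :
    wasserstein p μ₁ μ₃ ^ p ≤ 2 ^ (p - 1) * (∫⁻ z, ENNReal.ofReal (|z.1 - z.2| ^ p) ∂π₁ +
      ∫⁻ z, ENNReal.ofReal (|z.1 - z.2| ^ p) ∂π₂) := by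
  have hglue := map_snd_glue (h₁'.trans h₂.symm)
  have hmeas := measurable_ofReal_abs_sub_rpow p
  have houter : Measurable fun z : (ℝ × ℝ) × ℝ => (z.1.1, z.2) := by fun_prop
  calc wasserstein p μ₁ μ₃ ^ p
      ≤ ∫⁻ z, ENNReal.ofReal (|z.1 - z.2| ^ p) ∂(glue π₁ π₂).map fun z => (z.1.1, z.2) := by
        refine wasserstein_rpow_le_lintegral (zero_lt_one.trans_le hp) ?_ ?_
        · rw [Measure.fst_map_prodMk measurable_snd, ← h₁, Measure.fst]
          nth_rw 2 [← map_fst_glue (π₁ := π₁) (π₂ := π₂)]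
          rw [Measure.map_map measurable_fst measurable_fst]
          rfl
        · rw [Measure.snd_map_prodMk (by fun_prop), ← h₂', Measure.snd]
          nth_rw 2 [← hglue]
          rw [Measure.map_map measurable_snd (by fun_prop)]
          rfl
    _ ≤ ∫⁻ z, 2 ^ (p - 1) * (ENNReal.ofReal (|z.1.1 - z.1.2| ^ p) +
          ENNReal.ofReal (|z.1.2 - z.2| ^ p)) ∂glue π₁ π₂ := by
        rw [lintegral_map hmeas houter]
        exact lintegral_mono fun z => ofReal_abs_sub_rpow_le hp _ _ _
    _ = 2 ^ (p - 1) * (∫⁻ z, ENNReal.ofReal (|z.1 - z.2| ^ p) ∂(glue π₁ π₂).map Prod.fst +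
          ∫⁻ z, ENNReal.ofReal (|z.1 - z.2| ^ p) ∂(glue π₁ π₂).map fun z => (z.1.2, z.2)) := by
        rw [lintegral_const_mul' _ _ (by simp), lintegral_add_left (by fun_prop),
          lintegral_map hmeas measurable_fst, lintegral_map hmeas (by fun_prop)]
    _ = _ := by rw [map_fst_glue, hglue]

/-- The quantile function of a probability measure on the line, used on `(0, 1)` only (elsewhere the
set may be empty or unbounded below, and the infimum is a junk value). -/
def quantile (μ : Measure ℝ) (u : ℝ) : ℝ := sInf {x | u ≤ cdf μ x}

theorem quantile_le_iff (μ : Measure ℝ) {u x : ℝ} (hu : u ∈ Ioo (0 : ℝ) 1) :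
    quantile μ u ≤ x ↔ u ≤ cdf μ x := by
  obtain ⟨y, hy⟩ := ((tendsto_cdf_atTop μ).eventually (eventually_ge_nhds hu.2)).exists
  obtain ⟨z, hz⟩ := ((tendsto_cdf_atBot μ).eventually (eventually_lt_nhds hu.1)).exists
  have hbdd : BddBelow {x | u ≤ cdf μ x} :=
    ⟨z, fun w hw => ((monotone_cdf μ).reflect_lt (hz.trans_le hw)).le⟩
  refine ⟨fun h => ?_, fun h => csInf_le hbdd h⟩
  have hright : ∀ᶠ w in 𝓝[>] x, u ≤ cdf μ w := by
    filter_upwards [self_mem_nhdsWithin] with w hw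
    obtain ⟨v, hv, hvw⟩ := exists_lt_of_csInf_lt ⟨y, hy⟩ (h.trans_lt hw)
    exact hv.trans (monotone_cdf μ hvw.le)
  exact ge_of_tendsto (((cdf μ).right_continuous x).mono_left
    (nhdsWithin_mono _ Ioi_subset_Ici_self)) hright

theorem aemeasurable_quantile (μ : Measure ℝ) :
    AEMeasurable (quantile μ) (volume.restrict (Ioo (0 : ℝ) 1)) :=
  aemeasurable_restrict_of_monotoneOn measurableSet_Ioo fun _u hu _v hv huv =>
    (quantile_le_iff μ hu).2 (huv.trans ((quantile_le_iff μ hv).1 le_rfl))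

theorem map_quantile (μ : Measure ℝ) [IsProbabilityMeasure μ] :
    (volume.restrict (Ioo (0 : ℝ) 1)).map (quantile μ) = μ := by
  have : IsProbabilityMeasure (volume.restrict (Ioo (0 : ℝ) 1)) := ⟨by simp⟩
  have := Measure.isProbabilityMeasure_map (aemeasurable_quantile μ)
  refine Measure.ext_of_Iic _ _ fun x => ?_
  have hpre : quantile μ ⁻¹' Iic x ∩ Ioo 0 1 = Iic (cdf μ x) ∩ Ioo 0 1 := by
    ext u
    exact and_congr_left fun hu => quantile_le_iff μ hu
  rw [Measure.map_apply_of_aemeasurable (aemeasurable_quantile μ) measurableSet_Iic,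
    ← ofReal_cdf μ x, Measure.restrict_apply' measurableSet_Ioo, hpre,
    measure_congr ((ae_eq_refl _).inter Ioo_ae_eq_Ioc), inter_comm, Ioc_inter_Iic,
    min_eq_right (cdf_le_one μ x), Real.volume_Ioc, sub_zero]

/- One of the two extreme quarters of `[a, b]` keeps a distance at least `(b - a) / 4` from `0`. -/
theorem ofReal_sub_rpow_le_lintegral (hp : 1 ≤ p) {a b : ℝ} (hab : a ≤ b) :
    ENNReal.ofReal ((b - a) ^ p) ≤
      ENNReal.ofReal (4 ^ p) * ∫⁻ x in Ico a b, ENNReal.ofReal (|x| ^ (p - 1)) := by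
  rcases hab.eq_or_lt with rfl | hlt
  · simp [Real.zero_rpow (by linarith : p ≠ 0)]
  obtain ⟨L, hL⟩ : ∃ L, L = (b - a) / 4 := ⟨_, rfl⟩
  have hL0 : 0 < L := by linarith
  obtain ⟨c, hsub, hfar⟩ : ∃ c, Ico c (c + L) ⊆ Ico a b ∧ ∀ x ∈ Ico c (c + L), L ≤ |x| := by
    rcases le_total 0 (a + b) with h | h
    · exact ⟨b - L, Ico_subset_Ico (by linarith) (by linarith),
        fun x hx => le_trans (by linarith [hx.1]) (le_abs_self x)⟩
    · exact ⟨a, Ico_subset_Ico le_rfl (by linarith),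
        fun x hx => le_trans (by linarith [hx.2]) (neg_le_abs x)⟩
  calc ENNReal.ofReal ((b - a) ^ p) = ENNReal.ofReal (4 ^ p) * ENNReal.ofReal (L ^ p) := by
        rw [← ENNReal.ofReal_mul (by positivity), ← Real.mul_rpow (by norm_num) hL0.le, hL,
          mul_div_cancel₀ _ four_ne_zero]
    _ = ENNReal.ofReal (4 ^ p) * ∫⁻ _ in Ico c (c + L), ENNReal.ofReal (L ^ (p - 1)) := by
        rw [setLIntegral_const, Real.volume_Ico, add_sub_cancel_left,
          ← ENNReal.ofReal_mul (Real.rpow_nonneg hL0.le _), ← Real.rpow_add_one hL0.ne',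
          sub_add_cancel]
    _ ≤ ENNReal.ofReal (4 ^ p) * ∫⁻ x in Ico c (c + L), ENNReal.ofReal (|x| ^ (p - 1)) := by
        gcongr 1
        exact setLIntegral_mono' measurableSet_Ico fun _ hx => ENNReal.ofReal_le_ofReal
          (Real.rpow_le_rpow hL0.le (hfar _ hx) (by linarith))
    _ ≤ _ := by gcongr

/-- The quantile coupling of two probability measures: their quantile functions evaluated at a
common uniform variable. -/
def quantileCoupling (μ ν : Measure ℝ) : Measure (ℝ × ℝ) :=
  (volume.restrict (Ioo (0 : ℝ) 1)).map fun u => (quantile μ u, quantile ν u)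

instance isFiniteMeasure_quantileCoupling (μ ν : Measure ℝ) :
    IsFiniteMeasure (quantileCoupling μ ν) := by
  unfold quantileCoupling
  infer_instance

theorem fst_quantileCoupling (μ ν : Measure ℝ) [IsProbabilityMeasure μ] :
    (quantileCoupling μ ν).fst = μ := by
  rw [quantileCoupling, Measure.fst_map_prodMk₀ (aemeasurable_quantile ν), map_quantile]

theorem snd_quantileCoupling (μ ν : Measure ℝ) [IsProbabilityMeasure ν] :
    (quantileCoupling μ ν).snd = ν := by
  rw [quantileCoupling, Measure.snd_map_prodMk₀ (aemeasurable_quantile μ), map_quantile]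

theorem mem_Ico_quantile_iff (μ ν : Measure ℝ) {u x : ℝ} (hu : u ∈ Ioo (0 : ℝ) 1) :
    x ∈ Ico (min (quantile μ u) (quantile ν u)) (max (quantile μ u) (quantile ν u)) ↔
      u ∈ uIoc (cdf μ x) (cdf ν x) := by
  have hμ := quantile_le_iff μ (x := x) hu
  have hν := quantile_le_iff ν (x := x) hu
  rw [uIoc, mem_Ico, mem_Ioc, min_le_iff, lt_max_iff, min_lt_iff, le_max_iff, hμ, hν,
    lt_iff_lt_of_le_iff_le hμ, lt_iff_lt_of_le_iff_le hν, and_comm]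

theorem measurableSet_mem_uIoc_cdf (μ ν : Measure ℝ) :
    MeasurableSet {z : ℝ × ℝ | z.1 ∈ uIoc (cdf μ z.2) (cdf ν z.2)} := by
  have hcdf : ∀ μ : Measure ℝ, Measurable fun z : ℝ × ℝ => cdf μ z.2 :=
    fun μ => (monotone_cdf μ).measurable.comp measurable_snd
  exact (measurableSet_lt ((hcdf μ).min (hcdf ν)) measurable_fst).inter
    (measurableSet_le measurable_fst ((hcdf μ).max (hcdf ν)))

theorem lintegral_quantileCoupling_le (hp : 1 ≤ p) (μ ν : Measure ℝ) :
    ∫⁻ z, ENNReal.ofReal (|z.1 - z.2| ^ p) ∂(quantileCoupling μ ν) ≤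
      ENNReal.ofReal (4 ^ p) * cdfLoss p (cdf μ) (cdf ν) := by
  let w : ℝ → ℝ≥0∞ := fun x => ENNReal.ofReal (|x| ^ (p - 1))
  have hw : Measurable w := (measurable_id.abs.pow_const _).ennreal_ofReal
  let I : ℝ → Set ℝ := fun x => uIoc (cdf μ x) (cdf ν x)
  have hswap : AEMeasurable (Function.uncurry fun u x => (I x).indicator (fun _ => w x) u)
      ((volume.restrict (Ioo (0 : ℝ) 1)).prod volume) :=
    ((hw.comp measurable_snd).indicator (measurableSet_mem_uIoc_cdf μ ν)).aemeasurable
  rw [quantileCoupling, lintegral_map' (measurable_ofReal_abs_sub_rpow p).aemeasurable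
    ((aemeasurable_quantile μ).prodMk (aemeasurable_quantile ν))]
  calc ∫⁻ u in Ioo (0 : ℝ) 1, ENNReal.ofReal (|quantile μ u - quantile ν u| ^ p)
      ≤ ∫⁻ u in Ioo (0 : ℝ) 1, ENNReal.ofReal (4 ^ p) *
          ∫⁻ x, (I x).indicator (fun _ => w x) u := by
        refine setLIntegral_mono' measurableSet_Ioo fun u hu => ?_
        rw [← max_sub_min_eq_abs']
        refine (ofReal_sub_rpow_le_lintegral hp min_le_max).trans_eq (congrArg _ ?_)
        rw [← lintegral_indicator measurableSet_Ico]
        exact lintegral_congr fun x => indicator_eq_indicator (mem_Ico_quantile_iff μ ν hu) rfl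
    _ = ENNReal.ofReal (4 ^ p) *
          ∫⁻ x, ∫⁻ u in Ioo (0 : ℝ) 1, (I x).indicator (fun _ => w x) u := by
        rw [lintegral_const_mul' _ _ ENNReal.ofReal_ne_top, lintegral_lintegral_swap hswap]
    _ ≤ ENNReal.ofReal (4 ^ p) * cdfLoss p (cdf μ) (cdf ν) := by
        gcongr 1
        refine lintegral_mono fun x => (setLIntegral_le_lintegral _ _).trans_eq ?_
        rw [lintegral_indicator measurableSet_uIoc, setLIntegral_const, Real.volume_uIoc,
          ENNReal.ofReal_mul (by positivity), abs_sub_comm]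

end Wasserstein

/-! ### The bias -/

/-- The law `K_h` with density `x ↦ h⁻¹ k(x / h)`; as the law of `h Z`, where `Z` has density `k`,
it makes sense for every real `h`. -/
def kernelLaw (k : ℝ → ℝ) (h : ℝ) : Measure ℝ :=
  (volume.withDensity fun x => ENNReal.ofReal (k x)).map (h * ·)

section kernelLaw

variable {p : ℝ} {k : ℝ → ℝ}

theorem IsKernel.isProbabilityMeasure_kernelLaw (hk : IsKernel p k) (h : ℝ) :
    IsProbabilityMeasure (kernelLaw k h) := by
  have : IsProbabilityMeasure (volume.withDensity fun x => ENNReal.ofReal (k x)) := ⟨by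
    rw [withDensity_apply _ .univ, Measure.restrict_univ,
      ← ofReal_integral_eq_lintegral_ofReal hk.integrable (.of_forall hk.nonneg),
      hk.integral_eq_one, ENNReal.ofReal_one]⟩
  exact Measure.isProbabilityMeasure_map (by fun_prop)

theorem lintegral_kernelLaw (hk : AEMeasurable k) (h : ℝ) {g : ℝ → ℝ≥0∞} (hg : Measurable g) :
    ∫⁻ x, g x ∂(kernelLaw k h) = ∫⁻ x, ENNReal.ofReal (k x) * g (h * x) := by
  rw [kernelLaw, lintegral_map hg (by fun_prop),
    lintegral_withDensity_eq_lintegral_mul₀ hk.ennreal_ofReal (by fun_prop)]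
  rfl

theorem lintegral_rpow_kernelLaw (hk : AEMeasurable k) (p h : ℝ) :
    ∫⁻ x, ENNReal.ofReal (|x| ^ p) ∂(kernelLaw k h) =
      ENNReal.ofReal (|h| ^ p) * ∫⁻ x, ENNReal.ofReal (|x| ^ p * k x) := by
  rw [lintegral_kernelLaw hk h (by fun_prop),
    ← lintegral_const_mul' _ _ ENNReal.ofReal_ne_top]
  refine lintegral_congr fun x => ?_
  rw [abs_mul, Real.mul_rpow (abs_nonneg h) (abs_nonneg x), ENNReal.ofReal_mul (by positivity),
    ENNReal.ofReal_mul (by positivity), mul_comm, mul_assoc]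

theorem wasserstein_rpow_le_cdfLoss_conv_add {κ : Measure ℝ} [IsProbabilityMeasure κ] (hp : 1 ≤ p)
    (μ ν : Measure ℝ) [IsProbabilityMeasure μ] [IsProbabilityMeasure ν] :
    wasserstein p ν μ ^ p ≤ 2 ^ (p - 1) *
      (ENNReal.ofReal (4 ^ p) * cdfLoss p (cdf ν) (cdf (μ ∗ κ)) +
        ∫⁻ x, ENNReal.ofReal (|x| ^ p) ∂κ) := by
  have hm : Measurable fun z : ℝ × ℝ => (z.1 + z.2, z.1) := by fun_prop
  have hfst : ((μ.prod κ).map fun z => (z.1 + z.2, z.1)).fst = μ ∗ κ :=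
    Measure.fst_map_prodMk measurable_fst
  have hsnd : ((μ.prod κ).map fun z => (z.1 + z.2, z.1)).snd = μ :=
    (Measure.snd_map_prodMk (by fun_prop)).trans Measure.fst_prod
  refine (wasserstein_rpow_le_add hp (fst_quantileCoupling ν (μ ∗ κ))
    (snd_quantileCoupling ν (μ ∗ κ)) hfst hsnd).trans ?_
  gcongr
  · exact lintegral_quantileCoupling_le hp _ _
  · rw [lintegral_map (measurable_ofReal_abs_sub_rpow p) hm]
    simp only [add_sub_cancel_left]
    refine (lintegral_map (f := fun x => ENNReal.ofReal (|x| ^ p)) (by fun_prop)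
      measurable_snd).symm.trans_le (le_of_eq ?_)
    rw [← Measure.snd, Measure.snd_prod]

end kernelLaw

/-! ### Weighted integrals of root mean squares -/

section RootMeanSquare

variable {α : Type*} [MeasurableSpace α] {μ : Measure α}

theorem rpow_half_sq (a : ℝ≥0∞) : (a ^ (1 / 2 : ℝ)) ^ 2 = a := by
  rw [← ENNReal.rpow_natCast, ← ENNReal.rpow_mul]; norm_num

theorem sq_rpow_half (a : ℝ≥0∞) : (a ^ 2) ^ (1 / 2 : ℝ) = a := by
  rw [← ENNReal.rpow_natCast, ← ENNReal.rpow_mul]; norm_num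

theorem mul_rpow_half (a b : ℝ≥0∞) :
    (a * b) ^ (1 / 2 : ℝ) = a ^ (1 / 2 : ℝ) * b ^ (1 / 2 : ℝ) :=
  ENNReal.mul_rpow_of_nonneg _ _ (by norm_num)

theorem rpow_half_add_le (a b : ℝ≥0∞) :
    (a + b) ^ (1 / 2 : ℝ) ≤ a ^ (1 / 2 : ℝ) + b ^ (1 / 2 : ℝ) :=
  ENNReal.rpow_add_le_add_rpow _ _ (by norm_num) (by norm_num)

theorem lintegral_mul_rpow_half_le {f g : α → ℝ≥0∞} (hf : AEMeasurable f μ)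
    (hg : AEMeasurable g μ) :
    ∫⁻ x, f x * g x ^ (1 / 2 : ℝ) ∂μ ≤
      (∫⁻ x, f x ^ 2 ∂μ) ^ (1 / 2 : ℝ) * (∫⁻ x, g x ∂μ) ^ (1 / 2 : ℝ) := by
  have h := ENNReal.lintegral_mul_le_Lp_mul_Lq μ Real.HolderConjugate.two_two hf
    (hg.pow_const (1 / 2 : ℝ))
  simpa only [Pi.mul_apply, ENNReal.rpow_two, rpow_half_sq] using h

theorem lintegral_rpow_half_le [IsProbabilityMeasure μ] {g : α → ℝ≥0∞} (hg : AEMeasurable g μ) :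
    ∫⁻ x, g x ^ (1 / 2 : ℝ) ∂μ ≤ (∫⁻ x, g x ∂μ) ^ (1 / 2 : ℝ) := by
  simpa using lintegral_mul_rpow_half_le aemeasurable_one hg

theorem rpow_half_lintegral_add_sq_le {f g : α → ℝ≥0∞} (hf : AEMeasurable f μ)
    (hg : AEMeasurable g μ) :
    (∫⁻ x, (f x + g x) ^ 2 ∂μ) ^ (1 / 2 : ℝ) ≤
      (∫⁻ x, f x ^ 2 ∂μ) ^ (1 / 2 : ℝ) + (∫⁻ x, g x ^ 2 ∂μ) ^ (1 / 2 : ℝ) := by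
  simpa using ENNReal.lintegral_Lp_add_le hf hg one_le_two

end RootMeanSquare

section Weights

variable {s : ℝ} {m : ℕ}

theorem lintegral_ofReal_one_add_rpow_sq_lt_top (hs : s < -(1 / 2)) :
    ∫⁻ x : ℝ, ENNReal.ofReal ((1 + |x|) ^ s) ^ 2 < ∞ := by
  have h := finite_integral_one_add_norm (E := ℝ) (μ := volume) (r := -(s * 2))
    (by simp only [Module.finrank_self, Nat.cast_one]; linarith)
  refine lt_of_eq_of_lt (lintegral_congr fun x => ?_) h
  rw [← ENNReal.ofReal_pow (by positivity), ← Real.rpow_two, ← Real.rpow_mul (by positivity),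
    Real.norm_eq_abs, neg_neg]

theorem exists_lintegral_one_add_rpow_mul_rpow_half_le (hm : s + 1 / 2 < m) :
    ∃ C : ℝ≥0∞, C ≠ ∞ ∧ ∀ g : ℝ → ℝ≥0∞, AEMeasurable g →
      ∫⁻ x, ENNReal.ofReal ((1 + |x|) ^ s) * g x ^ (1 / 2 : ℝ) ≤
        C * (∫⁻ x, ENNReal.ofReal ((1 + |x|) ^ (2 * m)) * g x) ^ (1 / 2 : ℝ) := by
  refine ⟨(∫⁻ x : ℝ, ENNReal.ofReal ((1 + |x|) ^ (s - m)) ^ 2) ^ (1 / 2 : ℝ),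
    ENNReal.rpow_ne_top_of_nonneg (by norm_num)
      (lintegral_ofReal_one_add_rpow_sq_lt_top (by linarith)).ne, fun g hg => ?_⟩
  calc ∫⁻ x, ENNReal.ofReal ((1 + |x|) ^ s) * g x ^ (1 / 2 : ℝ)
      = ∫⁻ x, ENNReal.ofReal ((1 + |x|) ^ (s - m)) *
          (ENNReal.ofReal ((1 + |x|) ^ (2 * m)) * g x) ^ (1 / 2 : ℝ) := by
        refine lintegral_congr fun x => ?_
        have hx : (0 : ℝ) < 1 + |x| := by positivity
        rw [mul_rpow_half, mul_comm 2 m, pow_mul, ENNReal.ofReal_pow (by positivity), sq_rpow_half,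
          ← mul_assoc, ← ENNReal.ofReal_mul (by positivity), ← Real.rpow_natCast,
          ← Real.rpow_add hx, sub_add_cancel]
    _ ≤ _ := lintegral_mul_rpow_half_le
        (((measurable_const.add measurable_id.abs).pow_const _).ennreal_ofReal.aemeasurable)
        (by fun_prop)

theorem lintegral_one_add_rpow_mul_enorm_lt_top (hm : s + 1 / 2 < m) {f : ℝ → ℂ}
    (hf : AEMeasurable f) (h : ∫⁻ v, ENNReal.ofReal ((1 + |v|) ^ (2 * m) * ‖f v‖ ^ 2) < ∞) :
    ∫⁻ v, ENNReal.ofReal ((1 + |v|) ^ s) * ‖f v‖ₑ < ∞ := by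
  obtain ⟨C, hC, hle⟩ := exists_lintegral_one_add_rpow_mul_rpow_half_le hm
  have hsq := hle (fun v => ‖f v‖ₑ ^ 2) (by fun_prop)
  simp only [sq_rpow_half] at hsq
  refine hsq.trans_lt (ENNReal.mul_lt_top hC.lt_top
    (ENNReal.rpow_lt_top_of_nonneg (by norm_num) (ne_of_lt ?_)))
  simpa only [ENNReal.ofReal_mul (pow_nonneg (add_nonneg zero_le_one (abs_nonneg _)) _),
    ENNReal.ofReal_pow (norm_nonneg _), ofReal_norm] using h

theorem lintegral_le_lintegral_one_add_rpow_mul (hs : 0 ≤ s) (f : ℝ → ℝ≥0∞) :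
    ∫⁻ v, f v ≤ ∫⁻ v, ENNReal.ofReal ((1 + |v|) ^ s) * f v :=
  lintegral_mono fun v => le_mul_of_one_le_left zero_le
    (ENNReal.one_le_ofReal.2 (Real.one_le_rpow (by linarith [abs_nonneg v]) hs))

end Weights

/-- The square root of the probability that a variable of law `ν` has absolute value at
least `x`. -/
def rootTail (ν : Measure ℝ) (x : ℝ) : ℝ≥0∞ := ν {y | x ≤ |y|} ^ (1 / 2 : ℝ)

theorem measurable_ofReal_abs_rpow (s : ℝ) : Measurable fun x : ℝ => ENNReal.ofReal (|x| ^ s) :=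
  (measurable_id.abs.pow_const s).ennreal_ofReal

section RootTail

variable {p : ℝ} {ν : Measure ℝ}

theorem antitone_rootTail (ν : Measure ℝ) : Antitone (rootTail ν) := fun _ _ h =>
  ENNReal.rpow_le_rpow (measure_mono fun _ hy => h.trans hy) (by norm_num)

theorem rootTail_le_one (ν : Measure ℝ) [IsProbabilityMeasure ν] (x : ℝ) : rootTail ν x ≤ 1 :=
  ENNReal.rpow_le_one prob_le_one (by norm_num)

@[fun_prop]
theorem measurable_rootTail (ν : Measure ℝ) : Measurable (rootTail ν) :=
  (antitone_rootTail ν).measurable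

theorem lintegral_comp_abs (g : ℝ → ℝ≥0∞) : ∫⁻ x, g |x| = 2 * ∫⁻ x in Ioi 0, g x := by
  have hpos : ∫⁻ x in Ioi 0, g |x| = ∫⁻ x in Ioi 0, g x :=
    setLIntegral_congr_fun measurableSet_Ioi fun x hx => by rw [abs_of_pos hx]
  have hneg : ∫⁻ x in Iic 0, g |x| = ∫⁻ x in Ioi 0, g |x| := by
    have h := (Measure.measurePreserving_neg (volume : Measure ℝ)).setLIntegral_comp_preimage_emb
      (MeasurableEquiv.neg ℝ).measurableEmbedding (fun x => g |x|) (Iic 0)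
    simpa only [abs_neg, neg_preimage, neg_Iic, neg_zero,
      setLIntegral_congr (Ioi_ae_eq_Ici (a := (0 : ℝ))).symm] using h.symm
  rw [← lintegral_add_compl _ (measurableSet_Ioi (a := (0 : ℝ))), compl_Ioi, hneg, hpos, two_mul]

theorem lintegral_rpow_mul_rootTail_ne_top [IsFiniteMeasure ν]
    (htail : ∫⁻ x in Ioi (0 : ℝ), ENNReal.ofReal (|x| ^ (p - 1) * √(ν.real {y | x ≤ |y|})) < ∞)
    {c : ℝ} (hc : 0 < c) :
    ∫⁻ x, ENNReal.ofReal (|x| ^ (p - 1)) * rootTail ν (|x| / c) ≠ ∞ := by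
  set g : ℝ → ℝ≥0∞ := fun x => ENNReal.ofReal (|x| ^ (p - 1)) * rootTail ν x with hg
  have hfin : ∫⁻ x, g |x| ≠ ∞ := by
    rw [lintegral_comp_abs]
    refine ENNReal.mul_ne_top ENNReal.ofNat_ne_top (ne_of_lt ?_)
    have hroot : ∀ x, ENNReal.ofReal √(ν.real {y | x ≤ |y|}) = rootTail ν x := fun x => by
      rw [Real.sqrt_eq_rpow, ← ENNReal.ofReal_rpow_of_nonneg measureReal_nonneg one_half_pos.le,
        ofReal_measureReal, rootTail]
    simpa only [hg, ENNReal.ofReal_mul (Real.rpow_nonneg (abs_nonneg _) _), hroot] using htail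
  have hscale : ∀ x, ENNReal.ofReal (|x| ^ (p - 1)) * rootTail ν (|x| / c) =
      ENNReal.ofReal (c ^ (p - 1)) * g |x / c| := fun x => by
    simp only [hg, abs_abs, abs_div, abs_of_pos hc]
    rw [← mul_assoc, ← ENNReal.ofReal_mul (by positivity), Real.div_rpow (abs_nonneg x) hc.le,
      mul_div_cancel₀ _ (Real.rpow_pos_of_pos hc _).ne']
  simp_rw [hscale]
  rw [lintegral_const_mul' _ _ ENNReal.ofReal_ne_top,
    lintegral_comp_div (fun x => g |x|) hc.ne']
  finiteness

theorem lintegral_add_one_rpow_mul_rootTail_ne_top (hp : 1 ≤ p) [IsProbabilityMeasure ν]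
    (htail : ∫⁻ x, ENNReal.ofReal (|x| ^ (p - 1)) * rootTail ν (|x| / 3) ≠ ∞) :
    ∫⁻ t : ℝ, ENNReal.ofReal ((|t| + 1) ^ (p - 1)) * rootTail ν ((|t| - 1) / 2) ≠ ∞ := by
  have hle : ∀ t : ℝ, ENNReal.ofReal ((|t| + 1) ^ (p - 1)) * rootTail ν ((|t| - 1) / 2) ≤
      (Icc (-3 : ℝ) 3).indicator (fun _ => ENNReal.ofReal (4 ^ (p - 1))) t +
      ENNReal.ofReal (2 ^ (p - 1)) *
        (ENNReal.ofReal (|t| ^ (p - 1)) * rootTail ν (|t| / 3)) := fun t => by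
    by_cases ht : t ∈ Icc (-3 : ℝ) 3
    · refine le_add_right ?_
      rw [indicator_of_mem ht, ← mul_one (ENNReal.ofReal (4 ^ _))]
      have h3 : |t| ≤ 3 := abs_le.2 ht
      gcongr
      · linarith
      · exact rootTail_le_one ν _
    · refine le_add_left ?_
      have h3 : 3 < |t| := by rw [mem_Icc, ← abs_le] at ht; exact not_le.1 ht
      rw [← mul_assoc, ← ENNReal.ofReal_mul (by positivity),
        ← Real.mul_rpow zero_le_two (abs_nonneg t)]
      gcongr
      · linarith
      · exact antitone_rootTail ν (by linarith)
  refine ne_of_lt ((lintegral_mono hle).trans_lt ?_)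
  rw [lintegral_add_left (measurable_const.indicator measurableSet_Icc),
    lintegral_const_mul' _ _ ENNReal.ofReal_ne_top, lintegral_indicator measurableSet_Icc,
    setLIntegral_const]
  exact ENNReal.add_lt_top.2 ⟨ENNReal.mul_lt_top ENNReal.ofReal_lt_top (by simp),
    ENNReal.mul_lt_top ENNReal.ofReal_lt_top htail.lt_top⟩

end RootTail

section Convolution

variable {p : ℝ} {m : ℕ} {ν : Measure ℝ} {g : ℝ → ℝ≥0∞}

theorem lintegral_lintegral_comp_sub (hg : Measurable g) (ν : Measure ℝ) [SFinite ν] :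
    ∫⁻ x, ∫⁻ y, g (x - y) ∂ν = (∫⁻ x, g x) * ν univ := by
  rw [lintegral_lintegral_swap (by fun_prop)]
  simp_rw [lintegral_sub_right_eq_self g]
  rw [lintegral_const]

theorem measurable_setLIntegral_comp_sub (hg : Measurable g) (ν : Measure ℝ) [SFinite ν]
    {A : Set (ℝ × ℝ)} (hA : MeasurableSet A) :
    Measurable fun x => ∫⁻ y in Prod.mk x ⁻¹' A, g (x - y) ∂ν := by
  have hF : Measurable fun z : ℝ × ℝ => g (z.1 - z.2) := by fun_prop
  simp_rw [← lintegral_indicator (measurable_prodMk_left hA)]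
  exact (hF.indicator hA).lintegral_prod_right'

theorem lintegral_eq_lintegral_Icc {F : ℝ → ℝ≥0∞} (hF : Measurable F) :
    ∫⁻ x, F x = ∫⁻ t, ∫⁻ x in Icc t (t + 1), F x := by
  have hswap : ∀ t, ∫⁻ x in Icc t (t + 1), F x =
      ∫⁻ x, (Icc (x - 1) x).indicator (fun _ => F x) t := fun t => by
    rw [← lintegral_indicator measurableSet_Icc]
    refine lintegral_congr fun x => ?_
    have : x ∈ Icc t (t + 1) ↔ t ∈ Icc (x - 1) x := by
      rw [mem_Icc, mem_Icc, sub_le_iff_le_add, and_comm]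
    simp only [indicator, this]
  have hA : MeasurableSet {z : ℝ × ℝ | z.1 ∈ Icc (z.2 - 1) z.2} :=
    (measurableSet_le (measurable_snd.sub_const 1) measurable_fst).inter
      (measurableSet_le measurable_fst measurable_snd)
  simp_rw [hswap]
  rw [lintegral_lintegral_swap (by exact ((hF.comp measurable_snd).indicator hA).aemeasurable)]
  simp [lintegral_indicator measurableSet_Icc]

theorem lintegral_one_add_pow_mul_setLIntegral_near_le (hg : Measurable g) (m : ℕ)
    (ν : Measure ℝ) [IsProbabilityMeasure ν] :
    ∫⁻ x : ℝ, ENNReal.ofReal ((1 + |x|) ^ (2 * m)) * ∫⁻ y in {y | |y| ≤ |x| / 2}, g (x - y) ∂ν ≤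
      (2 ^ m) ^ 2 * ∫⁻ z, ENNReal.ofReal ((1 + |z|) ^ (2 * m)) * g z := by
  set w : ℝ → ℝ≥0∞ := fun x => ENNReal.ofReal ((1 + |x|) ^ (2 * m))
  have hwle : ∀ x y : ℝ, |y| ≤ |x| / 2 → w x ≤ (2 ^ m) ^ 2 * w (x - y) := fun x y hy => by
    have hxy : 1 + |x| ≤ 2 * (1 + |x - y|) := by linarith [abs_sub_abs_le_abs_sub x y]
    have htwo : ((2 : ℝ≥0∞) ^ m) ^ 2 = ENNReal.ofReal (2 ^ (2 * m)) := by
      rw [← pow_mul', ENNReal.ofReal_pow zero_le_two, ENNReal.ofReal_ofNat]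
    rw [htwo, ← ENNReal.ofReal_mul (by positivity), ← mul_pow]
    exact ENNReal.ofReal_le_ofReal (pow_le_pow_left₀ (by positivity) hxy _)
  calc ∫⁻ x, w x * ∫⁻ y in {y | |y| ≤ |x| / 2}, g (x - y) ∂ν
      ≤ ∫⁻ x, ∫⁻ y, (2 ^ m) ^ 2 * (w (x - y) * g (x - y)) ∂ν := by
        refine lintegral_mono fun x => ?_
        rw [← lintegral_const_mul' _ _ ENNReal.ofReal_ne_top]
        refine (setLIntegral_mono' (measurableSet_le (by fun_prop) (by fun_prop))
          fun y hy => ?_).trans (setLIntegral_le_lintegral _ _)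
        rw [← mul_assoc]
        gcongr
        exact hwle x y hy
    _ = _ := by
        simp_rw [lintegral_const_mul' _ _ (by finiteness : ((2 : ℝ≥0∞) ^ m) ^ 2 ≠ ∞)]
        rw [lintegral_lintegral_comp_sub (g := fun z => w z * g z) (by fun_prop) ν, measure_univ,
          mul_one]

theorem lintegral_rpow_mul_rpow_half_setLIntegral_far_le (hp : 1 ≤ p) (hg : Measurable g)
    (ν : Measure ℝ) [SFinite ν] :
    ∫⁻ x : ℝ, ENNReal.ofReal (|x| ^ (p - 1)) *
        (∫⁻ y in {y | |y| ≤ |x| / 2}ᶜ, g (x - y) ∂ν) ^ (1 / 2 : ℝ) ≤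
      (∫⁻ t : ℝ, ENNReal.ofReal ((|t| + 1) ^ (p - 1)) * rootTail ν ((|t| - 1) / 2)) *
        (∫⁻ x, g x) ^ (1 / 2 : ℝ) := by
  have hA : MeasurableSet {z : ℝ × ℝ | |z.2| ≤ |z.1| / 2} :=
    measurableSet_le (by fun_prop) (by fun_prop)
  have hfar : Measurable fun x => ∫⁻ y in {y | |y| ≤ |x| / 2}ᶜ, g (x - y) ∂ν :=
    measurable_setLIntegral_comp_sub hg ν hA.compl
  have hwt : Measurable fun t : ℝ =>
      ENNReal.ofReal ((|t| + 1) ^ (p - 1)) * rootTail ν ((|t| - 1) / 2) :=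
    ((measurable_id.abs.add_const 1).pow_const _).ennreal_ofReal.mul (by fun_prop)
  rw [lintegral_eq_lintegral_Icc (by
    exact (measurable_ofReal_abs_rpow (p - 1)).mul (hfar.pow_const _)),
    ← lintegral_mul_const _ hwt]
  refine lintegral_mono fun t => ?_
  set E : Set ℝ := {y | (|t| - 1) / 2 ≤ |y|}
  have : IsProbabilityMeasure ((volume : Measure ℝ).restrict (Icc t (t + 1))) :=
    ⟨by simp [Real.volume_Icc]⟩
  calc ∫⁻ x in Icc t (t + 1), ENNReal.ofReal (|x| ^ (p - 1)) *
          (∫⁻ y in {y | |y| ≤ |x| / 2}ᶜ, g (x - y) ∂ν) ^ (1 / 2 : ℝ)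
      ≤ ∫⁻ x in Icc t (t + 1), ENNReal.ofReal ((|t| + 1) ^ (p - 1)) *
          (∫⁻ y in E, g (x - y) ∂ν) ^ (1 / 2 : ℝ) := by
        refine setLIntegral_mono' measurableSet_Icc fun x hx => ?_
        have hxt : |x - t| ≤ 1 := abs_le.2 ⟨by linarith [hx.1], by linarith [hx.2]⟩
        gcongr
        · linarith [abs_sub_abs_le_abs_sub x t]
        · intro y hy
          have hxy : |x| / 2 < |y| := not_le.1 hy
          have htx := abs_sub_abs_le_abs_sub t x
          rw [abs_sub_comm] at htx
          change (|t| - 1) / 2 ≤ |y|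
          linarith
    _ ≤ ENNReal.ofReal ((|t| + 1) ^ (p - 1)) *
          (∫⁻ x in Icc t (t + 1), ∫⁻ y in E, g (x - y) ∂ν) ^ (1 / 2 : ℝ) := by
        rw [lintegral_const_mul' _ _ ENNReal.ofReal_ne_top]
        gcongr
        exact lintegral_rpow_half_le (Measurable.aemeasurable (by fun_prop))
    _ ≤ ENNReal.ofReal ((|t| + 1) ^ (p - 1)) * ((∫⁻ x, g x) * ν E) ^ (1 / 2 : ℝ) := by
        gcongr
        refine (setLIntegral_le_lintegral _ _).trans_eq ?_
        rw [lintegral_lintegral_comp_sub hg, Measure.restrict_apply_univ]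
    _ = _ := by rw [mul_comm (lintegral _ _), mul_rpow_half, ← mul_assoc]; rfl

-- Where `2 |y| ≤ |x|` the weight moves onto `g`, as `|x| ≤ 2 |x - y|`; elsewhere the tail of `ν`
-- takes over.
theorem exists_lintegral_rpow_mul_rpow_half_conv_le (hp : 1 ≤ p) (hm : p - 1 / 2 < m)
    [IsProbabilityMeasure ν]
    (htail : ∫⁻ x, ENNReal.ofReal (|x| ^ (p - 1)) * rootTail ν (|x| / 3) ≠ ∞) :
    ∃ C : ℝ≥0∞, C ≠ ∞ ∧ ∀ g : ℝ → ℝ≥0∞, Measurable g →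
      ∫⁻ x, ENNReal.ofReal (|x| ^ (p - 1)) * (∫⁻ y, g (x - y) ∂ν) ^ (1 / 2 : ℝ) ≤
        C * (∫⁻ z, ENNReal.ofReal ((1 + |z|) ^ (2 * m)) * g z) ^ (1 / 2 : ℝ) := by
  obtain ⟨C₁, hC₁, hCS⟩ := exists_lintegral_one_add_rpow_mul_rpow_half_le (s := p - 1)
    (by linarith : p - 1 + 1 / 2 < m)
  set C₂ : ℝ≥0∞ := ∫⁻ t : ℝ, ENNReal.ofReal ((|t| + 1) ^ (p - 1)) * rootTail ν ((|t| - 1) / 2)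
  have hC₂ : C₂ ≠ ∞ := lintegral_add_one_rpow_mul_rootTail_ne_top hp htail
  refine ⟨C₁ * 2 ^ m + C₂, by finiteness, fun g hg => ?_⟩
  set I := ∫⁻ z, ENNReal.ofReal ((1 + |z|) ^ (2 * m)) * g z
  set near : ℝ → ℝ≥0∞ := fun x => ∫⁻ y in {y | |y| ≤ |x| / 2}, g (x - y) ∂ν
  set far : ℝ → ℝ≥0∞ := fun x => ∫⁻ y in {y | |y| ≤ |x| / 2}ᶜ, g (x - y) ∂ν
  have hA : MeasurableSet {z : ℝ × ℝ | |z.2| ≤ |z.1| / 2} :=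
    measurableSet_le (by fun_prop) (by fun_prop)
  have hnearm : Measurable near := measurable_setLIntegral_comp_sub hg ν hA
  have hnear : ∫⁻ x, ENNReal.ofReal (|x| ^ (p - 1)) * near x ^ (1 / 2 : ℝ) ≤
      C₁ * 2 ^ m * I ^ (1 / 2 : ℝ) := by
    calc _ ≤ ∫⁻ x, ENNReal.ofReal ((1 + |x|) ^ (p - 1)) * near x ^ (1 / 2 : ℝ) := by
          gcongr with x
          linarith
      _ ≤ C₁ * ((2 ^ m) ^ 2 * I) ^ (1 / 2 : ℝ) := (hCS near hnearm.aemeasurable).trans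
          (by gcongr; exact lintegral_one_add_pow_mul_setLIntegral_near_le hg m ν)
      _ = _ := by rw [mul_rpow_half, sq_rpow_half, mul_assoc]
  have hfar : ∫⁻ x, ENNReal.ofReal (|x| ^ (p - 1)) * far x ^ (1 / 2 : ℝ) ≤
      C₂ * I ^ (1 / 2 : ℝ) := by
    refine (lintegral_rpow_mul_rpow_half_setLIntegral_far_le hp hg ν).trans ?_
    gcongr
    simpa only [Real.rpow_natCast] using
      lintegral_le_lintegral_one_add_rpow_mul (s := (2 * m : ℕ)) (Nat.cast_nonneg _) g
  calc _ ≤ ∫⁻ x, (ENNReal.ofReal (|x| ^ (p - 1)) * near x ^ (1 / 2 : ℝ) +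
          ENNReal.ofReal (|x| ^ (p - 1)) * far x ^ (1 / 2 : ℝ)) := by
        refine lintegral_mono fun x => ?_
        rw [← mul_add, ← lintegral_add_compl _ (measurable_prodMk_left (x := x) hA)]
        gcongr
        exact rpow_half_add_le _ _
    _ ≤ _ := by
        rw [lintegral_add_left (by
          exact (measurable_ofReal_abs_rpow (p - 1)).mul (hnearm.pow_const _)), add_mul]
        exact add_le_add hnear hfar

end Convolution

section LowFrequency

variable {p : ℝ} {q : ℝ → ℂ}

theorem setLIntegral_ofReal_abs_rpow_le (hp : 1 ≤ p) (v : ℝ) :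
    ∫⁻ x in {x | |x| / 2 ≤ |v|}, ENNReal.ofReal (|x| ^ (p - 1)) ≤
      ENNReal.ofReal (2 * 2 ^ p) * ENNReal.ofReal (|v| ^ p) := by
  have hset : {x | |x| / 2 ≤ |v|} = Icc (-(2 * |v|)) (2 * |v|) := by
    ext x
    rw [mem_ofPred_eq, mem_Icc, ← abs_le, div_le_iff₀' two_pos]
  calc ∫⁻ x in {x | |x| / 2 ≤ |v|}, ENNReal.ofReal (|x| ^ (p - 1))
      ≤ ∫⁻ x in Icc (-(2 * |v|)) (2 * |v|), ENNReal.ofReal ((2 * |v|) ^ (p - 1)) := by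
        rw [hset]
        exact setLIntegral_mono' measurableSet_Icc fun x hx => ENNReal.ofReal_le_ofReal
          (Real.rpow_le_rpow (abs_nonneg x) (abs_le.2 hx) (by linarith))
    _ = ENNReal.ofReal (2 * ((2 * |v|) ^ (p - 1) * (2 * |v|))) := by
        rw [setLIntegral_const, Real.volume_Icc, ← ENNReal.ofReal_mul (by positivity)]
        ring_nf
    _ = _ := by
        rw [← Real.rpow_add_one' (by positivity) (by linarith), sub_add_cancel,
          Real.mul_rpow zero_le_two (abs_nonneg v), ← mul_assoc, ENNReal.ofReal_mul (by positivity)]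

theorem lintegral_rpow_mul_setLIntegral_le (hp : 1 ≤ p) {f : ℝ → ℝ≥0∞} (hf : AEMeasurable f) :
    ∫⁻ x : ℝ, ENNReal.ofReal (|x| ^ (p - 1)) * ∫⁻ v in {v | |x| / 2 ≤ |v|}, f v ≤
      ENNReal.ofReal (2 * 2 ^ p) * ∫⁻ v, ENNReal.ofReal (|v| ^ p) * f v := by
  have hA : MeasurableSet {z : ℝ × ℝ | |z.1| / 2 ≤ |z.2|} :=
    measurableSet_le (by fun_prop) (by fun_prop)
  set F : ℝ × ℝ → ℝ≥0∞ := {z : ℝ × ℝ | |z.1| / 2 ≤ |z.2|}.indicator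
    fun z => ENNReal.ofReal (|z.1| ^ (p - 1)) * f z.2
  have hF : AEMeasurable F (volume.prod volume) :=
    (((measurable_ofReal_abs_rpow _).comp measurable_fst).aemeasurable.mul hf.comp_snd).indicator hA
  calc ∫⁻ x : ℝ, ENNReal.ofReal (|x| ^ (p - 1)) * ∫⁻ v in {v | |x| / 2 ≤ |v|}, f v
      = ∫⁻ x, ∫⁻ v, F (x, v) := by
        refine lintegral_congr fun x => ?_
        rw [← lintegral_const_mul' _ _ ENNReal.ofReal_ne_top,
          ← lintegral_indicator (by exact measurable_prodMk_left hA)]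
        rfl
    _ = ∫⁻ v, (∫⁻ x in {x | |x| / 2 ≤ |v|}, ENNReal.ofReal (|x| ^ (p - 1))) * f v := by
        rw [lintegral_lintegral_swap (by exact hF)]
        refine lintegral_congr fun v => ?_
        rw [← lintegral_mul_const _ (measurable_ofReal_abs_rpow _),
          ← lintegral_indicator (by exact measurable_prodMk_right hA)]
        rfl
    _ ≤ ∫⁻ v, ENNReal.ofReal (2 * 2 ^ p) * (ENNReal.ofReal (|v| ^ p) * f v) := by
        simp_rw [← mul_assoc]
        gcongr with v
        exact setLIntegral_ofReal_abs_rpow_le hp v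
    _ = _ := lintegral_const_mul' _ _ ENNReal.ofReal_ne_top

-- If `q` lived on `|v| < |x| / 2` and `|y| < |x| / 2`, the two sides of the difference would agree.
theorem enorm_integral_Iic_sub_le (hq : Integrable q) (hone : ∫ v, q v = 1) (x y : ℝ) :
    ‖(∫ v in Iic (x - y), q v) - (if 0 ≤ x then 1 else 0)‖ₑ ≤
      (∫⁻ v in {v | |x| / 2 ≤ |v|}, ‖q v‖ₑ) +
        {y : ℝ | |x| / 2 ≤ |y|}.indicator (fun _ => ∫⁻ v, ‖q v‖ₑ) y := by
  obtain ⟨S, hle, hsub⟩ : ∃ S : Set ℝ,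
      ‖(∫ v in Iic (x - y), q v) - (if 0 ≤ x then 1 else 0)‖ₑ ≤ ∫⁻ v in S, ‖q v‖ₑ ∧
        (|y| < |x| / 2 → ∀ v ∈ S, |x| / 2 ≤ |v|) := by
    by_cases hx : 0 ≤ x
    · refine ⟨Ioi (x - y), ?_, fun hy v hv => ?_⟩
      · rw [if_pos hx, ← hone, ← integral_add_compl measurableSet_Iic hq, compl_Iic,
          sub_add_cancel_left, enorm_neg]
        exact enorm_integral_le_lintegral_enorm _
      · rw [abs_of_nonneg hx] at hy ⊢
        linarith [le_abs_self v, le_abs_self y, mem_Ioi.1 hv]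
    · refine ⟨Iic (x - y), ?_, fun hy v hv => ?_⟩
      · rw [if_neg hx, sub_zero]
        exact enorm_integral_le_lintegral_enorm _
      · rw [abs_of_neg (not_le.1 hx)] at hy ⊢
        linarith [neg_abs_le v, neg_abs_le y, mem_Iic.1 hv]
  refine hle.trans ?_
  by_cases hy : |x| / 2 ≤ |y|
  · rw [indicator_of_mem (by exact hy)]
    exact le_add_left (setLIntegral_le_lintegral _ _)
  · exact le_add_right (lintegral_mono_set (hsub (not_le.1 hy)))

theorem rpow_half_lintegral_integral_Iic_sub_le (hq : Integrable q) (hone : ∫ v, q v = 1)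
    (ν : Measure ℝ) [IsProbabilityMeasure ν] (x : ℝ) :
    (∫⁻ y, ‖(∫ v in Iic (x - y), q v) - (if 0 ≤ x then 1 else 0)‖ₑ ^ 2 ∂ν) ^ (1 / 2 : ℝ) ≤
      (∫⁻ v in {v | |x| / 2 ≤ |v|}, ‖q v‖ₑ) + (∫⁻ v, ‖q v‖ₑ) * rootTail ν (|x| / 2) := by
  set N := ∫⁻ v, ‖q v‖ₑ
  set E : Set ℝ := {y | |x| / 2 ≤ |y|}
  have hE : MeasurableSet E := measurableSet_le (by fun_prop) (by fun_prop)
  have hsq : ∀ y, E.indicator (fun _ => N) y ^ 2 = E.indicator (fun _ => N ^ 2) y := fun y => by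
    by_cases hy : y ∈ E
    · simp only [indicator_of_mem hy]
    · simp only [indicator_of_notMem hy, zero_pow two_ne_zero]
  calc _ ≤ (∫⁻ y, ((∫⁻ v in E, ‖q v‖ₑ) + E.indicator (fun _ => N) y) ^ 2 ∂ν) ^ (1 / 2 : ℝ) := by
        gcongr with y
        exact enorm_integral_Iic_sub_le hq hone x y
    _ ≤ _ := rpow_half_lintegral_add_sq_le aemeasurable_const
        (measurable_const.indicator hE).aemeasurable
    _ = _ := by
        rw [lintegral_const, measure_univ, mul_one, sq_rpow_half]
        simp_rw [hsq]
        rw [lintegral_indicator_const hE, mul_rpow_half, sq_rpow_half]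
        rfl

theorem lintegral_rpow_half_integral_Iic_le (hp : 1 ≤ p) (hq : Integrable q)
    (hone : ∫ v, q v = 1) (ν : Measure ℝ) [IsProbabilityMeasure ν] :
    ∫⁻ x : ℝ, ENNReal.ofReal (|x| ^ (p - 1)) * (∫⁻ y, ‖(∫ v in Iic (x - y), q v) -
        (if 0 ≤ x then 1 else 0)‖ₑ ^ 2 ∂ν) ^ (1 / 2 : ℝ) ≤
      (ENNReal.ofReal (2 * 2 ^ p) +
          ∫⁻ x, ENNReal.ofReal (|x| ^ (p - 1)) * rootTail ν (|x| / 2)) *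
        ∫⁻ v, ENNReal.ofReal ((1 + |v|) ^ p) * ‖q v‖ₑ := by
  set N := ∫⁻ v, ‖q v‖ₑ
  have hwt : Measurable fun x => ENNReal.ofReal (|x| ^ (p - 1)) * rootTail ν (|x| / 2) :=
    (measurable_ofReal_abs_rpow _).mul (by fun_prop)
  calc _ ≤ ∫⁻ x : ℝ, (ENNReal.ofReal (|x| ^ (p - 1)) * (∫⁻ v in {v | |x| / 2 ≤ |v|}, ‖q v‖ₑ) +
        N * (ENNReal.ofReal (|x| ^ (p - 1)) * rootTail ν (|x| / 2))) := by
        refine lintegral_mono fun x => ?_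
        rw [mul_left_comm N, ← mul_add]
        gcongr
        exact rpow_half_lintegral_integral_Iic_sub_le hq hone ν x
    _ ≤ _ := by
        rw [lintegral_add_right _ (hwt.const_mul N), add_mul,
          lintegral_const_mul _ hwt, mul_comm N]
        gcongr ?_ + _ * ?_
        · refine (lintegral_rpow_mul_setLIntegral_le hp hq.1.aemeasurable.enorm).trans ?_
          gcongr with v
          linarith
        · exact lintegral_le_lintegral_one_add_rpow_mul (by linarith) _

end LowFrequency

/-! ### Averages over the observations -/

section Sample

variable {Ω : Type*} [MeasurableSpace Ω] {P : Measure Ω} {n : ℕ}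

theorem map_prodProdProdComm {α β γ δ : Type*} [MeasurableSpace α] [MeasurableSpace β]
    [MeasurableSpace γ] [MeasurableSpace δ] (μ₁ : Measure α) (μ₂ : Measure β) (ν₁ : Measure γ)
    (ν₂ : Measure δ) [SFinite μ₁] [SFinite μ₂] [SFinite ν₁] [SFinite ν₂] :
    ((μ₁.prod μ₂).prod (ν₁.prod ν₂)).map (fun z => ((z.1.1, z.2.1), (z.1.2, z.2.2))) =
      (μ₁.prod ν₁).prod (μ₂.prod ν₂) := by
  refine Measure.ext_of_lintegral _ fun F hF => ?_
  have hm : Measurable fun z : (α × β) × γ × δ => ((z.1.1, z.2.1), (z.1.2, z.2.2)) := by fun_prop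
  calc ∫⁻ z, F z ∂((μ₁.prod μ₂).prod (ν₁.prod ν₂)).map _
      = ∫⁻ z, F ((z.1.1, z.2.1), (z.1.2, z.2.2)) ∂(μ₁.prod μ₂).prod (ν₁.prod ν₂) :=
        lintegral_map hF hm
    _ = ∫⁻ x, ∫⁻ y, F ((x.1, y.1), (x.2, y.2)) ∂ν₁.prod ν₂ ∂μ₁.prod μ₂ :=
        lintegral_prod _ (hF.comp hm).aemeasurable
    _ = ∫⁻ a, ∫⁻ b, ∫⁻ y, F ((a, y.1), (b, y.2)) ∂ν₁.prod ν₂ ∂μ₂ ∂μ₁ :=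
        lintegral_prod _ (hF.comp hm).lintegral_prod_right'.aemeasurable
    _ = ∫⁻ a, ∫⁻ b, ∫⁻ c, ∫⁻ d, F ((a, c), (b, d)) ∂ν₂ ∂ν₁ ∂μ₂ ∂μ₁ :=
        lintegral_congr fun a => lintegral_congr fun b =>
          lintegral_prod (fun y => F ((a, y.1), (b, y.2))) (by fun_prop)
    _ = ∫⁻ a, ∫⁻ c, ∫⁻ b, ∫⁻ d, F ((a, c), (b, d)) ∂ν₂ ∂μ₂ ∂ν₁ ∂μ₁ :=
        lintegral_congr fun a => lintegral_lintegral_swap (Measurable.lintegral_prod_right'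
          (f := fun z : (β × γ) × δ => F ((a, z.1.2), (z.1.1, z.2))) (by fun_prop)).aemeasurable
    _ = ∫⁻ a, ∫⁻ c, ∫⁻ w, F ((a, c), w) ∂μ₂.prod ν₂ ∂ν₁ ∂μ₁ :=
        lintegral_congr fun a => lintegral_congr fun c =>
          (lintegral_prod (fun w => F ((a, c), w)) (by fun_prop)).symm
    _ = ∫⁻ z, F z ∂(μ₁.prod ν₁).prod (μ₂.prod ν₂) := by
        rw [lintegral_prod _ hF.aemeasurable,
          lintegral_prod _ hF.lintegral_prod_right'.aemeasurable]

theorem indepFun_prodMk_prodMk [IsFiniteMeasure P] {α β γ δ : Type*} [MeasurableSpace α]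
    [MeasurableSpace β] [MeasurableSpace γ] [MeasurableSpace δ] {X₁ : Ω → α} {X₂ : Ω → β}
    {Y₁ : Ω → γ} {Y₂ : Ω → δ} (hX₁ : Measurable X₁) (hX₂ : Measurable X₂) (hY₁ : Measurable Y₁)
    (hY₂ : Measurable Y₂) (hX : IndepFun X₁ X₂ P) (hY : IndepFun Y₁ Y₂ P)
    (hXY : IndepFun (fun ω => (X₁ ω, X₂ ω)) (fun ω => (Y₁ ω, Y₂ ω)) P) :
    IndepFun (fun ω => (X₁ ω, Y₁ ω)) (fun ω => (X₂ ω, Y₂ ω)) P := by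
  have h₁ : IndepFun X₁ Y₁ P := hXY.comp measurable_fst measurable_fst
  have h₂ : IndepFun X₂ Y₂ P := hXY.comp measurable_snd measurable_snd
  rw [indepFun_iff_map_prod_eq_prod_map_map (by fun_prop) (by fun_prop)] at hX hY hXY h₁ h₂ ⊢
  rw [hX, hY] at hXY
  rw [h₁, h₂, ← map_prodProdProdComm, ← hXY,
    Measure.map_map (by fun_prop) (by fun_prop)]
  rfl

/-- `Y₁, …, Yₙ` are pairwise independent variables with common law `ν`; no more is used of the
observations. -/
structure IsPairwiseSample (P : Measure Ω) (ν : Measure ℝ) (Y : Fin n → Ω → ℝ) : Prop where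
  measurable : ∀ i, Measurable (Y i)
  law : ∀ i, P.map (Y i) = ν
  indep : Pairwise fun i j => IndepFun (Y i) (Y j) P

theorem IsConvolutionSample.isPairwiseSample [IsFiniteMeasure P] {μ με : Measure ℝ}
    {X ε : Fin n → Ω → ℝ} (h : IsConvolutionSample P μ με X ε) :
    IsPairwiseSample P (μ.conv με) fun i ω => X i ω + ε i ω where
  measurable i := (h.measurable_signal i).add (h.measurable_noise i)
  law i := by
    have hi : IndepFun (X i) (ε i) P :=
      h.indep.comp (φ := fun x : Fin n → ℝ => x i) (ψ := fun x : Fin n → ℝ => x i) (by fun_prop)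
        (by fun_prop)
    rw [← h.law_signal i, ← h.law_noise i]
    exact hi.map_add_eq_map_conv_map (h.measurable_signal i) (h.measurable_noise i)
  indep i j hij := by
    have hXε : IndepFun (fun ω => (X i ω, X j ω)) (fun ω => (ε i ω, ε j ω)) P :=
      h.indep.comp (φ := fun x => (x i, x j)) (ψ := fun x => (x i, x j)) (by fun_prop)
        (by fun_prop)
    exact (indepFun_prodMk_prodMk (h.measurable_signal i) (h.measurable_signal j)
      (h.measurable_noise i) (h.measurable_noise j) (h.indep_signal.indepFun hij)
      (h.indep_noise.indepFun hij) hXε).comp measurable_add measurable_add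

namespace IsPairwiseSample

variable {ν : Measure ℝ} {Y : Fin n → Ω → ℝ} {g : ℝ → ℝ}

theorem memLp_comp (h : IsPairwiseSample P ν Y) (hg : MemLp g 2 ν) (i : Fin n) :
    MemLp (fun ω => g (Y i ω)) 2 P :=
  hg.comp_measurePreserving ⟨h.measurable i, h.law i⟩

theorem integral_average (h : IsPairwiseSample P ν Y) (hn : 0 < n) (hg : Integrable g ν) :
    ∫ ω, 1 / n * ∑ i, g (Y i ω) ∂P = ∫ y, g y ∂ν := by
  have hY : ∀ i, MeasurePreserving (Y i) P ν := fun i => ⟨h.measurable i, h.law i⟩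
  have hmean : ∀ i, ∫ ω, g (Y i ω) ∂P = ∫ y, g y ∂ν := fun i => by
    rw [← h.law i, integral_map (h.measurable i).aemeasurable (by rw [h.law i]; exact hg.1)]
  have hint : ∀ i, Integrable (fun ω => g (Y i ω)) P := fun i =>
    (hY i).integrable_comp_of_integrable hg
  rw [integral_const_mul, integral_finsetSum _ fun i _ => hint i]
  simp only [hmean, Finset.sum_const, Finset.card_univ, Fintype.card_fin, nsmul_eq_mul]
  field_simp

theorem variance_average (h : IsPairwiseSample P ν Y) (hn : 0 < n) (hgm : Measurable g)
    (hg : MemLp g 2 ν) :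
    variance (fun ω => 1 / n * ∑ i, g (Y i ω)) P = variance g ν / n := by
  have hvar : ∀ i, variance (fun ω => g (Y i ω)) P = variance g ν := fun i => by
    rw [← h.law i, variance_map hgm.aemeasurable (h.measurable i).aemeasurable]; rfl
  have hsum : variance (fun ω => ∑ i, g (Y i ω)) P = ∑ i, variance (fun ω => g (Y i ω)) P := by
    rw [← IndepFun.variance_sum (fun i _ => h.memLp_comp hg i)
      fun i _ j _ hij => (h.indep hij).comp hgm hgm]
    congr 1
    exact funext fun ω => by rw [Finset.sum_apply]
  rw [variance_const_mul, hsum]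
  simp only [hvar, Finset.sum_const, Finset.card_univ, Fintype.card_fin, nsmul_eq_mul]
  field_simp

end IsPairwiseSample

theorem ofReal_variance_le_lintegral {ν : Measure ℝ} [IsProbabilityMeasure ν] {g : ℝ → ℝ}
    (hg : MemLp g 2 ν) (c : ℝ) :
    ENNReal.ofReal (variance g ν) ≤ ∫⁻ y, ‖g y - c‖ₑ ^ 2 ∂ν := by
  have hgc : MemLp (fun y => g y - c) 2 ν := hg.sub (memLp_const c)
  rw [← variance_sub_const hg.1 c, ofReal_variance hgc, evariance_def' hgc.1]
  exact tsub_le_self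

theorem lintegral_enorm_sub_integral_le [IsProbabilityMeasure P] {Z : Ω → ℝ} (hZ : MemLp Z 2 P) :
    ∫⁻ ω, ‖Z ω - ∫ ω', Z ω' ∂P‖ₑ ∂P ≤ ENNReal.ofReal (variance Z P) ^ (1 / 2 : ℝ) := by
  have hm : AEMeasurable (fun ω => ‖Z ω - ∫ ω', Z ω' ∂P‖ₑ ^ 2) P :=
    (hZ.1.sub aestronglyMeasurable_const).enorm.pow_const 2
  rw [ofReal_variance hZ, evariance]
  simpa only [sq_rpow_half] using lintegral_rpow_half_le hm

theorem IsPairwiseSample.lintegral_average_sub_le [IsProbabilityMeasure P] {ν : Measure ℝ}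
    [IsProbabilityMeasure ν] {Y : Fin n → Ω → ℝ} (h : IsPairwiseSample P ν Y) (hn : 0 < n)
    {g : ℝ → ℝ} (hgm : Measurable g) (hg : MemLp g 2 ν) (c : ℝ) :
    ∫⁻ ω, ‖1 / n * ∑ i, g (Y i ω) - ∫ y, g y ∂ν‖ₑ ∂P ≤
      ENNReal.ofReal ((n : ℝ) ^ (-(1 / 2) : ℝ)) * (∫⁻ y, ‖g y - c‖ₑ ^ 2 ∂ν) ^ (1 / 2 : ℝ) := by
  have hZ : MemLp (fun ω => 1 / n * ∑ i, g (Y i ω)) 2 P :=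
    (memLp_finsetSum Finset.univ fun i _ => h.memLp_comp hg i).const_mul _
  have hdev := lintegral_enorm_sub_integral_le hZ
  rw [h.integral_average hn (hg.integrable one_le_two), h.variance_average hn hgm hg,
    div_eq_inv_mul (variance g ν), ENNReal.ofReal_mul (by positivity), mul_rpow_half,
    ENNReal.ofReal_rpow_of_nonneg (by positivity) (by norm_num), Real.inv_rpow n.cast_nonneg,
    ← Real.rpow_neg n.cast_nonneg] at hdev
  refine hdev.trans ?_
  gcongr
  exact ofReal_variance_le_lintegral hg c

end Sample

/-! ### Distribution functions of convolutions with signed densities -/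

section SignedDensity

variable {q : ℝ → ℝ} {ν ρ : Measure ℝ}

theorem charFun_add_measure [IsFiniteMeasure ν] [IsFiniteMeasure ρ] (t : ℝ) :
    charFun (ν + ρ) t = charFun ν t + charFun ρ t := by
  have hint : ∀ (κ : Measure ℝ) [IsFiniteMeasure κ],
      Integrable (fun x : ℝ => Complex.exp (t * x * Complex.I)) κ := fun κ _ =>
    .of_bound (Continuous.aestronglyMeasurable (by fun_prop)) 1 (.of_forall fun x => by
      rw [← Complex.ofReal_mul, Complex.norm_exp_ofReal_mul_I])
  simp only [charFun_apply_real]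
  exact integral_add_measure (hint ν) (hint ρ)

theorem charFun_withDensity_ofReal (hq : Integrable q) (t : ℝ) :
    charFun (volume.withDensity fun v => ENNReal.ofReal (q v)) t =
      ∫ v : ℝ, Complex.exp (Complex.I * t * v) * (max (q v) 0 : ℝ) := by
  rw [charFun_apply_real, integral_withDensity_eq_integral_toReal_smul₀
    hq.aemeasurable.ennreal_ofReal (.of_forall fun _ => ENNReal.ofReal_lt_top)]
  refine integral_congr_ae (.of_forall fun v => ?_)
  simp only [ENNReal.toReal_ofReal', Complex.real_smul]
  rw [mul_comm, mul_comm (_ : ℂ) Complex.I, mul_assoc]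

theorem charFun_withDensity_sub_charFun_withDensity_neg (hq : Integrable q) (t : ℝ) :
    charFun (volume.withDensity fun v => ENNReal.ofReal (q v)) t -
        charFun (volume.withDensity fun v => ENNReal.ofReal (-q v)) t =
      ∫ v : ℝ, Complex.exp (Complex.I * t * v) * q v := by
  have hint : ∀ {q : ℝ → ℝ}, Integrable q → Integrable fun v : ℝ =>
      Complex.exp (Complex.I * t * v) * (max (q v) 0 : ℝ) := fun {q} hq =>
    hq.pos_part.ofReal.bdd_mul (c := 1) (Continuous.aestronglyMeasurable (by fun_prop))
      (.of_forall fun v => by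
        rw [mul_assoc, mul_comm, ← Complex.ofReal_mul, Complex.norm_exp_ofReal_mul_I])
  have hneg := charFun_withDensity_ofReal hq.neg t
  simp only [Pi.neg_apply] at hneg
  have hint_neg := hint hq.neg
  simp only [Pi.neg_apply] at hint_neg
  rw [charFun_withDensity_ofReal hq, hneg, ← integral_sub (hint hq) hint_neg]
  refine integral_congr_ae (.of_forall fun v => ?_)
  simp only
  rw [← mul_sub, ← Complex.ofReal_sub, max_zero_sub_max_neg_zero_eq_self]

theorem integrable_real_Iic_sub (ν κ : Measure ℝ) [IsFiniteMeasure ν] [IsFiniteMeasure κ]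
    (x : ℝ) : Integrable (fun y => κ.real (Iic (x - y))) ν := by
  have hanti : Antitone fun y => κ.real (Iic (x - y)) := fun _ _ hab =>
    measureReal_mono (Iic_subset_Iic.2 (by gcongr))
  refine .of_bound hanti.measurable.aestronglyMeasurable (κ.real univ) (.of_forall fun y => ?_)
  rw [Real.norm_of_nonneg measureReal_nonneg]
  exact measureReal_mono (subset_univ _)

theorem conv_real_Iic (ν κ : Measure ℝ) [IsFiniteMeasure ν] [IsFiniteMeasure κ] (x : ℝ) :
    (ν ∗ κ).real (Iic x) = ∫ y, κ.real (Iic (x - y)) ∂ν := by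
  have hanti : Antitone fun y => κ (Iic (x - y)) := fun _ _ hab =>
    measure_mono (Iic_subset_Iic.2 (by gcongr))
  simp only [Measure.real]
  rw [integral_toReal hanti.measurable.aemeasurable (.of_forall fun _ => measure_lt_top _ _),
    ← lintegral_indicator_one measurableSet_Iic,
    Measure.lintegral_conv (measurable_one.indicator measurableSet_Iic)]
  congr 1
  refine lintegral_congr fun y => ?_
  rw [← lintegral_indicator_one measurableSet_Iic]
  refine lintegral_congr fun v => ?_
  simp only [indicator, mem_Iic, le_sub_iff_add_le', Pi.one_apply]

theorem setIntegral_eq_withDensity_real_sub (hq : Integrable q) {s : Set ℝ}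
    (hs : MeasurableSet s) :
    ∫ v in s, q v = (volume.withDensity fun v => ENNReal.ofReal (q v)).real s -
      (volume.withDensity fun v => ENNReal.ofReal (-q v)).real s := by
  rw [integral_eq_lintegral_pos_part_sub_lintegral_neg_part hq.integrableOn, Measure.real,
    Measure.real, withDensity_apply _ hs, withDensity_apply _ hs]

-- Splitting `q` into positive and negative parts turns the hypothesis into an equality of
-- characteristic functions of finite measures.
theorem integral_integral_Iic_sub_eq_cdf (hq : Integrable q) [IsProbabilityMeasure ν]
    [IsProbabilityMeasure ρ]
    (hchar : ∀ t : ℝ, (∫ v : ℝ, Complex.exp (Complex.I * t * v) * q v) * charFun ν t =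
      charFun ρ t) (x : ℝ) :
    ∫ y, (∫ v in Iic (x - y), q v) ∂ν = cdf ρ x := by
  set pos : Measure ℝ := volume.withDensity fun v => ENNReal.ofReal (q v)
  set neg : Measure ℝ := volume.withDensity fun v => ENNReal.ofReal (-q v)
  have : IsFiniteMeasure pos := isFiniteMeasure_withDensity_ofReal hq.2
  have : IsFiniteMeasure neg := isFiniteMeasure_withDensity_ofReal hq.neg.2
  have heq : ν ∗ pos = ν ∗ neg + ρ := by
    refine Measure.ext_of_charFun (funext fun t => ?_)
    rw [charFun_add_measure, charFun_conv, charFun_conv, ← hchar t,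
      ← charFun_withDensity_sub_charFun_withDensity_neg hq]
    ring
  simp_rw [setIntegral_eq_withDensity_real_sub hq measurableSet_Iic]
  rw [integral_sub (integrable_real_Iic_sub ν pos x) (integrable_real_Iic_sub ν neg x),
    ← conv_real_Iic, ← conv_real_Iic, heq, cdf_eq_real, measureReal_add_apply,
    add_sub_cancel_left]

end SignedDensity

/-! ### The deconvolution density -/

theorem continuous_integral_Iic {E : Type*} [NormedAddCommGroup E] [NormedSpace ℝ E] {f : ℝ → E}
    (hf : Integrable f) : Continuous fun z => ∫ v in Iic z, f v :=
  continuous_iff_continuousAt.2 fun z =>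
    (hf.integrableOn.continuousOn_Iic_primitive_Iic (a₀ := z + 1)).continuousAt
      (Iic_mem_nhds (by linarith))

theorem integrable_invFourier {R : ℝ} {b : ℝ → ℝ} {f : ℝ → ℂ} (hb : Continuous b)
    (h : HasDerivBound univ 1 b f) (hR : ∀ t, R < |t| → f t = 0) : Integrable (invFourier f) := by
  have hm : AEStronglyMeasurable f := h.continuous.aestronglyMeasurable
  have hc : Continuous (invFourier f) := continuous_invFourier
    (integrable_of_norm_le_of_eq_zero hm hb (fun t => h.norm_le trivial) hR)
  refine ⟨hc.aestronglyMeasurable, ?_⟩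
  refine (lintegral_le_lintegral_one_add_rpow_mul le_rfl _).trans_lt
    (lintegral_one_add_rpow_mul_enorm_lt_top (m := 1) (by norm_num) hc.aemeasurable ?_)
  exact (lintegral_one_add_pow_mul_sq_invFourier_le hm hb h hR).trans_lt (ENNReal.mul_lt_top
    ENNReal.ofReal_lt_top ((hb.pow 2).continuousOn.integrableOn_Icc).lintegral_lt_top)

theorem fourierStar_neg (k : ℝ → ℝ) (w : ℝ) : fourierStar k (-w) = conj (fourierStar k w) := by
  rw [fourierStar, fourierStar, ← integral_conj]
  refine integral_congr_ae (.of_forall fun u => ?_)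
  simp only [map_mul, ← Complex.exp_conj, Complex.conj_ofReal, Complex.conj_I, Complex.ofReal_neg,
    mul_neg, neg_mul]

theorem fourierStar_neg_of_even {k : ℝ → ℝ} (hk : ∀ x, k (-x) = k x) (w : ℝ) :
    fourierStar k (-w) = fourierStar k w := by
  rw [fourierStar, fourierStar, ← integral_neg_eq_self]
  refine integral_congr_ae (.of_forall fun u => ?_)
  simp only [hk, Complex.ofReal_neg, mul_neg, neg_mul, neg_neg]

theorem fourierStar_zero (k : ℝ → ℝ) : fourierStar k 0 = (∫ x, k x : ℝ) := by
  simp only [fourierStar, Complex.ofReal_zero, mul_zero, Complex.exp_zero, one_mul]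
  exact integral_complex_ofReal

/-- The Fourier transform `w ↦ k^*(hw) / μ_ε^*(w)` of the deconvolution density. -/
def symbol (k : ℝ → ℝ) (με : Measure ℝ) (h w : ℝ) : ℂ := fourierStar k (h * w) * invCharFun με w

/-- The density `v ↦ h⁻¹ k̃_h(v / h)`, normalized so that its translates by the observations average
to the density of the preliminary estimator. -/
def deconvDensity (k : ℝ → ℝ) (με : Measure ℝ) (h v : ℝ) : ℝ := (invFourier (symbol k με h) v).re

/-- The primitive of the deconvolution density that vanishes at `-∞`: the contribution of an
observation at the origin to the preliminary estimator. -/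
def deconvCDF (k : ℝ → ℝ) (με : Measure ℝ) (h z : ℝ) : ℝ := ∫ v in Iic z, deconvDensity k με h v

section Symbol

variable {p h : ℝ} {k b : ℝ → ℝ} {μ με : Measure ℝ} {g : ℝ → ℂ}

theorem conj_symbol_neg (k : ℝ → ℝ) (με : Measure ℝ) (h w : ℝ) :
    conj (symbol k με h (-w)) = symbol k με h w := by
  rw [symbol, symbol, mul_neg, fourierStar_neg, invCharFun, invCharFun, charFun_neg, map_mul,
    map_div₀, map_one, Complex.conj_conj, Complex.conj_conj]

theorem ofReal_deconvDensity (k : ℝ → ℝ) (με : Measure ℝ) (h v : ℝ) :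
    (deconvDensity k με h v : ℂ) = invFourier (symbol k με h) v :=
  Complex.conj_eq_iff_re.1 (conj_invFourier (conj_symbol_neg k με h) v)

theorem charFun_kernelLaw (hk : Integrable k) (hk0 : ∀ x, 0 ≤ k x) (h t : ℝ) :
    charFun (kernelLaw k h) t = fourierStar k (h * t) := by
  rw [kernelLaw, charFun_map_mul, charFun_apply_real, integral_withDensity_eq_integral_toReal_smul₀
    hk.aemeasurable.ennreal_ofReal (.of_forall fun _ => ENNReal.ofReal_lt_top)]
  refine integral_congr_ae (.of_forall fun u => ?_)
  simp only [ENNReal.toReal_ofReal (hk0 u), Complex.real_smul]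
  rw [mul_comm]
  congr 2
  ring

namespace IsKernel

theorem symbol_zero (hk : IsKernel p k) [IsProbabilityMeasure με] : symbol k με h 0 = 1 := by
  simp [symbol, invCharFun, fourierStar_zero, hk.integral_eq_one]

theorem symbol_eq_zero (hk : IsKernel p k) (hh : 0 < h) {w : ℝ} (hw : 1 / h < |w|) :
    symbol k με h w = 0 := by
  rw [symbol, hk.fourierStar_eq_zero, zero_mul]
  rwa [abs_mul, abs_of_pos hh, ← div_lt_iff₀' hh]

-- The substitution `u = -hw` in the definition of `k̃_h`.
theorem deconvKernel_div (hk : IsKernel p k) (hh : 0 < h) (v : ℝ) :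
    deconvKernel k με h (v / h) = h * deconvDensity k με h v := by
  have hsubst := Measure.integral_comp_mul_left (fun u : ℝ =>
    Complex.exp (Complex.I * u * (v / h : ℝ)) * fourierStar k u / charFun με (-u / h)) (-h)
  rw [abs_of_neg (by simpa using hh), inv_neg, neg_neg, Complex.real_smul] at hsubst
  have hc : (h : ℂ) ≠ 0 := by exact_mod_cast hh.ne'
  rw [deconvKernel, deconvDensity, ← Complex.re_ofReal_mul, invFourier_eq_integral, mul_left_comm]
  congr 2
  rw [← inv_mul_eq_iff_eq_mul₀ hc, ← Complex.ofReal_inv, ← hsubst]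
  refine integral_congr_ae (.of_forall fun w => ?_)
  simp only [symbol, invCharFun]
  rw [neg_mul, neg_neg, mul_div_cancel_left₀ _ hh.ne', fourierStar_neg_of_even hk.symm,
    mul_one_div, mul_div]
  congr 3
  push_cast
  field_simp

theorem continuous_symbol (hk : IsKernel p k) (hr : Continuous (invCharFun με)) :
    Continuous (symbol k με h) :=
  (hk.contDiff.continuous.comp (continuous_const_mul h)).mul hr

theorem integrable_mul_symbol (hk : IsKernel p k) (hh : 0 < h) (hr : Continuous (invCharFun με))
    (hg : Continuous g) : Integrable fun w => g w * symbol k με h w := by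
  have hc : Continuous fun w => g w * symbol k με h w := hg.mul (hk.continuous_symbol hr)
  exact integrable_of_norm_le_of_eq_zero hc.aestronglyMeasurable hc.norm (fun _ => le_rfl)
    fun w hw => by rw [hk.symbol_eq_zero hh hw, mul_zero]

theorem integrable_invFourier_mul_symbol (hp : 0 < p) (hk : IsKernel p k) (hh : 0 < h)
    (hb : Continuous b) (hr : HasDerivBound univ 1 b (invCharFun με)) (hg : ContDiff ℝ 1 g) :
    Integrable (invFourier fun w => g w * symbol k με h w) := by
  have hk1 : ContDiff ℝ 1 (fourierStar k) :=
    hk.contDiff.of_le (by exact_mod_cast Nat.one_le_ceil_iff.2 hp)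
  have hzero : ∀ w, 1 / h < |w| → g w * fourierStar k (h * w) = 0 := fun w hw => by
    rw [hk.fourierStar_eq_zero, mul_zero]
    rwa [abs_mul, abs_of_pos hh, ← div_lt_iff₀' hh]
  obtain ⟨c, -, hc⟩ := HasDerivBound.exists_of_contDiff (m := 1)
    (by exact_mod_cast hg.mul (hk1.comp (contDiff_const.mul contDiff_id))) hzero
  simpa only [symbol, mul_assoc] using integrable_invFourier (continuous_const.mul
    (continuous_const.mul hb)) (hc.mul isOpen_univ hr)
    fun w hw => by rw [hzero w hw, zero_mul]

theorem integrable_deconvDensity (hp : 0 < p) (hk : IsKernel p k) (hh : 0 < h)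
    (hb : Continuous b) (hr : HasDerivBound univ 1 b (invCharFun με)) :
    Integrable (deconvDensity k με h) := by
  have hq := hk.integrable_invFourier_mul_symbol hp hh hb hr (g := fun _ => 1) contDiff_const
  simp only [one_mul] at hq
  exact hq.re

theorem continuous_deconvCDF (hp : 0 < p) (hk : IsKernel p k) (hh : 0 < h)
    (hb : Continuous b) (hr : HasDerivBound univ 1 b (invCharFun με)) :
    Continuous (deconvCDF k με h) :=
  continuous_integral_Iic (hk.integrable_deconvDensity hp hh hb hr)

theorem prelimCDF_eq (hp : 0 < p) (hk : IsKernel p k) (hh : 0 < h) (hb : Continuous b)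
    (hr : HasDerivBound univ 1 b (invCharFun με)) {n : ℕ} (y : Fin n → ℝ) (t : ℝ) :
    prelimCDF k με h y t = 1 / n * ∑ i, deconvCDF k με h (t - y i) := by
  have hq := hk.integrable_deconvDensity hp hh hb hr
  have hshift : ∀ i, ∫ u in Iic t, deconvDensity k με h (u - y i) = deconvCDF k με h (t - y i) :=
    fun i => by
      simpa only [deconvCDF, preimage_sub_const_Iic, sub_add_cancel] using
        (measurePreserving_sub_right volume (y i)).setIntegral_preimage_emb
          (MeasurableEquiv.subRight (y i)).measurableEmbedding (deconvDensity k με h)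
          (Iic (t - y i))
  simp only [prelimCDF, hk.deconvKernel_div hh]
  rw [integral_finsetSum _ fun i _ => ((hq.comp_sub_right (y i)).const_mul h).integrableOn]
  simp only [integral_const_mul, hshift]
  rw [← Finset.mul_sum, ← mul_assoc]
  congr 1
  field_simp

theorem integral_deconvCDF_sub (hp : 0 < p) (hk : IsKernel p k) (hh : 0 < h)
    (μ : Measure ℝ) [IsProbabilityMeasure μ] [IsProbabilityMeasure με]
    (hne : ∀ t, charFun με t ≠ 0) (hb : Continuous b)
    (hr : HasDerivBound univ 1 b (invCharFun με)) (x : ℝ) :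
    ∫ y, deconvCDF k με h (x - y) ∂(μ ∗ με) = cdf (μ ∗ kernelLaw k h) x := by
  have := hk.isProbabilityMeasure_kernelLaw h
  refine integral_integral_Iic_sub_eq_cdf (hk.integrable_deconvDensity hp hh hb hr)
    (fun t => ?_) x
  have hs : Integrable (symbol k με h) := by
    simpa only [one_mul] using
      hk.integrable_mul_symbol hh hr.continuous (g := fun _ => 1) continuous_const
  have hq : Integrable (invFourier (symbol k με h)) := by
    simpa only [one_mul] using
      hk.integrable_invFourier_mul_symbol hp hh hb hr (g := fun _ => 1) contDiff_const
  simp only [ofReal_deconvDensity]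
  rw [integral_exp_mul_invFourier (hk.continuous_symbol hr.continuous) hs hq, charFun_conv,
    charFun_conv, charFun_kernelLaw hk.integrable hk.nonneg, symbol, invCharFun]
  field_simp [hne t]

end IsKernel

/-! ### Low and high frequencies -/

/-- The low frequency part of the deconvolution density. -/
def lowDensity (k : ℝ → ℝ) (με : Measure ℝ) (h : ℝ) : ℝ → ℂ :=
  invFourier fun w => cutoff w * symbol k με h w

/-- The primitive of the high frequency part of the deconvolution density. -/
def highPart (k : ℝ → ℝ) (με : Measure ℝ) (h : ℝ) : ℝ → ℂ :=
  invFourier fun w => Complex.I * cutoffQuot w * symbol k με h w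

namespace IsKernel

theorem hasDerivAt_highPart (hk : IsKernel p k) (hh : 0 < h) (hr : Continuous (invCharFun με))
    (v : ℝ) :
    HasDerivAt (highPart k με h) (invFourier (fun w => (1 - cutoff w) * symbol k με h w) v) v := by
  have hquot : Continuous cutoffQuot := (contDiff_cutoffQuot (n := 0)).continuous
  have hmul : Integrable fun w : ℝ => (w : ℂ) * (Complex.I * cutoffQuot w * symbol k με h w) := by
    simpa only [mul_assoc] using hk.integrable_mul_symbol hh hr
      (g := fun w : ℝ => (w : ℂ) * (Complex.I * cutoffQuot w)) (by fun_prop)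
  refine (hasDerivAt_invFourier (hk.integrable_mul_symbol hh hr
    (g := fun w => Complex.I * cutoffQuot w) (by fun_prop)) hmul v).congr_deriv ?_
  congr 1
  ext w
  rw [← mul_cutoffQuot]
  linear_combination (-(w : ℂ) * cutoffQuot w * symbol k με h w) * Complex.I_mul_I

theorem ofReal_deconvCDF (hp : 0 < p) (hk : IsKernel p k) (hh : 0 < h) (hb : Continuous b)
    (hr : HasDerivBound univ 1 b (invCharFun με)) (z : ℝ) :
    (deconvCDF k με h z : ℂ) = (∫ v in Iic z, lowDensity k με h v) + highPart k με h z := by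
  have hcut : ContDiff ℝ 1 cutoff := contDiff_cutoff (n := 1)
  have hcut' : ContDiff ℝ 1 fun w => 1 - cutoff w := contDiff_const.sub hcut
  have hlow : Integrable (lowDensity k με h) :=
    hk.integrable_invFourier_mul_symbol hp hh hb hr hcut
  have hhigh := hk.integrable_invFourier_mul_symbol hp hh hb hr hcut'
  have hsum : ∀ v, (deconvDensity k με h v : ℂ) = lowDensity k με h v +
      invFourier (fun w => (1 - cutoff w) * symbol k με h w) v := fun v => by
    rw [ofReal_deconvDensity, lowDensity, ← invFourier_add
      (hk.integrable_mul_symbol hh hr.continuous hcut.continuous)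
      (hk.integrable_mul_symbol hh hr.continuous hcut'.continuous)]
    congr 1
    ext w
    ring
  have hder := hk.hasDerivAt_highPart hh hr.continuous
  rw [deconvCDF, ← integral_complex_ofReal]
  simp only [hsum]
  rw [integral_add hlow.integrableOn hhigh.integrableOn, integral_Iic_of_hasDerivAt_of_tendsto
    (hder z).continuousAt.continuousWithinAt (fun v _ => hder v) hhigh.integrableOn
    (tendsto_invFourier_atBot _), sub_zero]

theorem integral_lowDensity (hp : 0 < p) (hk : IsKernel p k) (hh : 0 < h)
    [IsProbabilityMeasure με] (hb : Continuous b)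
    (hr : HasDerivBound univ 1 b (invCharFun με)) : ∫ v, lowDensity k με h v = 1 := by
  have hcut : ContDiff ℝ 1 cutoff := contDiff_cutoff (n := 1)
  have hinv := integral_exp_mul_invFourier (hcut.continuous.mul (hk.continuous_symbol
    hr.continuous)) (hk.integrable_mul_symbol hh hr.continuous hcut.continuous)
    (hk.integrable_invFourier_mul_symbol hp hh hb hr hcut) 0
  simp only [Complex.ofReal_zero, mul_zero, zero_mul, Complex.exp_zero, one_mul] at hinv
  refine hinv.trans ?_
  rw [Pi.mul_apply, cutoff_eq_one (by simp), hk.symbol_zero, one_mul]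

end IsKernel

end Symbol

theorem invFourier_fourierStar_mul {k : ℝ → ℝ} {f : ℝ → ℂ} (hk : Integrable k)
    (hf : Integrable f) (h v : ℝ) :
    invFourier (fun w => fourierStar k (h * w) * f w) v =
      ∫ y, k y * invFourier f (v - h * y) := by
  have hk' : Integrable fun y => (k y : ℂ) := hk.ofReal
  simp only [invFourier_eq_integral, fourierStar, ← integral_const_mul, ← integral_mul_const]
  refine (integral_integral_swap ?_).trans
    (integral_congr_ae (.of_forall fun y => integral_congr_ae (.of_forall fun w => ?_)))
  · have hexp : ∀ z : ℝ × ℝ, ‖Complex.exp (-(Complex.I * z.1 * v)) *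
        Complex.exp (Complex.I * z.2 * (h * z.1 : ℝ))‖ ≤ 1 := fun z => by
      rw [norm_mul, norm_exp_I_mul_mul, ← mul_neg, ← Complex.ofReal_neg, norm_exp_I_mul_mul,
        one_mul]
    refine (((hf.mul_prod hk').bdd_mul (Continuous.aestronglyMeasurable (by fun_prop))
      (.of_forall hexp)).const_mul (1 / (2 * Real.pi) : ℂ)).congr (.of_forall fun z => ?_)
    simp only [Function.uncurry]
    ring
  · have hexp : Complex.exp (-(Complex.I * w * (v - h * y : ℝ))) =
        Complex.exp (-(Complex.I * w * v)) * Complex.exp (Complex.I * y * (h * w : ℝ)) := by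
      rw [← Complex.exp_add]
      congr 1
      push_cast
      ring
    simp only
    rw [hexp]
    ring

theorem one_add_abs_add_rpow_le {p : ℝ} (hp : 0 ≤ p) (x y : ℝ) :
    (1 + |x + y|) ^ p ≤ (1 + |x|) ^ p * (1 + |y|) ^ p := by
  rw [← Real.mul_rpow (by positivity) (by positivity)]
  gcongr
  nlinarith [abs_add_le x y, mul_nonneg (abs_nonneg x) (abs_nonneg y)]

theorem lintegral_one_add_rpow_mul_enorm_conv_le {p h H : ℝ} (hp : 0 ≤ p) (hh : 0 ≤ h)
    (hH : h ≤ H) {k : ℝ → ℝ} (hk : AEMeasurable k) {a : ℝ → ℂ} (ha : Measurable a) :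
    ∫⁻ v, ENNReal.ofReal ((1 + |v|) ^ p) * ‖∫ y, k y * a (v - h * y)‖ₑ ≤
      (∫⁻ y, ENNReal.ofReal ((1 + H * |y|) ^ p) * ‖k y‖ₑ) *
        ∫⁻ v, ENNReal.ofReal ((1 + |v|) ^ p) * ‖a v‖ₑ := by
  have hweight : ∀ v y, ENNReal.ofReal ((1 + |v + h * y|) ^ p) ≤
      ENNReal.ofReal ((1 + H * |y|) ^ p) * ENNReal.ofReal ((1 + |v|) ^ p) := fun v y => by
    rw [← ENNReal.ofReal_mul (by have := hh.trans hH; positivity)]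
    refine ENNReal.ofReal_le_ofReal ((one_add_abs_add_rpow_le hp v _).trans ?_)
    rw [abs_mul, abs_of_nonneg hh, mul_comm]
    gcongr
  calc ∫⁻ v, ENNReal.ofReal ((1 + |v|) ^ p) * ‖∫ y, k y * a (v - h * y)‖ₑ
      ≤ ∫⁻ v, ∫⁻ y, ENNReal.ofReal ((1 + |v|) ^ p) * (‖k y‖ₑ * ‖a (v - h * y)‖ₑ) := by
        refine lintegral_mono fun v => ?_
        rw [lintegral_const_mul' _ _ ENNReal.ofReal_ne_top]
        gcongr
        refine (enorm_integral_le_lintegral_enorm _).trans_eq (lintegral_congr fun y => ?_)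
        rw [enorm_mul, ← ofReal_norm, Complex.norm_real, ofReal_norm]
    _ = ∫⁻ y, ∫⁻ v, ENNReal.ofReal ((1 + |v|) ^ p) * (‖k y‖ₑ * ‖a (v - h * y)‖ₑ) := by
        have hk₂ : AEMeasurable (fun z : ℝ × ℝ => ‖k z.2‖ₑ) (volume.prod volume) :=
          hk.enorm.comp_quasiMeasurePreserving Measure.quasiMeasurePreserving_snd
        have ha₂ : Measurable fun z : ℝ × ℝ => ‖a (z.1 - h * z.2)‖ₑ := by fun_prop
        exact lintegral_lintegral_swap
          (Measurable.aemeasurable (by fun_prop) |>.mul (hk₂.mul ha₂.aemeasurable))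
    _ = ∫⁻ y, ∫⁻ v, ENNReal.ofReal ((1 + |v + h * y|) ^ p) * (‖k y‖ₑ * ‖a v‖ₑ) := by
        refine lintegral_congr fun y => ?_
        rw [← lintegral_add_right_eq_self _ (h * y)]
        simp only [add_sub_cancel_right]
    _ ≤ ∫⁻ y, ∫⁻ v, ENNReal.ofReal ((1 + H * |y|) ^ p) * ‖k y‖ₑ *
          (ENNReal.ofReal ((1 + |v|) ^ p) * ‖a v‖ₑ) := by
        refine lintegral_mono fun y => lintegral_mono fun v =>
          (mul_le_mul_left (hweight v y) _).trans_eq (by ring)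
    _ = _ := by
        exact lintegral_lintegral_mul (f := fun y => ENNReal.ofReal ((1 + H * |y|) ^ p) * ‖k y‖ₑ)
          ((Measurable.aemeasurable (by fun_prop)).mul hk.enorm)
          (Measurable.aemeasurable (by fun_prop))

theorem IsKernel.lintegral_one_add_rpow_mul_lt_top {p H : ℝ} {k : ℝ → ℝ} (hp : 1 ≤ p)
    (hk : IsKernel p k) (hH : 0 ≤ H) :
    ∫⁻ y, ENNReal.ofReal ((1 + H * |y|) ^ p) * ‖k y‖ₑ < ∞ := by
  have hp0 : 0 ≤ p := by linarith
  calc ∫⁻ y, ENNReal.ofReal ((1 + H * |y|) ^ p) * ‖k y‖ₑ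
      ≤ ∫⁻ y, 2 ^ (p - 1) * (‖k y‖ₑ +
          ENNReal.ofReal (H ^ p) * ENNReal.ofReal (|y| ^ p * k y)) := by
        refine lintegral_mono fun y => ?_
        have hHy : 0 ≤ H * |y| := by positivity
        have hpow : ENNReal.ofReal ((1 + H * |y|) ^ p) ≤
            2 ^ (p - 1) * (1 + ENNReal.ofReal (H ^ p) * ENNReal.ofReal (|y| ^ p)) := by
          rw [← ENNReal.ofReal_mul (by positivity), ← Real.mul_rpow hH (abs_nonneg y),
            ← ENNReal.ofReal_rpow_of_nonneg (by positivity) hp0,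
            ← ENNReal.ofReal_rpow_of_nonneg hHy hp0, ENNReal.ofReal_add zero_le_one hHy]
          simpa only [ENNReal.ofReal_one, ENNReal.one_rpow] using
            ENNReal.rpow_add_le_mul_rpow_add_rpow 1 (ENNReal.ofReal (H * |y|)) hp
        rw [ENNReal.ofReal_mul (p := |y| ^ p) (by positivity), Real.enorm_eq_ofReal (hk.nonneg y)]
        exact (mul_le_mul_left hpow _).trans_eq (by ring)
    _ < ∞ := by
        rw [lintegral_const_mul' _ _ (by simp), lintegral_add_left'
          hk.integrable.aemeasurable.enorm, lintegral_const_mul' _ _ ENNReal.ofReal_ne_top]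
        have hpow : (2 : ℝ≥0∞) ^ (p - 1) < ∞ :=
          ENNReal.rpow_lt_top_of_nonneg (by linarith) ENNReal.ofNat_ne_top
        exact ENNReal.mul_lt_top hpow (ENNReal.add_lt_top.2 ⟨hk.integrable.2,
          ENNReal.mul_lt_top ENNReal.ofReal_lt_top (hk.lintegral_rpow_mul_lt_top (by linarith))⟩)

/-! ### The stochastic error -/

theorem sub_half_lt_mOne (p : ℝ) : p - 1 / 2 < mOne p := by
  rw [mOne]
  exact_mod_cast Nat.lt_floor_add_one (p - 1 / 2)

theorem add_half_lt_mZero (p : ℝ) : p + 1 / 2 < mZero p := by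
  rw [mZero]
  exact_mod_cast Nat.lt_floor_add_one (p + 1 / 2)

theorem one_le_mOne (p : ℝ) : 1 ≤ mOne p := Nat.le_add_left 1 _

theorem mOne_le_ceil {p : ℝ} (hp : 1 ≤ p) : mOne p ≤ ⌈p⌉₊ := by
  have hlt : ((⌊p - 1 / 2⌋₊ : ℕ) : ℝ) < (⌈p⌉₊ : ℕ) :=
    (Nat.floor_le (by linarith)).trans_lt ((by linarith : p - 1 / 2 < p).trans_le (Nat.le_ceil p))
  exact_mod_cast hlt

theorem lintegral_one_add_rpow_mul_enorm_invFourier_cutoff_mul_lt_top {s c : ℝ} {m : ℕ}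
    {f : ℝ → ℂ} (hm : s + 1 / 2 < m) (hf : Continuous f)
    (h : HasDerivBound (Icc (-2) 2) m (fun _ => c) f) :
    ∫⁻ v, ENNReal.ofReal ((1 + |v|) ^ s) * ‖invFourier (fun w => cutoff w * f w) v‖ₑ < ∞ := by
  obtain ⟨c', hc', hcut⟩ := HasDerivBound.exists_of_contDiff (m := m) (R := 3 / 2)
    (contDiff_cutoff (n := m)) fun t ht => cutoff_eq_zero ht.le
  have hzero : ∀ t, 3 / 2 < |t| → cutoff t * f t = 0 := fun t ht => by
    rw [cutoff_eq_zero ht.le, zero_mul]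
  have hc : 0 ≤ c := (norm_nonneg _).trans (h.norm_le (t := 0) (by norm_num))
  have hin := (hcut.subset (subset_univ (Ioo (-2 : ℝ) 2))).mul isOpen_Ioo
    (h.subset Ioo_subset_Icc_self)
  have hall : HasDerivBound univ m (fun _ => 2 ^ m * (c' * c)) fun w => cutoff w * f w :=
    (hin.union (HasDerivBound.of_eq_zero (by positivity) hzero)).subset fun t _ =>
      (le_or_gt |t| (3 / 2)).imp (fun ht => abs_lt.1 (by linarith)) id
  refine lintegral_one_add_rpow_mul_enorm_lt_top hm
    (continuous_invFourier (integrable_cutoff_mul hf)).aemeasurable ?_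
  exact (lintegral_one_add_pow_mul_sq_invFourier_le
    (integrable_cutoff_mul hf).aestronglyMeasurable continuous_const hall hzero).trans_lt
    (ENNReal.mul_lt_top ENNReal.ofReal_lt_top
      (continuous_const.continuousOn.integrableOn_Icc).lintegral_lt_top)

/-- The deviation of the translates by a `ν`-distributed variable of the contribution of a single
observation from the Heaviside function, in `L²(ν)` and then integrated against `|x| ^ (p - 1)`. It
controls the expected loss of the preliminary estimator. -/
def deconvError (p : ℝ) (k : ℝ → ℝ) (με ν : Measure ℝ) (h : ℝ) : ℝ≥0∞ :=
  ∫⁻ x : ℝ, ENNReal.ofReal (|x| ^ (p - 1)) *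
    (∫⁻ y, ‖deconvCDF k με h (x - y) - (if 0 ≤ x then 1 else 0)‖ₑ ^ 2 ∂ν) ^ (1 / 2 : ℝ)

section DeconvError

variable {p h H c : ℝ} {k b : ℝ → ℝ} {μ με ν : Measure ℝ}

namespace IsKernel

theorem lowDensity_eq_integral (hk : IsKernel p k) (hr : Continuous (invCharFun με)) (h v : ℝ) :
    lowDensity k με h v =
      ∫ y, k y * invFourier (fun w => cutoff w * invCharFun με w) (v - h * y) := by
  rw [← invFourier_fourierStar_mul hk.integrable (integrable_cutoff_mul hr), lowDensity]
  congr 1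
  ext w
  rw [symbol, mul_left_comm]

theorem exists_lintegral_lowDensity_le (hp : 1 ≤ p) (hk : IsKernel p k) [IsProbabilityMeasure με]
    [IsProbabilityMeasure ν]
    (htail : ∫⁻ x in Ioi (0 : ℝ), ENNReal.ofReal (|x| ^ (p - 1) * √(ν.real {y | x ≤ |y|})) < ∞)
    (hb : Continuous b) (hr : HasDerivBound univ 1 b (invCharFun με))
    (hr₀ : HasDerivBound (Icc (-2) 2) (mZero p) (fun _ => c) (invCharFun με)) (hH : 0 ≤ H) :
    ∃ L : ℝ≥0∞, L ≠ ∞ ∧ ∀ h, 0 < h → h ≤ H →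
      ∫⁻ x : ℝ, ENNReal.ofReal (|x| ^ (p - 1)) * (∫⁻ y, ‖(∫ v in Iic (x - y),
        lowDensity k με h v) - (if 0 ≤ x then 1 else 0)‖ₑ ^ 2 ∂ν) ^ (1 / 2 : ℝ) ≤ L := by
  have hp0 : 0 < p := by linarith
  set a := invFourier fun w => cutoff w * invCharFun με w
  have ha : Measurable a := (continuous_invFourier (integrable_cutoff_mul hr.continuous)).measurable
  refine ⟨(ENNReal.ofReal (2 * 2 ^ p) +
      ∫⁻ x, ENNReal.ofReal (|x| ^ (p - 1)) * rootTail ν (|x| / 2)) *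
    ((∫⁻ y, ENNReal.ofReal ((1 + H * |y|) ^ p) * ‖k y‖ₑ) *
      ∫⁻ v, ENNReal.ofReal ((1 + |v|) ^ p) * ‖a v‖ₑ), ?_, fun h hh hhH => ?_⟩
  · exact ENNReal.mul_ne_top (ENNReal.add_ne_top.2 ⟨ENNReal.ofReal_ne_top,
      lintegral_rpow_mul_rootTail_ne_top htail two_pos⟩)
      (ENNReal.mul_ne_top (hk.lintegral_one_add_rpow_mul_lt_top hp hH).ne
        (lintegral_one_add_rpow_mul_enorm_invFourier_cutoff_mul_lt_top (add_half_lt_mZero p)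
          hr.continuous hr₀).ne)
  · refine (lintegral_rpow_half_integral_Iic_le (q := lowDensity k με h) hp
      (hk.integrable_invFourier_mul_symbol hp0 hh hb hr (contDiff_cutoff (n := 1))) 
      (hk.integral_lowDensity hp0 hh hb hr) ν).trans ?_
    gcongr
    simp only [hk.lowDensity_eq_integral hr.continuous]
    exact lintegral_one_add_rpow_mul_enorm_conv_le hp0.le hh.le hhH hk.integrable.aemeasurable ha

theorem exists_hasDerivBound_cutoffQuot_mul_symbol {m : ℕ} (hm : m ≤ ⌈p⌉₊) (hk : IsKernel p k)
    (hr : HasDerivBound univ m b (invCharFun με)) :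
    ∃ A : ℝ, ∀ h, 0 < h → h ≤ H → HasDerivBound univ m (fun w => A * (b w / (1 + |w|)))
      fun w => Complex.I * cutoffQuot w * symbol k με h w := by
  obtain ⟨c₁, hc₁, hquot⟩ := exists_hasDerivBound_cutoffQuot m
  obtain ⟨c₂, hc₂, hstar⟩ := HasDerivBound.exists_of_contDiff (m := m) (R := 1)
    (hk.contDiff.of_le (by exact_mod_cast hm)) fun t ht => hk.fourierStar_eq_zero ht
  refine ⟨2 ^ m * (c₁ * (2 ^ m * ((1 + H) ^ m * c₂))), fun h hh hhH => ?_⟩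
  have hprod := (hquot.mul isOpen_univ
    ((hstar.comp_mul_left hh.le).mul isOpen_univ hr)).const_smul Complex.I
  refine (hprod.mono fun w _ => ?_).congr isOpen_univ fun w _ => ?_
  · have hbw : 0 ≤ b w := (norm_nonneg _).trans (hr.norm_le trivial)
    rw [Complex.norm_I, one_mul]
    calc 2 ^ m * (c₁ / (1 + |w|) * (2 ^ m * ((1 + h) ^ m * c₂ * b w)))
        ≤ 2 ^ m * (c₁ / (1 + |w|) * (2 ^ m * ((1 + H) ^ m * c₂ * b w))) := by gcongr
      _ = _ := by ring
  · simp only [symbol, smul_eq_mul, mul_assoc]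

theorem exists_lintegral_one_add_pow_mul_sq_highPart_le {m : ℕ} (hm : m ≤ ⌈p⌉₊)
    (hk : IsKernel p k) (hc : Continuous (invCharFun με)) (hb : Continuous b)
    (hr : HasDerivBound univ m b (invCharFun με)) :
    ∃ A : ℝ≥0∞, A ≠ ∞ ∧ ∀ h, 0 < h → h ≤ H →
      ∫⁻ z, ENNReal.ofReal ((1 + |z|) ^ (2 * m)) * ‖highPart k με h z‖ₑ ^ 2 ≤
        A * ∫⁻ w in Icc (-(1 / h)) (1 / h), ENNReal.ofReal ((b w / (1 + |w|)) ^ 2) := by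
  obtain ⟨A, hbound⟩ := hk.exists_hasDerivBound_cutoffQuot_mul_symbol (H := H) hm hr
  refine ⟨ENNReal.ofReal (2 * 4 ^ m) * ENNReal.ofReal (A ^ 2), by finiteness, fun h hh hhH => ?_⟩
  have hquot : Continuous cutoffQuot := (contDiff_cutoffQuot (n := 0)).continuous
  have hbc : Continuous fun w => A * (b w / (1 + |w|)) :=
    continuous_const.mul (hb.div (by fun_prop) fun w => by positivity)
  have hmoment := lintegral_one_add_pow_mul_sq_invFourier_le (R := 1 / h)
    (hk.integrable_mul_symbol hh hc (g := fun w => Complex.I * cutoffQuot w)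
      (by fun_prop)).aestronglyMeasurable hbc (hbound h hh hhH)
    fun w hw => by rw [hk.symbol_eq_zero hh hw, mul_zero]
  simp only [mul_pow A, ENNReal.ofReal_mul (sq_nonneg A)] at hmoment
  rw [lintegral_const_mul' _ _ ENNReal.ofReal_ne_top, ← mul_assoc] at hmoment
  refine (lintegral_congr fun z => ?_).trans_le hmoment
  rw [ENNReal.ofReal_mul (by positivity), ENNReal.ofReal_pow (norm_nonneg _), ofReal_norm, highPart]

theorem continuous_highPart (hk : IsKernel p k) (hh : 0 < h) (hr : Continuous (invCharFun με)) :
    Continuous (highPart k με h) :=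
  continuous_iff_continuousAt.2 fun v => (hk.hasDerivAt_highPart hh hr v).continuousAt

theorem exists_lintegral_highPart_le (hp : 1 ≤ p) (hk : IsKernel p k) [IsProbabilityMeasure ν]
    (htail : ∫⁻ x in Ioi (0 : ℝ), ENNReal.ofReal (|x| ^ (p - 1) * √(ν.real {y | x ≤ |y|})) < ∞)
    (hc : Continuous (invCharFun με)) (hb : Continuous b)
    (hr : HasDerivBound univ (mOne p) b (invCharFun με)) :
    ∃ B : ℝ≥0∞, B ≠ ∞ ∧ ∀ h, 0 < h → h ≤ H →
      ∫⁻ x : ℝ, ENNReal.ofReal (|x| ^ (p - 1)) *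
          (∫⁻ y, ‖highPart k με h (x - y)‖ₑ ^ 2 ∂ν) ^ (1 / 2 : ℝ) ≤
        B * (∫⁻ w in Icc (-(1 / h)) (1 / h),
          ENNReal.ofReal ((b w / (1 + |w|)) ^ 2)) ^ (1 / 2 : ℝ) := by
  obtain ⟨A, hA, hmoment⟩ :=
    hk.exists_lintegral_one_add_pow_mul_sq_highPart_le (H := H) (mOne_le_ceil hp) hc hb hr
  obtain ⟨C, hC, hconv⟩ := exists_lintegral_rpow_mul_rpow_half_conv_le hp (sub_half_lt_mOne p)
    (lintegral_rpow_mul_rootTail_ne_top htail three_pos)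
  refine ⟨C * A ^ (1 / 2 : ℝ), ENNReal.mul_ne_top hC
    (ENNReal.rpow_ne_top_of_nonneg (by norm_num) hA), fun h hh hhH => ?_⟩
  rw [mul_assoc, ← mul_rpow_half]
  refine (hconv (fun z => ‖highPart k με h z‖ₑ ^ 2)
    ((hk.continuous_highPart hh hc).measurable.enorm.pow_const 2)).trans ?_
  gcongr
  exact hmoment h hh hhH

theorem rpow_half_lintegral_deconvCDF_sub_le (hp : 0 < p) (hk : IsKernel p k) (hh : 0 < h)
    (hb : Continuous b) (hr : HasDerivBound univ 1 b (invCharFun με)) (ν : Measure ℝ) (x a : ℝ) :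
    (∫⁻ y, ‖deconvCDF k με h (x - y) - a‖ₑ ^ 2 ∂ν) ^ (1 / 2 : ℝ) ≤
      (∫⁻ y, ‖(∫ v in Iic (x - y), lowDensity k με h v) - a‖ₑ ^ 2 ∂ν) ^ (1 / 2 : ℝ) +
        (∫⁻ y, ‖highPart k με h (x - y)‖ₑ ^ 2 ∂ν) ^ (1 / 2 : ℝ) := by
  have hlow : Continuous fun z => ∫ v in Iic z, lowDensity k με h v := continuous_integral_Iic
    (hk.integrable_invFourier_mul_symbol hp hh hb hr (contDiff_cutoff (n := 1)))
  have hhigh := hk.continuous_highPart hh hr.continuous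
  refine le_trans ?_ (rpow_half_lintegral_add_sq_le
    ((hlow.comp (continuous_sub_left x)).sub continuous_const).enorm.aemeasurable
    (Continuous.aemeasurable (by fun_prop)))
  gcongr with y
  rw [← ofReal_norm (_ - a), ← Complex.norm_real, ofReal_norm, Complex.ofReal_sub,
    hk.ofReal_deconvCDF hp hh hb hr, add_sub_right_comm]
  exact enorm_add_le _ _

theorem exists_deconvError_le (hp : 1 ≤ p) (hk : IsKernel p k) [IsProbabilityMeasure με]
    [IsProbabilityMeasure ν]
    (htail : ∫⁻ x in Ioi (0 : ℝ), ENNReal.ofReal (|x| ^ (p - 1) * √(ν.real {y | x ≤ |y|})) < ∞)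
    (hb : Continuous b) (hr₀ : HasDerivBound (Icc (-2) 2) (mZero p) (fun _ => c) (invCharFun με))
    (hr : HasDerivBound univ (mOne p) b (invCharFun με)) (hH : 0 ≤ H) :
    ∃ C : ℝ≥0∞, C ≠ ∞ ∧ ∀ h, 0 < h → h ≤ H → deconvError p k με ν h ≤
      C * (1 + (∫⁻ w in Icc (-(1 / h)) (1 / h),
        ENNReal.ofReal ((b w / (1 + |w|)) ^ 2)) ^ (1 / 2 : ℝ)) := by
  have hr₁ := hr.of_le (one_le_mOne p)
  obtain ⟨L, hL, hlow⟩ := hk.exists_lintegral_lowDensity_le hp htail hb hr₁ hr₀ hH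
  obtain ⟨B, hB, hhigh⟩ := hk.exists_lintegral_highPart_le (H := H) hp htail hr₁.continuous hb hr
  refine ⟨L + B, ENNReal.add_ne_top.2 ⟨hL, hB⟩, fun h hh hhH => ?_⟩
  set S := (∫⁻ w in Icc (-(1 / h)) (1 / h), ENNReal.ofReal ((b w / (1 + |w|)) ^ 2)) ^ (1 / 2 : ℝ)
  have hhc := (hk.continuous_highPart hh hr₁.continuous).measurable
  calc deconvError p k με ν h
      ≤ ∫⁻ x : ℝ, (ENNReal.ofReal (|x| ^ (p - 1)) * (∫⁻ y, ‖(∫ v in Iic (x - y),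
          lowDensity k με h v) - (if 0 ≤ x then 1 else 0)‖ₑ ^ 2 ∂ν) ^ (1 / 2 : ℝ) +
        ENNReal.ofReal (|x| ^ (p - 1)) *
          (∫⁻ y, ‖highPart k με h (x - y)‖ₑ ^ 2 ∂ν) ^ (1 / 2 : ℝ)) := by
        refine lintegral_mono fun x => ?_
        rw [← mul_add]
        gcongr
        simpa only [apply_ite, Complex.ofReal_one, Complex.ofReal_zero] using
          hk.rpow_half_lintegral_deconvCDF_sub_le (by linarith) hh hb hr₁ ν x
            (if 0 ≤ x then 1 else 0)
    _ ≤ L + B * S := by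
        have hm : Measurable fun x : ℝ => ENNReal.ofReal (|x| ^ (p - 1)) *
            (∫⁻ y, ‖highPart k με h (x - y)‖ₑ ^ 2 ∂ν) ^ (1 / 2 : ℝ) :=
          (measurable_ofReal_abs_rpow _).mul (Measurable.pow_const (by fun_prop) _)
        rw [lintegral_add_right _ hm]
        exact add_le_add (hlow h hh hhH) (hhigh h hh hhH)
    _ ≤ (L + B) * (1 + S) := by
        rw [mul_add, mul_one]
        exact add_le_add le_self_add (mul_le_mul' le_add_self le_rfl)

end IsKernel

end DeconvError

/-! ### The risk -/

theorem cdfLoss_triangle {p : ℝ} {F G₁ G₂ : ℝ → ℝ} (hF : Measurable F) (hG₁ : Measurable G₁) :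
    cdfLoss p G₁ G₂ ≤ cdfLoss p F G₁ + cdfLoss p F G₂ := by
  have hm : Measurable fun x => ENNReal.ofReal (|x| ^ (p - 1) * |F x - G₁ x|) :=
    ((measurable_id.abs.pow_const _).mul (hF.sub hG₁).abs).ennreal_ofReal
  rw [cdfLoss, cdfLoss, cdfLoss, ← lintegral_add_left hm]
  refine lintegral_mono fun x => ?_
  rw [← ENNReal.ofReal_add (by positivity) (by positivity), ← mul_add, abs_sub_comm (F x) (G₁ x)]
  gcongr
  exact abs_sub_le _ _ _

section Risk

variable {p ρ h H c : ℝ} {k b F : ℝ → ℝ} {μ με ν : Measure ℝ}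

theorem IsIsotoneApprox.wasserstein_rpow_le (hest : IsIsotoneApprox p ρ F ν) (hp : 1 ≤ p)
    (hF : Measurable F) (μ κ : Measure ℝ) [IsProbabilityMeasure μ] [IsProbabilityMeasure κ] :
    wasserstein p ν μ ^ p ≤ 2 ^ (p - 1) *
      (ENNReal.ofReal (4 ^ p) * (2 * cdfLoss p F (cdf (μ ∗ κ)) + ENNReal.ofReal ρ) +
        ∫⁻ x, ENNReal.ofReal (|x| ^ p) ∂κ) := by
  obtain ⟨_, hmin⟩ := hest
  refine (wasserstein_rpow_le_cdfLoss_conv_add (κ := κ) hp μ ν).trans ?_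
  gcongr
  calc cdfLoss p (cdf ν) (cdf (μ ∗ κ)) ≤ cdfLoss p F (cdf ν) + cdfLoss p F (cdf (μ ∗ κ)) :=
        cdfLoss_triangle hF (monotone_cdf ν).measurable
    _ ≤ cdfLoss p F (cdf (μ ∗ κ)) + ENNReal.ofReal ρ + cdfLoss p F (cdf (μ ∗ κ)) := by
        gcongr
        exact hmin _ inferInstance
    _ = 2 * cdfLoss p F (cdf (μ ∗ κ)) + ENNReal.ofReal ρ := by ring

namespace IsKernel

theorem continuous_prelimCDF (hp : 0 < p) (hk : IsKernel p k) (hh : 0 < h) (hb : Continuous b)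
    (hr : HasDerivBound univ 1 b (invCharFun με)) {n : ℕ} (y : Fin n → ℝ) :
    Continuous (prelimCDF k με h y) := by
  have hG := hk.continuous_deconvCDF hp hh hb hr
  exact (continuous_const.mul (continuous_finsetSum _ fun i _ =>
    hG.comp (continuous_sub_right (y i)))).congr fun t => (hk.prelimCDF_eq hp hh hb hr y t).symm

theorem lintegral_cdfLoss_prelimCDF_le (hp : 0 < p) (hk : IsKernel p k)
    [IsProbabilityMeasure μ] [IsProbabilityMeasure με] (hne : ∀ t, charFun με t ≠ 0)
    (hb : Continuous b) (hr : HasDerivBound univ 1 b (invCharFun με)) (hh : 0 < h)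
    {Ω : Type*} [MeasurableSpace Ω] {P : Measure Ω} [IsProbabilityMeasure P] {n : ℕ} (hn : 0 < n)
    {Y : Fin n → Ω → ℝ} (hY : IsPairwiseSample P (μ ∗ με) Y) :
    ∫⁻ ω, cdfLoss p (prelimCDF k με h fun i => Y i ω) (cdf (μ ∗ kernelLaw k h)) ∂P ≤
      ENNReal.ofReal ((n : ℝ) ^ (-(1 / 2) : ℝ)) * deconvError p k με (μ ∗ με) h := by
  have hG := (hk.continuous_deconvCDF hp hh hb hr).measurable
  have hbound : ∀ z, ‖deconvCDF k με h z‖ ≤ ∫ v, ‖deconvDensity k με h v‖ := fun z =>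
    (norm_integral_le_integral_norm _).trans (setIntegral_le_integral
      (hk.integrable_deconvDensity hp hh hb hr).norm (.of_forall fun v => norm_nonneg _))
  simp only [cdfLoss, hk.prelimCDF_eq hp hh hb hr]
  rw [deconvError, lintegral_lintegral_swap, ← lintegral_const_mul' _ _ ENNReal.ofReal_ne_top]
  · refine lintegral_mono fun x => ?_
    simp only [ENNReal.ofReal_mul (Real.rpow_nonneg (abs_nonneg x) (p - 1))]
    rw [lintegral_const_mul' _ _ ENNReal.ofReal_ne_top, mul_left_comm]
    gcongr
    have hGx : Measurable fun y => deconvCDF k με h (x - y) := hG.comp (measurable_const_sub x)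
    simpa only [hk.integral_deconvCDF_sub hp hh μ hne hb hr, Real.enorm_eq_ofReal_abs] using
      hY.lintegral_average_sub_le hn hGx (MemLp.of_bound hGx.aestronglyMeasurable _
        (.of_forall fun y => hbound _)) (if 0 ≤ x then 1 else 0)
  · have hsum : Measurable fun z : Ω × ℝ => ∑ i, deconvCDF k με h (z.2 - Y i z.1) :=
      Finset.measurable_sum _ fun i _ =>
        hG.comp (measurable_snd.sub ((hY.measurable i).comp measurable_fst))
    exact ((measurable_snd.abs.pow_const _).mul ((hsum.const_mul _).sub
      ((monotone_cdf _).measurable.comp measurable_snd)).abs).ennreal_ofReal.aemeasurable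

theorem lintegral_wasserstein_rpow_le (hp : 1 ≤ p) (hk : IsKernel p k)
    [IsProbabilityMeasure μ] [IsProbabilityMeasure με] (hne : ∀ t, charFun με t ≠ 0)
    (hb : Continuous b) (hr : HasDerivBound univ 1 b (invCharFun με)) (hh : 0 < h)
    {Ω : Type*} [MeasurableSpace Ω] {P : Measure Ω} [IsProbabilityMeasure P] {n : ℕ} (hn : 0 < n)
    {Y : Fin n → Ω → ℝ} (hY : IsPairwiseSample P (μ ∗ με) Y) {μt : Ω → Measure ℝ}
    (hest : ∀ ω, IsIsotoneApprox p ρ (prelimCDF k με h fun i => Y i ω) (μt ω)) :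
    ∫⁻ ω, wasserstein p (μt ω) μ ^ p ∂P ≤ 2 ^ (p - 1) * (ENNReal.ofReal (4 ^ p) *
      (2 * (ENNReal.ofReal ((n : ℝ) ^ (-(1 / 2) : ℝ)) * deconvError p k με (μ ∗ με) h) +
        ENNReal.ofReal ρ) + ENNReal.ofReal (h ^ p) * ∫⁻ x, ENNReal.ofReal (|x| ^ p * k x)) := by
  have hp0 : 0 < p := by linarith
  have := hk.isProbabilityMeasure_kernelLaw h
  set L : Ω → ℝ≥0∞ := fun ω =>
    cdfLoss p (prelimCDF k με h fun i => Y i ω) (cdf (μ ∗ kernelLaw k h))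
  set M := ENNReal.ofReal (h ^ p) * ∫⁻ x, ENNReal.ofReal (|x| ^ p * k x)
  have hmoment : ∫⁻ x, ENNReal.ofReal (|x| ^ p) ∂kernelLaw k h = M := by
    rw [lintegral_rpow_kernelLaw hk.integrable.aemeasurable, abs_of_pos hh]
  calc ∫⁻ ω, wasserstein p (μt ω) μ ^ p ∂P
      ≤ ∫⁻ ω, 2 ^ (p - 1) * (ENNReal.ofReal (4 ^ p) * (2 * L ω + ENNReal.ofReal ρ) + M) ∂P :=
        lintegral_mono fun ω => hmoment ▸ (hest ω).wasserstein_rpow_le hp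
          (hk.continuous_prelimCDF hp0 hh hb hr _).measurable μ (kernelLaw k h)
    _ = 2 ^ (p - 1) * (ENNReal.ofReal (4 ^ p) * (2 * ∫⁻ ω, L ω ∂P + ENNReal.ofReal ρ) + M) := by
        rw [lintegral_const_mul' _ _ (by simp), lintegral_add_right _ measurable_const,
          lintegral_const_mul' _ _ ENNReal.ofReal_ne_top, lintegral_add_right _ measurable_const,
          lintegral_const_mul' _ _ (by simp), lintegral_const, lintegral_const, measure_univ,
          mul_one, mul_one]
    _ ≤ _ := by
        gcongr
        exact hk.lintegral_cdfLoss_prelimCDF_le hp0 hne hb hr hh hn hY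

end IsKernel

/-- The isotone deconvolution estimator with kernel `k` and bandwidth `h`, computed from `n`
observations with tolerance at most `n ^ (-1/2)`, has risk at most `R`, whatever the probability
space and the choice of the approximate minimizer. The observations need only be pairwise
independent. -/
def IsotoneRiskLE.{u} (p : ℝ) (k : ℝ → ℝ) (μ με : Measure ℝ) (n : ℕ) (h R : ℝ) : Prop :=
  ∀ (Ω : Type u) [MeasurableSpace Ω] (P : Measure Ω) [IsProbabilityMeasure P]
    (Y : Fin n → Ω → ℝ) (ρ : ℝ) (μt : Ω → Measure ℝ),
    IsPairwiseSample P (μ ∗ με) Y → ρ ≤ (n : ℝ) ^ (-(1 / 2) : ℝ) →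
    (∀ ω, IsIsotoneApprox p ρ (prelimCDF k με h fun i => Y i ω) (μt ω)) →
    ∫⁻ ω, wasserstein p (μt ω) μ ^ p ∂P ≤ ENNReal.ofReal R

theorem IsotoneRiskLE.mono.{u} {n : ℕ} {R R' : ℝ} (hrisk : IsotoneRiskLE.{u} p k μ με n h R)
    (hR : R ≤ R') : IsotoneRiskLE.{u} p k μ με n h R' :=
  fun Ω _ P _ Y ρ μt hY hρ hest =>
    (hrisk Ω P Y ρ μt hY hρ hest).trans (ENNReal.ofReal_le_ofReal hR)

theorem IsKernel.exists_isotoneRiskLE.{u} (hp : 1 ≤ p) (hk : IsKernel p k)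
    (μ : Measure ℝ) [IsProbabilityMeasure μ] [IsProbabilityMeasure με]
    (hne : ∀ t, charFun με t ≠ 0)
    (htail : ∫⁻ x in Ioi (0 : ℝ),
      ENNReal.ofReal (|x| ^ (p - 1) * √((μ ∗ με).real {y | x ≤ |y|})) < ∞)
    (hr₀ : HasDerivBound (Icc (-2) 2) (mZero p) (fun _ => c) (invCharFun με))
    (hb : Continuous b) (hr : HasDerivBound univ (mOne p) b (invCharFun με)) (hH : 0 ≤ H) :
    ∃ K : ℝ, 0 < K ∧ ∀ (n : ℕ) (h σ : ℝ), 0 < n → 0 < h → h ≤ H → 0 ≤ σ →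
      ∫⁻ w in Icc (-(1 / h)) (1 / h), ENNReal.ofReal ((b w / (1 + |w|)) ^ 2) ≤
        ENNReal.ofReal (σ ^ 2) →
      IsotoneRiskLE.{u} p k μ με n h (K * ((n : ℝ) ^ (-(1 / 2) : ℝ) * (1 + σ) + h ^ p)) := by
  obtain ⟨C, hC, herror⟩ := hk.exists_deconvError_le (ν := μ ∗ με) hp htail hb hr₀ hr hH
  set M := ∫⁻ x, ENNReal.ofReal (|x| ^ p * k x)
  have hM_top : M ≠ ∞ := (hk.lintegral_rpow_mul_lt_top (by linarith)).ne
  set A : ℝ≥0∞ := 2 ^ (p - 1) * ENNReal.ofReal (4 ^ p)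
  have hT : (2 : ℝ≥0∞) ^ (p - 1) ≠ ∞ := by simp
  set K : ℝ≥0∞ := A * (2 * C + 1) + 2 ^ (p - 1) * M + 1 with hK
  have hK_top : K ≠ ∞ := by finiteness
  refine ⟨K.toReal, ENNReal.toReal_pos (by simp [hK]) hK_top, ?_⟩
  intro n h σ hn hh hhH hσ hS Ω _ P _ Y ρ μt hY hρ hest
  set a : ℝ := (n : ℝ) ^ (-(1 / 2) : ℝ)
  have herr : deconvError p k με (μ ∗ με) h ≤ C * (1 + ENNReal.ofReal σ) := by
    refine (herror h hh hhH).trans ?_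
    gcongr
    rw [← sq_rpow_half (ENNReal.ofReal σ), ← ENNReal.ofReal_pow hσ]
    gcongr
  calc ∫⁻ ω, wasserstein p (μt ω) μ ^ p ∂P
      ≤ 2 ^ (p - 1) * (ENNReal.ofReal (4 ^ p) *
          (2 * (ENNReal.ofReal a * deconvError p k με (μ ∗ με) h) + ENNReal.ofReal ρ) +
            ENNReal.ofReal (h ^ p) * M) :=
        hk.lintegral_wasserstein_rpow_le hp hne hb (hr.of_le (one_le_mOne p)) hh hn hY hest
    _ ≤ 2 ^ (p - 1) * (ENNReal.ofReal (4 ^ p) *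
          (2 * (ENNReal.ofReal a * (C * (1 + ENNReal.ofReal σ))) +
            ENNReal.ofReal a * (1 + ENNReal.ofReal σ)) + ENNReal.ofReal (h ^ p) * M) := by
        gcongr
        exact (ENNReal.ofReal_le_ofReal hρ).trans (le_mul_of_one_le_right zero_le le_self_add)
    _ = A * (2 * C + 1) * (ENNReal.ofReal a * (1 + ENNReal.ofReal σ)) +
          2 ^ (p - 1) * M * ENNReal.ofReal (h ^ p) := by ring
    _ ≤ K * (ENNReal.ofReal a * (1 + ENNReal.ofReal σ)) + K * ENNReal.ofReal (h ^ p) := by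
        gcongr
        · exact le_add_right le_self_add
        · exact le_add_right le_add_self
    _ = _ := by
        rw [← mul_add, ENNReal.ofReal_mul ENNReal.toReal_nonneg, ENNReal.ofReal_toReal hK_top,
          ENNReal.ofReal_add (by positivity) (by positivity), ENNReal.ofReal_mul (by positivity),
          ENNReal.ofReal_add zero_le_one hσ, ENNReal.ofReal_one]

end Risk

/-! ### The rates -/

/-- The bandwidth `n ^ (-1 / (2 p + (2 β - 1)₊))` of the ordinary smooth case. -/
def ordinaryBandwidth (p β : ℝ) (n : ℕ) : ℝ :=
  (n : ℝ) ^ (-(1 / (2 * p + max (2 * β - 1) 0)))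

/-- The bandwidth `(4 / (γ log n)) ^ (1 / β)` of the supersmooth case. -/
def supersmoothBandwidth (β γ : ℝ) (n : ℕ) : ℝ :=
  (4 / (γ * Real.log n)) ^ (1 / β)

theorem lintegral_Icc_comp_abs_le (g : ℝ → ℝ≥0∞) (T : ℝ) :
    ∫⁻ w in Icc (-T) T, g |w| ≤ 2 * ∫⁻ w in Icc 0 T, g w := by
  have hsub : Icc (-T) T ⊆ (Neg.neg ⁻¹' Icc 0 T) ∪ Icc 0 T := fun w hw => by
    rcases le_total w 0 with h | h
    · exact .inl ⟨by simpa using h, by linarith [hw.1]⟩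
    · exact .inr ⟨h, hw.2⟩
  have hpos : ∫⁻ w in Icc 0 T, g |w| = ∫⁻ w in Icc 0 T, g w :=
    setLIntegral_congr_fun measurableSet_Icc fun w hw => by rw [abs_of_nonneg hw.1]
  have hneg : ∫⁻ w in Neg.neg ⁻¹' Icc 0 T, g |w| = ∫⁻ w in Icc 0 T, g |w| := by
    simpa only [abs_neg] using
      (Measure.measurePreserving_neg (volume : Measure ℝ)).setLIntegral_comp_preimage_emb
        (MeasurableEquiv.neg ℝ).measurableEmbedding (fun w => g |w|) (Icc 0 T)
  calc _ ≤ ∫⁻ w in (Neg.neg ⁻¹' Icc 0 T) ∪ Icc 0 T, g |w| := lintegral_mono_set hsub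
    _ ≤ _ := lintegral_union_le _ _ _
    _ = _ := by rw [hneg, hpos, two_mul]

section Ordinary

variable {p β : ℝ} {n : ℕ}

theorem lintegral_Icc_sq_mul_rpow_div_le (c β : ℝ) {T : ℝ} (hT : 0 ≤ T) :
    ∫⁻ w in Icc (-T) T, ENNReal.ofReal ((c * (1 + |w|) ^ β / (1 + |w|)) ^ 2) ≤
      ENNReal.ofReal (2 * c ^ 2 * ∫ w in (1 : ℝ)..1 + T, w ^ (2 * β - 2)) := by
  have hcont : ContinuousOn (fun w : ℝ => (1 + w) ^ (2 * β - 2)) (Icc 0 T) := fun w hw =>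
    ((continuousAt_const.add continuousAt_id).rpow_const
      (.inl (add_pos_of_pos_of_nonneg one_pos hw.1).ne')).continuousWithinAt
  have hsq : ∀ w ∈ Icc (0 : ℝ) T, ENNReal.ofReal ((c * (1 + w) ^ β / (1 + w)) ^ 2) =
      ENNReal.ofReal (c ^ 2) * ENNReal.ofReal ((1 + w) ^ (2 * β - 2)) := fun w hw => by
    have h1 : 0 < 1 + w := by linarith [hw.1]
    rw [← ENNReal.ofReal_mul (sq_nonneg c), div_pow, mul_pow, Real.rpow_sub h1, mul_comm 2 β,
      Real.rpow_mul h1.le, Real.rpow_two, Real.rpow_two, mul_div_assoc]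
  have hshift : ∫ w in (1 : ℝ)..1 + T, w ^ (2 * β - 2) =
      ∫ w in Icc 0 T, (1 + w) ^ (2 * β - 2) := by
    rw [integral_Icc_eq_integral_Ioc, ← intervalIntegral.integral_of_le hT,
      intervalIntegral.integral_comp_add_left (fun w : ℝ => w ^ (2 * β - 2)), add_zero]
  have hpos : 0 ≤ᵐ[volume.restrict (Icc 0 T)] fun w : ℝ => (1 + w) ^ (2 * β - 2) := by
    filter_upwards [ae_restrict_mem measurableSet_Icc] with w hw
    exact Real.rpow_nonneg (by linarith [hw.1]) _
  refine (lintegral_Icc_comp_abs_le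
    (fun w => ENNReal.ofReal ((c * (1 + w) ^ β / (1 + w)) ^ 2)) T).trans_eq ?_
  rw [setLIntegral_congr_fun measurableSet_Icc hsq,
    lintegral_const_mul' _ _ ENNReal.ofReal_ne_top,
    ← ofReal_integral_eq_lintegral_ofReal hcont.integrableOn_Icc hpos, ← hshift, mul_assoc 2,
    ENNReal.ofReal_mul zero_le_two, ENNReal.ofReal_mul (sq_nonneg c), ENNReal.ofReal_ofNat]

theorem integral_rpow_two_mul_sub_two {T : ℝ} (hβ : β ≠ 1 / 2) (hT : 0 ≤ T) :
    ∫ w in (1 : ℝ)..1 + T, w ^ (2 * β - 2) = ((1 + T) ^ (2 * β - 1) - 1) / (2 * β - 1) := by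
  have h0 : (0 : ℝ) ∉ uIcc 1 (1 + T) := by
    rw [uIcc_of_le (by linarith)]
    exact fun h => by linarith [h.1]
  have hβ' : 2 * β - 2 ≠ -1 := fun h => hβ (by linarith)
  rw [integral_rpow (.inr ⟨hβ', h0⟩), Real.one_rpow, show 2 * β - 2 + 1 = 2 * β - 1 by ring]

theorem integral_rpow_two_mul_sub_two_nonneg {T : ℝ} (hT : 0 ≤ T) :
    0 ≤ ∫ w in (1 : ℝ)..1 + T, w ^ (2 * β - 2) :=
  intervalIntegral.integral_nonneg (by linarith) fun w hw =>
    Real.rpow_nonneg (zero_le_one.trans hw.1) _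

theorem ordinaryBandwidth_pos (hn : 0 < n) : 0 < ordinaryBandwidth p β n :=
  Real.rpow_pos_of_pos (Nat.cast_pos.2 hn) _

theorem ordinaryBandwidth_le_one (hp : 0 ≤ p) (hn : 0 < n) : ordinaryBandwidth p β n ≤ 1 := by
  have := le_max_right (2 * β - 1) 0
  exact Real.rpow_le_one_of_one_le_of_nonpos (Nat.one_le_cast.2 hn) (neg_nonpos.2 (by positivity))

theorem one_div_ordinaryBandwidth (p β : ℝ) (n : ℕ) :
    1 / ordinaryBandwidth p β n = (n : ℝ) ^ (1 / (2 * p + max (2 * β - 1) 0)) := by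
  rw [ordinaryBandwidth, Real.rpow_neg n.cast_nonneg, one_div, inv_inv]

theorem ordinaryBandwidth_rpow (p β : ℝ) (n : ℕ) :
    ordinaryBandwidth p β n ^ p = (n : ℝ) ^ (-(p / (2 * p + max (2 * β - 1) 0))) := by
  rw [ordinaryBandwidth, ← Real.rpow_mul n.cast_nonneg, neg_mul, one_div_mul_eq_div]

theorem ordinaryBandwidth_rpow_of_le (hp : p ≠ 0) (hβ : β ≤ 1 / 2) (n : ℕ) :
    ordinaryBandwidth p β n ^ p = (n : ℝ) ^ (-(1 / 2) : ℝ) := by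
  rw [ordinaryBandwidth_rpow, max_eq_right (by linarith), add_zero, div_mul_cancel_right₀ hp,
    one_div]

theorem ordinaryRate_of_lt (hβ : β < 1 / 2) : ordinaryRate p β n = (n : ℝ) ^ (-(1 / 2) : ℝ) := by
  rw [ordinaryRate, if_neg hβ.not_gt, if_neg hβ.ne, Real.rpow_neg n.cast_nonneg,
    Real.sqrt_eq_rpow, one_div]

theorem ordinaryRate_half :
    ordinaryRate p (1 / 2) n = (n : ℝ) ^ (-(1 / 2) : ℝ) * √(Real.log n) := by
  rw [ordinaryRate, if_neg (lt_irrefl _), if_pos rfl, Real.rpow_neg n.cast_nonneg,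
    ← Real.sqrt_eq_rpow, Real.sqrt_div (Real.log_natCast_nonneg n), div_eq_inv_mul]

theorem ordinaryRate_of_gt (hβ : 1 / 2 < β) :
    ordinaryRate p β n = (n : ℝ) ^ (-(p / (2 * p + (2 * β - 1)))) := by
  rw [ordinaryRate, if_pos hβ, add_sub_assoc]

theorem rpow_neg_half_le_ordinaryRate (hp : 0 ≤ p) (hn : 2 ≤ n) :
    (n : ℝ) ^ (-(1 / 2) : ℝ) ≤ 2 * ordinaryRate p β n := by
  have hn1 : (1 : ℝ) ≤ n := by exact_mod_cast one_le_two.trans hn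
  have hroot : 0 ≤ (n : ℝ) ^ (-(1 / 2) : ℝ) := by positivity
  rcases lt_trichotomy β (1 / 2) with hβ | rfl | hβ
  · rw [ordinaryRate_of_lt hβ]
    linarith
  · have hlog : Real.log 2 ≤ Real.log n := Real.log_le_log two_pos (by exact_mod_cast hn)
    have hsqrt : 1 / 2 ≤ √(Real.log n) := Real.le_sqrt_of_sq_le (by linarith [Real.log_two_gt_d9])
    rw [ordinaryRate_half]
    nlinarith
  · have hle : (n : ℝ) ^ (-(1 / 2) : ℝ) ≤ (n : ℝ) ^ (-(p / (2 * p + (2 * β - 1)))) := by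
      refine Real.rpow_le_rpow_of_exponent_le hn1 (neg_le_neg ?_)
      rw [div_le_div_iff₀ (by linarith) two_pos]
      linarith
    rw [ordinaryRate_of_gt hβ]
    linarith

theorem ordinaryBandwidth_rpow_le (hp : 0 < p) (hn : 2 ≤ n) :
    ordinaryBandwidth p β n ^ p ≤ 2 * ordinaryRate p β n := by
  rcases le_or_gt β (1 / 2) with hβ | hβ
  · rw [ordinaryBandwidth_rpow_of_le hp.ne' hβ]
    exact rpow_neg_half_le_ordinaryRate hp.le hn
  · rw [ordinaryBandwidth_rpow, max_eq_left (by linarith), ordinaryRate_of_gt hβ]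
    linarith [Real.rpow_nonneg n.cast_nonneg (-(p / (2 * p + (2 * β - 1))))]

theorem integral_ordinaryBandwidth_half_le (hp : 1 ≤ p) (hn : 2 ≤ n) :
    ∫ w in (1 : ℝ)..1 + 1 / ordinaryBandwidth p (1 / 2) n, w ^ (2 * (1 / 2) - 2 : ℝ) ≤
      2 * Real.log n := by
  have hn2 : (2 : ℝ) ≤ n := by exact_mod_cast hn
  have hT : 1 / ordinaryBandwidth p (1 / 2) n ≤ n := by
    rw [one_div_ordinaryBandwidth]
    refine Real.rpow_le_self_of_one_le (by linarith) ?_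
    rw [max_eq_right (by norm_num), add_zero, div_le_one (by positivity)]
    linarith
  have hT0 : 0 < 1 / ordinaryBandwidth p (1 / 2) n :=
    one_div_pos.2 (ordinaryBandwidth_pos (zero_lt_two.trans_le hn))
  simp only [show (2 * (1 / 2) - 2 : ℝ) = -1 by norm_num, Real.rpow_neg_one]
  rw [integral_inv_of_pos one_pos (by positivity), div_one, ← Nat.cast_two (R := ℝ),
    ← Real.log_pow]
  exact Real.log_le_log (by positivity) (by nlinarith)

theorem rpow_neg_half_mul_sqrt_integral_le_of_gt (hp : 0 ≤ p) (hβ : 1 / 2 < β) (hn : 0 < n) :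
    (n : ℝ) ^ (-(1 / 2) : ℝ) *
        √(∫ w in (1 : ℝ)..1 + 1 / ordinaryBandwidth p β n, w ^ (2 * β - 2)) ≤
      √(2 ^ (2 * β - 1) / (2 * β - 1)) * ordinaryRate p β n := by
  have hn0 : (0 : ℝ) < n := Nat.cast_pos.2 hn
  have hT : 1 ≤ 1 / ordinaryBandwidth p β n :=
    one_le_one_div (ordinaryBandwidth_pos hn) (ordinaryBandwidth_le_one hp hn)
  rw [integral_rpow_two_mul_sub_two hβ.ne' (by linarith), ordinaryRate_of_gt hβ]
  rw [one_div_ordinaryBandwidth, max_eq_left (by linarith)] at *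
  have ha0 : 0 < 2 * β - 1 := by linarith
  set a := 2 * β - 1
  set T := (n : ℝ) ^ (1 / (2 * p + a)) with hT_eq
  have hrootT : √(T ^ a) = (n : ℝ) ^ (a / (2 * (2 * p + a))) := by
    rw [hT_eq, Real.sqrt_eq_rpow, ← Real.rpow_mul hn0.le, ← Real.rpow_mul hn0.le]
    congr 1
    field_simp
  calc (n : ℝ) ^ (-(1 / 2) : ℝ) * √(((1 + T) ^ a - 1) / a)
      ≤ (n : ℝ) ^ (-(1 / 2) : ℝ) * √((2 * T) ^ a / a) := by
        have : (1 + T) ^ a ≤ (2 * T) ^ a := by gcongr; linarith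
        gcongr
        linarith
    _ = √(2 ^ a / a) * ((n : ℝ) ^ (-(1 / 2) : ℝ) * (n : ℝ) ^ (a / (2 * (2 * p + a)))) := by
        rw [Real.mul_rpow zero_le_two (by positivity), mul_div_right_comm,
          Real.sqrt_mul (by positivity), hrootT, mul_left_comm]
    _ = √(2 ^ a / a) * (n : ℝ) ^ (-(p / (2 * p + a))) := by
        rw [← Real.rpow_add hn0]
        congr 2
        field_simp
        ring

theorem exists_rpow_neg_half_mul_sqrt_integral_le (hp : 1 ≤ p) (β : ℝ) :
    ∃ D : ℝ, 0 ≤ D ∧ ∀ n : ℕ, 2 ≤ n → (n : ℝ) ^ (-(1 / 2) : ℝ) *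
        √(∫ w in (1 : ℝ)..1 + 1 / ordinaryBandwidth p β n, w ^ (2 * β - 2)) ≤
      D * ordinaryRate p β n := by
  rcases lt_trichotomy β (1 / 2) with hβ | rfl | hβ
  · refine ⟨√(1 / (1 - 2 * β)), Real.sqrt_nonneg _, fun n hn => ?_⟩
    have hT : 0 < 1 / ordinaryBandwidth p β n :=
      one_div_pos.2 (ordinaryBandwidth_pos (zero_lt_two.trans_le hn))
    have hβ' : 0 ≤ 1 - 2 * β := by linarith
    rw [ordinaryRate_of_lt hβ, integral_rpow_two_mul_sub_two hβ.ne hT.le, mul_comm,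
      ← neg_sub (1 : ℝ) ((1 + _) ^ _), ← neg_sub 1 (2 * β), neg_div_neg_eq]
    gcongr
    exact sub_le_self _ (by positivity)
  · refine ⟨√2, Real.sqrt_nonneg _, fun n hn => ?_⟩
    rw [ordinaryRate_half, mul_left_comm, ← Real.sqrt_mul zero_le_two]
    gcongr
    exact integral_ordinaryBandwidth_half_le hp hn
  · exact ⟨_, Real.sqrt_nonneg _, fun n hn =>
      rpow_neg_half_mul_sqrt_integral_le_of_gt (by linarith) hβ (zero_lt_two.trans_le hn)⟩

theorem exists_le_mul_ordinaryRate (hp : 1 ≤ p) (β c : ℝ) :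
    ∃ D : ℝ, 0 < D ∧ ∀ n : ℕ, 2 ≤ n → (n : ℝ) ^ (-(1 / 2) : ℝ) *
        (1 + √(2 * c ^ 2 *
          ∫ w in (1 : ℝ)..1 + 1 / ordinaryBandwidth p β n, w ^ (2 * β - 2))) +
        ordinaryBandwidth p β n ^ p ≤ D * ordinaryRate p β n := by
  obtain ⟨D, hD, hroot⟩ := exists_rpow_neg_half_mul_sqrt_integral_le hp β
  refine ⟨4 + √(2 * c ^ 2) * D, by positivity, fun n hn => ?_⟩
  rw [Real.sqrt_mul (by positivity), mul_add, mul_one, mul_left_comm]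
  have := mul_le_mul_of_nonneg_left (hroot n hn) (Real.sqrt_nonneg (2 * c ^ 2))
  linarith [rpow_neg_half_le_ordinaryRate (β := β) (zero_le_one.trans hp) hn,
    ordinaryBandwidth_rpow_le (β := β) (zero_lt_one.trans_le hp) hn]

end Ordinary

section Supersmooth

variable {p β γ : ℝ} {n : ℕ}

theorem lintegral_Icc_sq_le {f : ℝ → ℝ} {M T : ℝ} (hT : 0 ≤ T)
    (hf : ∀ w ∈ Icc (-T) T, |f w| ≤ M) :
    ∫⁻ w in Icc (-T) T, ENNReal.ofReal (f w ^ 2) ≤ ENNReal.ofReal ((M * (1 + T)) ^ 2) := by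
  calc ∫⁻ w in Icc (-T) T, ENNReal.ofReal (f w ^ 2)
      ≤ ∫⁻ _ in Icc (-T) T, ENNReal.ofReal (M ^ 2) :=
        setLIntegral_mono' measurableSet_Icc fun w hw => ENNReal.ofReal_le_ofReal
          (sq_le_sq.2 ((hf w hw).trans (le_abs_self M)))
    _ ≤ ENNReal.ofReal ((M * (1 + T)) ^ 2) := by
        rw [setLIntegral_const, Real.volume_Icc, ← ENNReal.ofReal_mul (sq_nonneg _), mul_pow]
        gcongr
        nlinarith

theorem exists_log_rpow_le {s t : ℝ} (hs : 0 < s) (ht : 0 < t) :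
    ∃ A : ℝ, 0 < A ∧ ∀ x : ℝ, 1 ≤ x → Real.log x ^ s ≤ A * x ^ t := by
  refine ⟨(s / t) ^ s, by positivity, fun x hx => ?_⟩
  calc Real.log x ^ s ≤ (x ^ (t / s) / (t / s)) ^ s :=
        Real.rpow_le_rpow (Real.log_nonneg hx) (Real.log_le_rpow_div (by linarith)
          (by positivity)) hs.le
    _ = (s / t) ^ s * x ^ t := by
        rw [div_eq_inv_mul, inv_div, Real.mul_rpow (by positivity) (by positivity),
          ← Real.rpow_mul (by linarith), div_mul_cancel₀ t hs.ne']

theorem log_natCast_pos (hn : 2 ≤ n) : 0 < Real.log n :=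
  Real.log_pos (by exact_mod_cast hn)

theorem supersmoothBandwidth_pos (hγ : 0 < γ) (hn : 2 ≤ n) : 0 < supersmoothBandwidth β γ n := by
  have := log_natCast_pos hn
  exact Real.rpow_pos_of_pos (by positivity) _

theorem supersmoothBandwidth_le (hβ : 0 ≤ β) (hγ : 0 < γ) (hn : 2 ≤ n) :
    supersmoothBandwidth β γ n ≤ supersmoothBandwidth β γ 2 := by
  have := log_natCast_pos hn
  have := log_natCast_pos le_rfl
  unfold supersmoothBandwidth
  gcongr

theorem supersmoothBandwidth_rpow (hγ : 0 ≤ γ) (p β : ℝ) (n : ℕ) :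
    supersmoothBandwidth β γ n ^ p = (4 / γ) ^ (p / β) * Real.log n ^ (-(p / β)) := by
  have := Real.log_natCast_nonneg n
  rw [supersmoothBandwidth, ← Real.rpow_mul (by positivity), one_div_mul_eq_div, ← div_div,
    Real.div_rpow (by positivity) this, Real.rpow_neg this, div_eq_mul_inv]

theorem one_div_supersmoothBandwidth (hγ : 0 ≤ γ) (β : ℝ) (n : ℕ) :
    1 / supersmoothBandwidth β γ n = (γ * Real.log n / 4) ^ (1 / β) := by
  have := Real.log_natCast_nonneg n
  rw [supersmoothBandwidth, one_div, ← Real.inv_rpow (by positivity), inv_div]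

theorem exists_one_add_one_div_supersmoothBandwidth_le (hβ : 0 ≤ β) (hγ : 0 < γ) :
    ∃ B : ℝ, 0 < B ∧ ∀ n : ℕ, 2 ≤ n →
      1 + 1 / supersmoothBandwidth β γ n ≤ B * Real.log n ^ (1 / β) := by
  have hlog2 := Real.log_pos one_lt_two
  refine ⟨(1 / Real.log 2) ^ (1 / β) + (γ / 4) ^ (1 / β), by positivity, fun n hn => ?_⟩
  have hlog := log_natCast_pos hn
  rw [one_div_supersmoothBandwidth hγ.le, mul_div_right_comm, Real.mul_rpow (by positivity) hlog.le,
    add_mul]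
  gcongr
  rw [← Real.mul_rpow (by positivity) hlog.le]
  refine Real.one_le_rpow ?_ (by positivity)
  rw [one_div_mul_eq_div, one_le_div hlog2]
  gcongr
  exact_mod_cast hn

theorem exp_rpow_div_le_of_abs_le_one_div_supersmoothBandwidth (hβ : 0 < β) (hγ : 0 < γ)
    (hn : 2 ≤ n) {w : ℝ} (hw : |w| ≤ 1 / supersmoothBandwidth β γ n) :
    Real.exp (|w| ^ β / γ) ≤ (n : ℝ) ^ (1 / 4 : ℝ) := by
  have hlog := log_natCast_pos hn
  have hn0 : (0 : ℝ) < n := Nat.cast_pos.2 (zero_lt_two.trans_le hn)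
  rw [Real.rpow_def_of_pos hn0, Real.exp_le_exp, div_le_iff₀ hγ]
  calc |w| ^ β ≤ (1 / supersmoothBandwidth β γ n) ^ β := by gcongr
    _ = Real.log n * (1 / 4) * γ := by
      rw [one_div_supersmoothBandwidth hγ.le, ← Real.rpow_mul (by positivity),
        one_div_mul_cancel hβ.ne', Real.rpow_one]
      ring

theorem lintegral_supersmoothBandwidth_le {βt : ℝ} (hβ : 0 < β) (hβt : 0 ≤ βt) (hγ : 0 < γ)
    (c : ℝ) (hn : 2 ≤ n) {T : ℝ} (hT : T = 1 / supersmoothBandwidth β γ n) :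
    ∫⁻ w in Icc (-T) T, ENNReal.ofReal
        ((c * (1 + |w|) ^ βt * Real.exp (|w| ^ β / γ) / (1 + |w|)) ^ 2) ≤
      ENNReal.ofReal ((|c| * (1 + T) ^ (βt + 1) * (n : ℝ) ^ (1 / 4 : ℝ)) ^ 2) := by
  have hT0 : 0 ≤ T := hT ▸ (one_div_pos.2 (supersmoothBandwidth_pos hγ hn)).le
  convert lintegral_Icc_sq_le (M := |c| * (1 + T) ^ βt * (n : ℝ) ^ (1 / 4 : ℝ)) hT0
    fun w hw => ?_ using 3
  · rw [Real.rpow_add_one (by positivity)]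
    ring
  · have hw' : |w| ≤ T := abs_le.2 hw
    rw [abs_div, abs_mul, abs_mul, Real.abs_exp, Real.abs_rpow_of_nonneg (by positivity),
      abs_of_nonneg (by positivity : 0 ≤ 1 + |w|)]
    refine (div_le_self (by positivity) (by linarith [abs_nonneg w])).trans ?_
    gcongr
    exact exp_rpow_div_le_of_abs_le_one_div_supersmoothBandwidth hβ hγ hn (hT ▸ hw')

theorem exists_one_add_one_div_supersmoothBandwidth_rpow_mul_le {s : ℝ} (hp : 0 ≤ p)
    (hβ : 0 < β) (hγ : 0 < γ) (hs : 0 < s) :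
    ∃ D : ℝ, 0 < D ∧ ∀ n : ℕ, 2 ≤ n →
      (1 + 1 / supersmoothBandwidth β γ n) ^ s * (n : ℝ) ^ (-(1 / 4) : ℝ) ≤
        D * Real.log n ^ (-(p / β)) := by
  obtain ⟨B, hB, hTB⟩ := exists_one_add_one_div_supersmoothBandwidth_le hβ.le hγ
  obtain ⟨A, hA, hlogA⟩ := exists_log_rpow_le (s := s / β + p / β) (t := 1 / 4)
    (by positivity) (by norm_num)
  refine ⟨B ^ s * A, by positivity, fun n hn => ?_⟩
  have hn1 : (1 : ℝ) ≤ n := by exact_mod_cast one_le_two.trans hn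
  have hT := one_div_pos.2 (supersmoothBandwidth_pos (β := β) hγ hn)
  have hL := log_natCast_pos hn
  rw [Real.rpow_neg n.cast_nonneg, Real.rpow_neg hL.le, ← div_eq_mul_inv, ← div_eq_mul_inv,
    div_le_div_iff₀ (by positivity) (by positivity)]
  set L := Real.log n
  calc (1 + 1 / supersmoothBandwidth β γ n) ^ s * L ^ (p / β)
      ≤ (B * L ^ (1 / β)) ^ s * L ^ (p / β) := by
        gcongr ?_ ^ s * _
        exact hTB n hn
    _ = B ^ s * L ^ (s / β + p / β) := by
        rw [Real.mul_rpow hB.le (by positivity), ← Real.rpow_mul hL.le, one_div_mul_eq_div,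
          Real.rpow_add hL, mul_assoc]
    _ ≤ B ^ s * A * (n : ℝ) ^ (1 / 4 : ℝ) := by
        rw [mul_assoc]
        gcongr
        exact hlogA n hn1

theorem exists_le_mul_log_rpow_neg {βt : ℝ} (hp : 0 ≤ p) (hβ : 0 < β) (hβt : 0 ≤ βt)
    (hγ : 0 < γ) (c : ℝ) :
    ∃ D : ℝ, 0 < D ∧ ∀ n : ℕ, 2 ≤ n → (n : ℝ) ^ (-(1 / 2) : ℝ) *
        (1 + |c| * (1 + 1 / supersmoothBandwidth β γ n) ^ (βt + 1) * (n : ℝ) ^ (1 / 4 : ℝ)) +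
      supersmoothBandwidth β γ n ^ p ≤ D * Real.log n ^ (-(p / β)) := by
  obtain ⟨D, hD, hVD⟩ := exists_one_add_one_div_supersmoothBandwidth_rpow_mul_le
    (s := βt + 1) hp hβ hγ (by positivity)
  refine ⟨(1 + |c|) * D + (4 / γ) ^ (p / β), by positivity, fun n hn => ?_⟩
  have hn1 : (1 : ℝ) ≤ n := by exact_mod_cast one_le_two.trans hn
  have hT := one_div_pos.2 (supersmoothBandwidth_pos (β := β) hγ hn)
  have hV := hVD n hn
  set V := (1 + 1 / supersmoothBandwidth β γ n) ^ (βt + 1)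
  have hV1 : 1 ≤ V := Real.one_le_rpow (by linarith) (by linarith)
  have hpow : (n : ℝ) ^ (-(1 / 2) : ℝ) * (n : ℝ) ^ (1 / 4 : ℝ) = (n : ℝ) ^ (-(1 / 4) : ℝ) := by
    rw [← Real.rpow_add (by linarith)]
    norm_num
  rw [supersmoothBandwidth_rpow hγ.le, add_mul]
  gcongr ?_ + _
  calc (n : ℝ) ^ (-(1 / 2) : ℝ) * (1 + |c| * V * (n : ℝ) ^ (1 / 4 : ℝ))
      = (n : ℝ) ^ (-(1 / 2) : ℝ) * 1 + |c| * V * (n : ℝ) ^ (-(1 / 4) : ℝ) := by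
        rw [← hpow]
        ring
    _ ≤ (n : ℝ) ^ (-(1 / 4) : ℝ) * V + |c| * V * (n : ℝ) ^ (-(1 / 4) : ℝ) := by
        gcongr
        norm_num
    _ = (1 + |c|) * (V * (n : ℝ) ^ (-(1 / 4) : ℝ)) := by ring
    _ ≤ (1 + |c|) * D * Real.log n ^ (-(p / β)) := by
        rw [mul_assoc]
        gcongr

end Supersmooth

namespace IsKernel

variable {p c₀ : ℝ} {k : ℝ → ℝ} {με : Measure ℝ}

theorem exists_isotoneRiskLE_supersmooth.{u} (hp : 1 ≤ p) (hk : IsKernel p k)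
    (μ : Measure ℝ) [IsProbabilityMeasure μ] [IsProbabilityMeasure με]
    (hne : ∀ t, charFun με t ≠ 0)
    (htail : ∫⁻ x in Ioi (0 : ℝ),
      ENNReal.ofReal (|x| ^ (p - 1) * √((μ ∗ με).real {y | x ≤ |y|})) < ∞)
    (hr₀ : HasDerivBound (Icc (-2) 2) (mZero p) (fun _ => c₀) (invCharFun με))
    {β βt γ c : ℝ} (hβ : 0 < β) (hβt : 0 ≤ βt) (hγ : 0 < γ)
    (hr : HasDerivBound univ (mOne p)
      (fun t => c * (1 + |t|) ^ βt * Real.exp (|t| ^ β / γ)) (invCharFun με)) :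
    ∃ C : ℝ, 0 < C ∧ ∀ n : ℕ, 2 ≤ n →
      IsotoneRiskLE.{u} p k μ με n (supersmoothBandwidth β γ n)
        (C * Real.log n ^ (-(p / β))) := by
  have hb : Continuous fun t : ℝ => c * (1 + |t|) ^ βt * Real.exp (|t| ^ β / γ) := by
    have hpoly : Continuous fun t : ℝ => (1 + |t|) ^ βt :=
      (continuous_const.add continuous_abs).rpow_const fun _ => .inr hβt
    have hpow : Continuous fun t : ℝ => |t| ^ β := continuous_abs.rpow_const fun _ => .inr hβ.le
    exact (continuous_const.mul hpoly).mul (Real.continuous_exp.comp (hpow.div_const γ))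
  obtain ⟨D, hD, hrate⟩ := exists_le_mul_log_rpow_neg (by linarith : 0 ≤ p) hβ hβt hγ c
  obtain ⟨K, hK, hrisk⟩ := hk.exists_isotoneRiskLE.{u} hp μ hne htail hr₀ hb hr
    (supersmoothBandwidth_pos (β := β) hγ le_rfl).le
  refine ⟨K * D, mul_pos hK hD, fun n hn => ?_⟩
  have hh := supersmoothBandwidth_pos (β := β) hγ hn
  refine (hrisk n _ _ (zero_lt_two.trans_le hn) hh (supersmoothBandwidth_le hβ.le hγ hn)
    (by positivity) (lintegral_supersmoothBandwidth_le hβ hβt hγ c hn rfl)).mono ?_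
  exact (mul_le_mul_of_nonneg_left (hrate n hn) hK.le).trans_eq (mul_assoc _ _ _).symm

theorem exists_isotoneRiskLE_ordinary.{u} (hp : 1 ≤ p) (hk : IsKernel p k)
    (μ : Measure ℝ) [IsProbabilityMeasure μ] [IsProbabilityMeasure με]
    (hne : ∀ t, charFun με t ≠ 0)
    (htail : ∫⁻ x in Ioi (0 : ℝ),
      ENNReal.ofReal (|x| ^ (p - 1) * √((μ ∗ με).real {y | x ≤ |y|})) < ∞)
    (hr₀ : HasDerivBound (Icc (-2) 2) (mZero p) (fun _ => c₀) (invCharFun με)) {β c : ℝ}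
    (hr : HasDerivBound univ (mOne p) (fun t => c * (1 + |t|) ^ β) (invCharFun με)) :
    ∃ C : ℝ, 0 < C ∧ ∀ n : ℕ, 2 ≤ n →
      IsotoneRiskLE.{u} p k μ με n (ordinaryBandwidth p β n) (C * ordinaryRate p β n) := by
  have hb : Continuous fun t : ℝ => c * (1 + |t|) ^ β :=
    continuous_const.mul ((continuous_const.add continuous_abs).rpow_const fun t =>
      .inl (by positivity : 0 < 1 + |t|).ne')
  obtain ⟨D, hD, hrate⟩ := exists_le_mul_ordinaryRate hp β c
  obtain ⟨K, hK, hrisk⟩ := hk.exists_isotoneRiskLE.{u} hp μ hne htail hr₀ hb hr zero_le_one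
  refine ⟨K * D, mul_pos hK hD, fun n hn => ?_⟩
  have hn0 := zero_lt_two.trans_le hn
  have hT := (one_div_pos.2 (ordinaryBandwidth_pos (p := p) (β := β) hn0)).le
  have hvar := lintegral_Icc_sq_mul_rpow_div_le c β hT
  have hint := integral_rpow_two_mul_sub_two_nonneg (β := β) hT
  rw [← Real.sq_sqrt (mul_nonneg (by positivity) hint)] at hvar
  refine (hrisk n _ _ hn0 (ordinaryBandwidth_pos hn0)
    (ordinaryBandwidth_le_one (by linarith) hn0) (Real.sqrt_nonneg _) hvar).mono ?_
  exact (mul_le_mul_of_nonneg_left (hrate n hn) hK.le).trans_eq (mul_assoc _ _ _).symm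

end IsKernel

end WassersteinDeconvolution

end

open WassersteinDeconvolution in
theorem theorem1_general.{u, v}
    (p : ℝ) (hp : 1 ≤ p) (k : ℝ → ℝ) (hk : IsKernel p k)
    (μ με : Measure ℝ) [IsProbabilityMeasure μ] [IsProbabilityMeasure με]
    (hne : ∀ t, charFun με t ≠ 0)
    (hdiff₁ : ∀ ℓ < mOne p, Differentiable ℝ (iteratedDeriv ℓ (invCharFun με)))
    (hdiff₀ : ∀ ℓ < mZero p, ∀ t ∈ Icc (-2 : ℝ) 2,
      DifferentiableAt ℝ (iteratedDeriv ℓ (invCharFun με)) t)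
    (htail : ∫⁻ x in Ioi (0 : ℝ),
      ENNReal.ofReal (|x| ^ (p - 1) * √((μ.conv με).real {y | x ≤ |y|})) < ∞)
    (hsup : ∃ M : ℝ, ∀ t ∈ Icc (-2 : ℝ) 2, ‖iteratedDeriv (mZero p) (invCharFun με) t‖ ≤ M) :
    (∀ β βt γ c : ℝ, 0 < β → 0 ≤ βt → 0 < γ →
      (∀ ℓ ≤ mOne p, ∀ t : ℝ, ‖iteratedDeriv ℓ (invCharFun με) t‖ ≤
        c * (1 + |t|) ^ βt * Real.exp (|t| ^ β / γ)) →
      ∃ C : ℝ, 0 < C ∧ ∀ n : ℕ, 2 ≤ n →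
        IsotoneRiskLE.{u} p k μ με n (supersmoothBandwidth β γ n)
          (C * Real.log n ^ (-(p / β)))) ∧
    (∀ β c : ℝ,
      (∀ ℓ ≤ mOne p, ∀ t : ℝ, ‖iteratedDeriv ℓ (invCharFun με) t‖ ≤ c * (1 + |t|) ^ β) →
      ∃ C : ℝ, 0 < C ∧ ∀ n : ℕ, 2 ≤ n →
        IsotoneRiskLE.{v} p k μ με n (ordinaryBandwidth p β n) (C * ordinaryRate p β n)) := by
  obtain ⟨_, _, hr₀⟩ := HasDerivBound.exists_of_isCompact isCompact_Icc hdiff₀ hsup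
  have hdiff : ∀ ℓ < mOne p, ∀ t ∈ univ, DifferentiableAt ℝ (iteratedDeriv ℓ (invCharFun με)) t :=
    fun ℓ hℓ t _ => hdiff₁ ℓ hℓ t
  refine ⟨fun β βt γ c hβ hβt hγ hr => ?_, fun β c hr => ?_⟩
  · exact hk.exists_isotoneRiskLE_supersmooth hp μ hne htail hr₀ hβ hβt hγ
      ⟨hdiff, fun ℓ hℓ t _ => hr ℓ hℓ t⟩
  · exact hk.exists_isotoneRiskLE_ordinary hp μ hne htail hr₀
      ⟨hdiff, fun ℓ hℓ t _ => hr ℓ hℓ t⟩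

open WassersteinDeconvolution in
theorem theorem1
    (p : ℝ) (hp : 1 ≤ p)
    -- the kernel, the unknown law `μ` and the known noise law `με`
    (k : ℝ → ℝ) (hk : IsKernel p k)
    (μ με : Measure ℝ) [IsProbabilityMeasure μ] [IsProbabilityMeasure με]
    -- `r = 1 / με^*` is well defined and twice continuously differentiable
    (hne : ∀ t, charFun με t ≠ 0)
    (hC2 : ContDiff ℝ 2 (invCharFun με))
    -- the derivatives of `r` that occur below exist
    (hdiff₁ : ∀ ℓ < mOne p, Differentiable ℝ (iteratedDeriv ℓ (invCharFun με)))
    (hdiff₀ : ∀ ℓ < mZero p, ∀ t ∈ Icc (-2 : ℝ) 2,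
      DifferentiableAt ℝ (iteratedDeriv ℓ (invCharFun με)) t)
    -- the tail condition, `μ ∗ με` being the law of the observations
    (htail : ∫⁻ x in Ioi (0 : ℝ),
      ENNReal.ofReal (|x| ^ (p - 1) * √((μ.conv με).real {y | x ≤ |y|})) < ∞)
    (hsup : ∃ M : ℝ, ∀ t ∈ Icc (-2 : ℝ) 2, ‖iteratedDeriv (mZero p) (invCharFun με) t‖ ≤ M) :
    -- the supersmooth case
    (∀ β βt γ c : ℝ, 0 < β → 0 ≤ βt → 0 < γ → 0 < c →
      (∀ ℓ ≤ mOne p, ∀ t : ℝ, ‖iteratedDeriv ℓ (invCharFun με) t‖ ≤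
        c * (1 + |t|) ^ βt * Real.exp (|t| ^ β / γ)) →
      ∃ C : ℝ, 0 < C ∧ ∀ n : ℕ, 2 ≤ n →
        ∀ (Ω : Type*) [MeasurableSpace Ω] (P : Measure Ω) [IsProbabilityMeasure P]
          (X ε : Fin n → Ω → ℝ) (ρ : ℝ) (μt : Ω → Measure ℝ),
          IsConvolutionSample P μ με X ε →
          0 ≤ ρ → ρ ≤ (n : ℝ) ^ (-(1 / 2) : ℝ) →
          IsIsotoneEstimator p ρ k με ((4 / (γ * Real.log n)) ^ (1 / β)) X ε μt →
          ∫⁻ ω, wasserstein p (μt ω) μ ^ p ∂P ≤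
            ENNReal.ofReal (C * Real.log n ^ (-(p / β)))) ∧
    -- the ordinary smooth case
    (∀ β c : ℝ, 0 < β → 0 < c →
      (∀ ℓ ≤ mOne p, ∀ t : ℝ, ‖iteratedDeriv ℓ (invCharFun με) t‖ ≤ c * (1 + |t|) ^ β) →
      ∃ C : ℝ, 0 < C ∧ ∀ n : ℕ, 2 ≤ n →
        ∀ (Ω : Type*) [MeasurableSpace Ω] (P : Measure Ω) [IsProbabilityMeasure P]
          (X ε : Fin n → Ω → ℝ) (ρ : ℝ) (μt : Ω → Measure ℝ),
          IsConvolutionSample P μ με X ε →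
          0 ≤ ρ → ρ ≤ (n : ℝ) ^ (-(1 / 2) : ℝ) →
          IsIsotoneEstimator p ρ k με ((n : ℝ) ^ (-(1 / (2 * p + max (2 * β - 1) 0)))) X ε μt →
          ∫⁻ ω, wasserstein p (μt ω) μ ^ p ∂P ≤ ENNReal.ofReal (C * ordinaryRate p β n)) := by
  obtain ⟨hsuper, hordinary⟩ := theorem1_general p hp k hk μ με hne hdiff₁ hdiff₀ htail hsup
  refine ⟨fun β βt γ c hβ hβt hγ _ hr => ?_, fun β c _ _ hr => ?_⟩
  · exact (hsuper β βt γ c hβ hβt hγ hr).imp fun C hC => ⟨hC.1, fun n hn Ω _ P _ X ε ρ μt hs _ hρ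
      hest => hC.2 n hn Ω P _ ρ μt hs.isPairwiseSample hρ hest⟩
  · exact (hordinary β c hr).imp fun C hC => ⟨hC.1, fun n hn Ω _ P _ X ε ρ μt hs _ hρ
      hest => hC.2 n hn Ω P _ ρ μt hs.isPairwiseSample hρ hest⟩
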